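/- **Setting.** Fix a finite alphabet $\Sigma$ and $\varepsilon>0$. Let $\Omega=\{\$\}\cup\Sigma\cup\{c_1,c_2,\dots\}$. An input $x$ is $\$$ followed by a word over $\Sigma\cup\{c_1,c_2,\dots\}$; $|x|$ is its length including $\$$. Let $\mathcal F(\Omega)$ be the set of maps $f$ sending each input $x$ to a matrix $f(x)\in\mathbb R^{|x|\times\Omega}$. **Transformers.** A transformer $T$ with context window $N\in\mathbb N\cup\{\infty\}$ on a real Hilbert space $\mathcal H$ has $L$ layers, $H$ heads, $m$ hidden units per MLP, precisions $p,r\in\mathbb N$, embeddings $E_\omega\in\mathcal H$ for $\omega\in\Omega_N=\{\$\}\cup\Sigma\cup\{c_k:k\le N\}$ (only finite $k$ when $N=\infty$), positional encodings $p_i\in\mathcal H$ (finite $i\le N$), bounded linear maps $K_{l,h},Q_{l,h},V_{l,h}:\mathcal H\to\mathcal H$, $A_l:\mathcal H\to\mathbb R^m$, $B_l:\mathbb R^m\to\mathcal H$, vectors $b_l\in\mathbb R^m$, and a bounded linear map $U:\mathcal H\to\ell^2(\Omega_N)$ with rows $U_\omega$. At offsets $o_p,o_c\ge0$ set $y^{(0)}_i=E_{x_i}+p_{i+o_p}$,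 where $E_{x_i}$ is replaced by $E_{c_{k+o_c}}$ if $x_i=c_k$. In layer $l$ the logits $\langle K_{l,h}y_j,Q_{l,h}y_i\rangle$ ($j\le i$, $y=y^{(l-1)}$) are rounded to $r$ fractional bits, giving $a_{ij}$; $w_{ij}$ is $\exp(\log|x|\cdot a_{ij})$ rounded to $r$ fractional bits; $Y_i=y_i+\sum_h(\sum_{j\le i}w_{ij}V_{l,h}y_j)/(\sum_{j\le i}w_{ij})$ (a head with zero denominator contributes $0$); and $y^{(l)}_i=Y_i+B_l\,\psi_l(A_lY_i+b_l)$, where each coordinate of $\psi_l$ is ReLU, Heaviside ($t\mapsto 1$ if $t\ge 0$, else $0$) or $t\mapsto 1/(t+\varepsilon)$ (with $1/0=0$). The output $T(x,o_p,o_c)_{i,\omega}$ is $U_\omega y^{(L)}_i$ for $\omega\in\Sigma\cup\{\$\}$ and $U_{c_{k+o_c}}y_i^{(L)}$ for $\omega=c_k$. **Product functions.** Let $\mathcal P$ be the collection of sets $\mathcal S$ of value matrices $V_{l,h}$ with at most one from each layer, and let $\prod\mathcal S$ be their product, lowest layer at the right. For $v,w$ ranging over the $p_i$, the $E_\omega$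 and the columns of the $B_l$, the product functions are $\langle K_{l,h}\prod\mathcal S_1v,\,Q_{l,h}\prod\mathcal S_2w\rangle$ (attention), $U_\omega\prod\mathcal S\,w$ (unembedding) and $(A_l)_{s,\cdot}\prod\mathcal S\,w$ (MLP). They are *translation invariant* if attention products of $(p_i,p_j)$ and of $(c_i,c_j)$ and unembedding products of $(U_{c_i},c_j)$ depend only on $i-j$ (here $c_k$ also denotes $E_{c_k}$), and every other product function is independent of the indices of all positions and extended symbols occurring in it. They are *local* if for some $\Delta$ those first three kinds vanish for $|i-j|>\Delta$. A *Symbolic Limit Transformer* is a transformer with $N=\infty$ such that $\sup_i\|p_i\|<\infty$, $\sup_k\|E_{c_k}\|<\infty$, all product functions and the entries of the $b_l$ are integer multiples of $2^{-p}$, and the product functions are translation invariant and local. It *expresses* $f$ if $T(x,0,0)=f(x)$ for all $x$. **Hypothesis class and regularizer.** $\Theta_n$ ($n\ge1$) is the set of transformers with $N=n$, $\mathcal H=\mathbb R^d$, $m=d$ for some $d$, all of whose parameter entries are integer multiples of $2^{-p}$ and whose product functions are translation invariant. For $T\in\Theta_n$ let $$\mathcal R(T)=L+H+p+r+\max_{l,h}\|K_{l,h}^{\top}Q_{l,h}\|+\max_{l,h}\|V_{l,h}\|+\max_l\|A_l\|_F+\max_l\|B_l\|_F+\|U\|+\max_i\|p_i\|+\max_{\omega}\|E_\omega\|+\max_l\|b_l\|+\zeta(T),$$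 where norms of matrices without index are spectral norms, and $\zeta(T)$ is the sum, over all $l,h,\mathcal S_1,\mathcal S_2$, of the squares of the attention products of the pairs $(p_1,p_j)$, $j\le n$, and of the pairs $(c_i,c_j)$ with $i,j\le n$ and $\min(i,j)=1$, plus the sum, over all $\mathcal S$, of the squares of the unembedding products of $(U_{c_i},c_j)$ with $i,j\le n$ and $\min(i,j)=1$. **Inference.** $T\in\Theta_n$ *matches* $f$ on $x$ if for all $o_p,o_c\ge0$ with $|x|+o_p\le n$, $|x|+o_c\le n$ and $k+o_c\le n$ for every $c_k$ in $x$, $T(x,o_p,o_c)_{i,\omega}=f(x)_{i,\omega}$ for all $i\le |x|$ and all $\omega\in\Sigma\cup\{\$\}\cup\{c_k:k+o_c\le n\}$. Let $U_n^0$ be the set of $T\in\Theta_n$ with all $p_i=0$ that match $f$ on all inputs $x$ over $\Omega_n$ with $|x|\le n/2$ such that any two indices of extended symbols in $x$ differ by at most $n/2$. A *NoPE inference sequence* for $f$ is a sequence $T_1,T_2,\dots$ with $T_n\in U_n^0$ and $\mathcal R(T_n)\le\frac1n+\inf_{T\in U^0_n}\mathcal R(T)$ for all $n\ge1$. **Corollary.**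 Let $f\in\mathcal F(\Omega)$. The following are equivalent. 1. $f$ is expressed by a Symbolic Limit Transformer with all $p_i=0$. 2. There is a NoPE inference sequence for $f$, and for every such sequence $T_1,T_2,\dots$ one has $\sup_n\mathcal R(T_n)<\infty$ and there is $N_0$ such that for all $n>N_0$, $T_n$ matches $f$ on all inputs $x$ over $\Omega_n$ of length $|x|\le n$. -/

import Mathlib

open scoped BigOperators ENNReal InnerProductSpace

noncomputable section

namespace SymbolicLimit

universe u

/-- The indices of the positional encodings and of the extended symbols available in a context
window of size `N`.  Indices start at `0`, so slot `k` stands for `p_{k+1}`, resp. `c_{k+1}`. -/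
abbrev Slot (N : ℕ∞) : Type := {k : ℕ // (k : ℕ∞) < N}

instance slotFintype (n : ℕ) : Fintype (Slot (n : ℕ∞)) :=
  Fintype.ofInjective (fun k : Slot (n : ℕ∞) => (⟨k.1, by exact_mod_cast k.2⟩ : Fin n))
    (fun a b h => Subtype.ext (congrArg Fin.val h))

/-- The vocabulary: the start symbol, the finite alphabet `S`, and extended symbols
indexed by `ι`. -/
inductive Vocab (S : Type u) (ι : Type) : Type u
  | start : Vocab S ι
  | sym (a : S) : Vocab S ι
  | ext (k : ι) : Vocab S ι

/-- An input is the start symbol followed by a word over `S` and the extended symbols;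
only the part after the start symbol is recorded. -/
abbrev Word (S : Type u) : Type u := List (S ⊕ ℕ)

/-- The length `|x|` of the input, counting the start symbol. -/
def inputLength {S : Type u} (w : Word S) : ℕ := w.length + 1

/-- The symbols of the input, the start symbol first. -/
def inputToken {S : Type u} (w : Word S) : Fin (inputLength w) → Vocab S ℕ :=
  Fin.cons Vocab.start (fun i => Sum.elim Vocab.sym Vocab.ext (w.get i))

/-- Maps sending an input `x` to a matrix of size `|x| × |Ω|` of next-token logits. -/
abbrev Task (S : Type u) : Type u :=
  (w : Word S) → Fin (inputLength w) → Vocab S ℕ → ℝ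

/-- The activation functions that each coordinate of an MLP may use. -/
inductive Act : Type
  | relu : Act
  | heaviside : Act
  | recip : Act

/-- Evaluation of an activation function; `ε` is the constant of the reciprocal activation. -/
def Act.eval (ε : ℝ) : Act → ℝ → ℝ
  | .relu, x => max x 0
  | .heaviside, x => if 0 ≤ x then 1 else 0
  | .recip, x => 1 / (x + ε)

/-- `x` is a number with `p` fractional bits. -/
def IsBit (p : ℕ) (x : ℝ) : Prop := ∃ z : ℤ, x = (z : ℝ) / 2 ^ p

/-- Rounding to `p` fractional bits. -/
def roundTo (p : ℕ) (x : ℝ) : ℝ := (round (x * 2 ^ p) : ℝ) / 2 ^ p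

/-- A transformer over the finite alphabet `S` with context window `N`, residual space `H` and
`m` hidden units in every MLP.  The embedding of an extended symbol is `c k = emb (ext k)`;
row `ω` of the unembedding is the functional `y ↦ U y ω`.  The number `prec` is the precision of
the parameters (of the product functions, when the context window is infinite), and `roundPrec`
is the precision to which attention logits and outputs of `exp` are rounded. -/
structure Transformer (S : Type u) (N : ℕ∞) (H : Type) [NormedAddCommGroup H]
    [InnerProductSpace ℝ H] (m : ℕ) where
  layers : ℕ
  heads : ℕ
  prec : ℕ
  roundPrec : ℕ
  emb : Vocab S (Slot N) → H
  pos : Slot N → H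
  K : Fin layers → Fin heads → (H →L[ℝ] H)
  Q : Fin layers → Fin heads → (H →L[ℝ] H)
  V : Fin layers → Fin heads → (H →L[ℝ] H)
  A : Fin layers → (H →L[ℝ] EuclideanSpace ℝ (Fin m))
  B : Fin layers → (EuclideanSpace ℝ (Fin m) →L[ℝ] H)
  b : Fin layers → EuclideanSpace ℝ (Fin m)
  act : Fin layers → Fin m → Act
  U : H →L[ℝ] lp (fun _ : Vocab S (Slot N) => ℝ) 2

/-- Names of the vectors that are written into the residual stream: positional encodings,
token embeddings and columns of the output matrices of the MLPs. -/
inductive Source (S : Type u) (N : ℕ∞) (L m : ℕ) : Type u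
  | pos (i : Slot N) : Source S N L m
  | tok (ω : Vocab S (Slot N)) : Source S N L m
  | mlp (l : Fin L) (s : Fin m) : Source S N L m

/-- Two vocabulary items agree up to the index of an extended symbol. -/
def Vocab.SameKind {S : Type u} {ι : Type} : Vocab S ι → Vocab S ι → Prop
  | .ext _, .ext _ => True
  | a, b => a = b

/-- Two sources agree up to the index of a positional encoding or of an extended symbol. -/
def Source.SameKind {S : Type u} {N : ℕ∞} {L m : ℕ} : Source S N L m → Source S N L m → Prop
  | .pos _, .pos _ => True
  | .tok a, .tok b => a.SameKind b
  | a, b => a = b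

/-- The vocabulary item is an extended symbol. -/
def Vocab.IsExt {S : Type u} {ι : Type} : Vocab S ι → Prop
  | .ext _ => True
  | _ => False

/-- The source is a positional encoding. -/
def Source.IsPos {S : Type u} {N : ℕ∞} {L m : ℕ} : Source S N L m → Prop
  | .pos _ => True
  | _ => False

/-- The source is the embedding of an extended symbol. -/
def Source.IsExt {S : Type u} {N : ℕ∞} {L m : ℕ} : Source S N L m → Prop
  | .tok a => a.IsExt
  | _ => False

namespace Transformer

variable {S : Type u} {N : ℕ∞} {H : Type} [NormedAddCommGroup H] [InnerProductSpace ℝ H] {m : ℕ}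

/-! ### Computation -/

/-- Rounded attention logit, at query activation `yi` and key activation `yj`. -/
def logit (T : Transformer S N H m) (l : Fin T.layers) (h : Fin T.heads) (yi yj : H) : ℝ :=
  roundTo T.roundPrec ⟪T.K l h yj, T.Q l h yi⟫_ℝ

/-- Rounded output of `exp`, in an input of length `n`. -/
def weight (T : Transformer S N H m) (n : ℕ) (l : Fin T.layers) (h : Fin T.heads)
    (yi yj : H) : ℝ :=
  roundTo T.roundPrec (Real.exp (Real.log n * T.logit l h yi yj))

/-- The attention block of layer `l`: causal softmax attention, scaled by `log n`, added to the
residual stream.  (A head all of whose rounded weights vanish contributes `0`.) -/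
def attention (T : Transformer S N H m) {n : ℕ} (l : Fin T.layers) (y : Fin n → H) :
    Fin n → H := fun i =>
  y i + ∑ h : Fin T.heads,
    (∑ j ∈ Finset.Iic i, T.weight n l h (y i) (y j))⁻¹ •
      ∑ j ∈ Finset.Iic i, T.weight n l h (y i) (y j) • T.V l h (y j)

/-- The MLP of layer `l`, added to the residual stream. -/
def mlp (T : Transformer S N H m) (ε : ℝ) (l : Fin T.layers) (Y : H) : H :=
  Y + T.B l (WithLp.toLp 2 (fun s => (T.act l s).eval ε (T.A l Y s + T.b l s)))

/-- One layer. -/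
def layer (T : Transformer S N H m) (ε : ℝ) {n : ℕ} (l : Fin T.layers) (y : Fin n → H) :
    Fin n → H := fun i => T.mlp ε l (T.attention l y i)

/-- All layers, in increasing order. -/
def final (T : Transformer S N H m) (ε : ℝ) {n : ℕ} (y : Fin n → H) : Fin n → H :=
  (List.finRange T.layers).foldl (fun y l => T.layer ε l y) y

/-- The vocabulary item of `T` that represents an item of the full vocabulary when the indices of
extended symbols are shifted by `oc`; `none` if it falls outside of the context window. -/
def shifted (N : ℕ∞) (oc : ℕ) : Vocab S ℕ → Option (Vocab S (Slot N))
  | .start => some .start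
  | .sym a => some (.sym a)
  | .ext k => open Classical in
      if h : ((k + oc : ℕ) : ℕ∞) < N then some (.ext ⟨k + oc, h⟩) else none

/-- The token embedding at character offset `oc`; it is used only inside the context window. -/
def embAt (T : Transformer S N H m) (oc : ℕ) (ω : Vocab S ℕ) : H :=
  (shifted N oc ω).elim 0 T.emb

/-- The positional encoding with index `i`; it is used only inside the context window. -/
def posAt (T : Transformer S N H m) (i : ℕ) : H := open Classical in
  if h : (i : ℕ∞) < N then T.pos ⟨i, h⟩ else 0

/-- The initial activations of the input, at positional offset `op` and character offset `oc`. -/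
def init (T : Transformer S N H m) (op oc : ℕ) (w : Word S) : Fin (inputLength w) → H := fun i =>
  T.embAt oc (inputToken w i) + T.posAt (i + op)

/-- The next-token logits of `T`.  The character offset renames the extended symbols, both on
input and on output: the symbol with index `k` is represented by the one with index `k + oc`. -/
def logits (T : Transformer S N H m) (ε : ℝ) (op oc : ℕ) (w : Word S)
    (i : Fin (inputLength w)) (ω : Vocab S ℕ) : ℝ :=
  (shifted N oc ω).elim 0 (fun ω' => T.U (T.final ε (T.init op oc w) i) ω')

/-! ### Product functions -/

/-- The vector with a given name. -/
def vec (T : Transformer S N H m) : Source S N T.layers m → H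
  | .pos i => T.pos i
  | .tok ω => T.emb ω
  | .mlp l s => T.B l (EuclideanSpace.single s 1)

/-- Sets of value matrices with at most one matrix from each layer. -/
abbrev Path (T : Transformer S N H m) : Type := Fin T.layers → Option (Fin T.heads)

/-- The product of a set of value matrices, the one from the lowest layer at the right. -/
def pathProd (T : Transformer S N H m) (P : T.Path) : H →L[ℝ] H :=
  (List.ofFn (fun l => (P l).elim (1 : H →L[ℝ] H) (fun h => T.V l h))).reverse.prod

/-- The product function `vᵀ (∏ P₁)ᵀ Kᵀ Q (∏ P₂) w` of an attention head. -/
def prodAttn (T : Transformer S N H m) (l : Fin T.layers) (h : Fin T.heads) (P₁ P₂ : T.Path)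
    (v w : Source S N T.layers m) : ℝ :=
  ⟪T.K l h (T.pathProd P₁ (T.vec v)), T.Q l h (T.pathProd P₂ (T.vec w))⟫_ℝ

/-- The product function `U_ωᵀ (∏ P) w`. -/
def prodUnembed (T : Transformer S N H m) (P : T.Path) (ω : Vocab S (Slot N))
    (w : Source S N T.layers m) : ℝ :=
  T.U (T.pathProd P (T.vec w)) ω

/-- The product function `vᵀ (∏ P) w`, with `v` row `s` of the input matrix of the MLP of
layer `l`. -/
def prodMlp (T : Transformer S N H m) (P : T.Path) (l : Fin T.layers) (s : Fin m)
    (w : Source S N T.layers m) : ℝ :=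
  T.A l (T.pathProd P (T.vec w)) s

/-- Translation invariance: interactions between two positions, or between two extended symbols,
depend only on the difference of the indices; all other product functions do not depend on
the indices of the positions and extended symbols that they involve. -/
structure TranslationInvariant (T : Transformer S N H m) : Prop where
  attn_pos : ∀ l h P₁ P₂ (i j i' j' : Slot N), (i : ℕ) + (j' : ℕ) = (i' : ℕ) + (j : ℕ) →
    T.prodAttn l h P₁ P₂ (.pos i) (.pos j) = T.prodAttn l h P₁ P₂ (.pos i') (.pos j')
  attn_ext : ∀ l h P₁ P₂ (i j i' j' : Slot N), (i : ℕ) + (j' : ℕ) = (i' : ℕ) + (j : ℕ) →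
    T.prodAttn l h P₁ P₂ (.tok (.ext i)) (.tok (.ext j)) =
      T.prodAttn l h P₁ P₂ (.tok (.ext i')) (.tok (.ext j'))
  unembed_ext : ∀ P (i j i' j' : Slot N), (i : ℕ) + (j' : ℕ) = (i' : ℕ) + (j : ℕ) →
    T.prodUnembed P (.ext i) (.tok (.ext j)) = T.prodUnembed P (.ext i') (.tok (.ext j'))
  attn_const : ∀ l h P₁ P₂ v w v' w', v.SameKind v' → w.SameKind w' →
    ¬ (v.IsPos ∧ w.IsPos) → ¬ (v.IsExt ∧ w.IsExt) →
    T.prodAttn l h P₁ P₂ v w = T.prodAttn l h P₁ P₂ v' w'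
  unembed_const : ∀ P ω w ω' w', ω.SameKind ω' → w.SameKind w' → ¬ (ω.IsExt ∧ w.IsExt) →
    T.prodUnembed P ω w = T.prodUnembed P ω' w'
  mlp_const : ∀ P l s w w', w.SameKind w' → T.prodMlp P l s w = T.prodMlp P l s w'

/-- Locality with bandwidth `Δ`: interactions between two positions, or between two extended
symbols, vanish at distances larger than `Δ`. -/
structure Local (T : Transformer S N H m) (Δ : ℕ) : Prop where
  attn_pos : ∀ l h P₁ P₂ (i j : Slot N), Δ < Nat.dist i j →
    T.prodAttn l h P₁ P₂ (.pos i) (.pos j) = 0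
  attn_ext : ∀ l h P₁ P₂ (i j : Slot N), Δ < Nat.dist i j →
    T.prodAttn l h P₁ P₂ (.tok (.ext i)) (.tok (.ext j)) = 0
  unembed_ext : ∀ P (i j : Slot N), Δ < Nat.dist i j →
    T.prodUnembed P (.ext i) (.tok (.ext j)) = 0

/-- All positional encodings vanish. -/
def NoPE (T : Transformer S N H m) : Prop := ∀ i, T.pos i = 0

end Transformer

/-! ### Symbolic limit transformers -/

/-- A symbolic limit transformer is a transformer with infinite context window, on a Hilbert
space, with bounded linear maps as weight matrices (this is built into `Transformer`), bounded
embeddings, and product functions (and MLP biases) in finite precision that are local and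
translation invariant. -/
structure IsSymbolicLimit {S : Type u} {H : Type} [NormedAddCommGroup H] [InnerProductSpace ℝ H]
    {m : ℕ} (T : Transformer S ⊤ H m) : Prop where
  bounded_pos : ∃ C : ℝ, ∀ i, ‖T.pos i‖ ≤ C
  bounded_ext : ∃ C : ℝ, ∀ k, ‖T.emb (.ext k)‖ ≤ C
  bit_attn : ∀ l h P₁ P₂ v w, IsBit T.prec (T.prodAttn l h P₁ P₂ v w)
  bit_unembed : ∀ P ω w, IsBit T.prec (T.prodUnembed P ω w)
  bit_mlp : ∀ P l s w, IsBit T.prec (T.prodMlp P l s w)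
  bit_bias : ∀ l s, IsBit T.prec (T.b l s)
  translationInvariant : T.TranslationInvariant
  isLocal : ∃ Δ : ℕ, T.Local Δ

/-- `f` is expressible by a symbolic limit transformer all of whose positional encodings
vanish. -/
def ExpressibleNoPE {S : Type u} (ε : ℝ) (f : Task S) : Prop :=
  ∃ (H : Type) (_ : NormedAddCommGroup H) (_ : InnerProductSpace ℝ H) (_ : CompleteSpace H)
    (m : ℕ) (T : Transformer S ⊤ H m),
    IsSymbolicLimit T ∧ T.NoPE ∧ ∀ w i ω, T.logits ε 0 0 w i ω = f w i ω

/-! ### Hypothesis class and regularizer -/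

/-- Transformers with context window `n` and some finite width; the MLPs have as many hidden
units as the width. -/
structure FinTransformer (S : Type u) (n : ℕ) where
  width : ℕ
  model : Transformer S (n : ℕ∞) (EuclideanSpace ℝ (Fin width)) width

/-- The standard basis vector. -/
def stdVec {d : ℕ} (j : Fin d) : EuclideanSpace ℝ (Fin d) := EuclideanSpace.single j 1

/-- The hypothesis class `Θ_n`: all parameters have `prec` bits of precision, and the product
functions are translation invariant. -/
structure InTheta {S : Type u} {n : ℕ} (T : FinTransformer S n) : Prop where
  bit_emb : ∀ ω j, IsBit T.model.prec (T.model.emb ω j)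
  bit_pos : ∀ i j, IsBit T.model.prec (T.model.pos i j)
  bit_K : ∀ l h i j, IsBit T.model.prec (T.model.K l h (stdVec j) i)
  bit_Q : ∀ l h i j, IsBit T.model.prec (T.model.Q l h (stdVec j) i)
  bit_V : ∀ l h i j, IsBit T.model.prec (T.model.V l h (stdVec j) i)
  bit_A : ∀ l i j, IsBit T.model.prec (T.model.A l (stdVec j) i)
  bit_B : ∀ l i j, IsBit T.model.prec (T.model.B l (stdVec j) i)
  bit_b : ∀ l j, IsBit T.model.prec (T.model.b l j)
  bit_U : ∀ ω j, IsBit T.model.prec (T.model.U (stdVec j) ω)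
  translationInvariant : T.model.TranslationInvariant

/-- Frobenius norm of a linear map between Euclidean spaces. -/
def frobenius {d e : ℕ} (M : EuclideanSpace ℝ (Fin d) →L[ℝ] EuclideanSpace ℝ (Fin e)) : ℝ :=
  Real.sqrt (∑ i : Fin e, ∑ j : Fin d, (M (stdVec j) i) ^ 2)

/-- The penalty on interactions of the first position, and of the first extended symbol, with all
others.  Causal masking fixes the order of two positions in attention; two extended symbols
interact in both orders, and both are penalized. -/
def zeta {S : Type u} {n : ℕ} (T : FinTransformer S n) : ℝ :=
  (∑ l : Fin T.model.layers, ∑ h : Fin T.model.heads, ∑ P₁ : T.model.Path, ∑ P₂ : T.model.Path,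
    ((∑ i : Slot (n : ℕ∞), ∑ j : Slot (n : ℕ∞),
        if (i : ℕ) = 0 then |T.model.prodAttn l h P₁ P₂ (.pos i) (.pos j)| ^ 2 else 0) +
      ∑ i : Slot (n : ℕ∞), ∑ j : Slot (n : ℕ∞),
        if (i : ℕ) = 0 ∨ (j : ℕ) = 0 then
          |T.model.prodAttn l h P₁ P₂ (.tok (.ext i)) (.tok (.ext j))| ^ 2 else 0)) +
  ∑ P : T.model.Path, ∑ i : Slot (n : ℕ∞), ∑ j : Slot (n : ℕ∞),
    if (i : ℕ) = 0 ∨ (j : ℕ) = 0 then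
      |T.model.prodUnembed P (.ext i) (.tok (.ext j))| ^ 2 else 0

/-- The regularizer.  All suprema are maxima over finite index sets (and `0` over the empty
set). -/
def regularizer {S : Type u} {n : ℕ} (T : FinTransformer S n) : ℝ :=
  ((T.model.layers : ℝ) + T.model.heads) +
  ((T.model.prec : ℝ) + T.model.roundPrec) +
  ((⨆ q : Fin T.model.layers × Fin T.model.heads,
      ‖(ContinuousLinearMap.adjoint (T.model.K q.1 q.2)).comp (T.model.Q q.1 q.2)‖) +
    (⨆ q : Fin T.model.layers × Fin T.model.heads, ‖T.model.V q.1 q.2‖) +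
    (⨆ l, frobenius (T.model.A l)) + (⨆ l, frobenius (T.model.B l)) + ‖T.model.U‖) +
  ((⨆ i, ‖T.model.pos i‖) + (⨆ ω, ‖T.model.emb ω‖) + (⨆ l, ‖T.model.b l‖)) +
  zeta T

/-! ### Inference procedure -/

/-- All extended symbols of the input, shifted by `oc`, lie in a context window of size `n`. -/
def SymbolsFit {S : Type u} (n oc : ℕ) (w : Word S) : Prop :=
  ∀ k : ℕ, Sum.inr k ∈ w → k + oc < n

/-- `T` matches `f` on the input: at all offsets for which the input fits into the context
window, and on all output symbols that `T` has at this offset. -/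
def Matches {S : Type u} {n : ℕ} (ε : ℝ) (T : FinTransformer S n) (f : Task S) (w : Word S) :
    Prop :=
  ∀ op oc : ℕ, inputLength w + op ≤ n → inputLength w + oc ≤ n → SymbolsFit n oc w →
    ∀ (i : Fin (inputLength w)) (ω : Vocab S ℕ), (∀ k, ω = .ext k → k + oc < n) →
      T.model.logits ε op oc w i ω = f w i ω

/-- The training inputs for context window `n`: the length is at most `n / 2`, and the extended
symbols lie in the window and in a range of size at most `n / 2`. -/
def IsTraining {S : Type u} (n : ℕ) (w : Word S) : Prop :=
  2 * inputLength w ≤ n ∧ SymbolsFit n 0 w ∧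
    ∀ k k' : ℕ, Sum.inr k ∈ w → Sum.inr k' ∈ w → 2 * k ≤ 2 * k' + n

/-- The members of `Θ_n` without positional encodings that match `f` on all training inputs. -/
def candidates {S : Type u} (ε : ℝ) (f : Task S) (n : ℕ) : Set (FinTransformer S n) :=
  {T | InTheta T ∧ T.model.NoPE ∧ ∀ w, IsTraining n w → Matches ε T f w}

/-- `T 1, T 2, …` is a sequence that the inference procedure, constrained to vanishing positional
encodings, may produce on `f` (the entry `T 0` is irrelevant). -/
def IsRun {S : Type u} (ε : ℝ) (f : Task S) (T : (n : ℕ) → FinTransformer S n) : Prop :=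
  ∀ n : ℕ, 1 ≤ n → T n ∈ candidates ε f n ∧
    regularizer (T n) ≤ 1 / (n : ℝ) + sInf (regularizer '' candidates ε f n)

/-- Bounded regularizer, and correctness on all inputs up to the full context window
from some point on. -/
def GeneralizesInLimit {S : Type u} (ε : ℝ) (f : Task S) (T : (n : ℕ) → FinTransformer S n) :
    Prop :=
  (∃ C : ℝ, ∀ n : ℕ, 1 ≤ n → regularizer (T n) ≤ C) ∧
  ∃ N₀ : ℕ, ∀ n : ℕ, N₀ < n → ∀ w : Word S,
    inputLength w ≤ n → SymbolsFit n 0 w → Matches ε (T n) f w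

end SymbolicLimit

end

/-! Without positional encodings, every activation is a linear combination of vectors `∏ P v`, where
`v` is an embedding or an output column of an MLP and `P` picks at most one value matrix per layer.
Attention logits, MLP preactivations and output logits are linear or bilinear in the activations, so
the coefficients, and with them the output, are determined by the product functions together with
biases, activation functions and rounding precision (`Sys.logits_eq_of_realizes`). By translation
invariance one table of product functions is valid at all character offsets
(`Transformer.realizes_table`). This table with its dimensions is the code of the transformer.

Codes with bounded dimensions and precision, bounded entries and a fixed bandwidth are finite in
number (`Code.bounded_finite`). Conversely, every good table is realized in all finite windows with
a regularizer bounded independently of the window (`exists_finTransformer`), and also by a symbolic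
limit transformer (`exists_limitTransformer`). The realization has one basis vector for each path
and symbol, and all its matrices are sparse, which bounds their norms.

If a limit transformer expresses `f`, its table yields candidates for all windows with a common
regularizer bound, so runs exist and are bounded. In a bounded run the infima of the regularizer are
bounded in `n`. Hence some window `k + 1` nearly attains their supremum, and restricting a late `T
n` to this window can lower `zeta` only by less than the square of the smallest nonzero product
function. No interaction beyond that distance survives, and `T n` is local (`IsRun.exists_local`).
So late members have finitely many codes, and from some point on only codes that recur forever. Such
a code computes `f` everywhere, because every input is eventually a training input
(`IsRun.logits_eq_of_frequently`). This gives generalization, and realizing a recurrent code in the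
infinite window gives the converse. -/

noncomputable section

/-! ### Symbolic expansion of activations: the output depends only on the product functions. -/

namespace SymbolicLimit

universe u

instance Vocab.instFinite {S : Type u} {ι : Type} [Finite S] [Finite ι] : Finite (Vocab S ι) := by
  let g : Vocab S ι → Option (S ⊕ ι) := fun ω => match ω with
    | .start => none
    | .sym a => some (.inl a)
    | .ext k => some (.inr k)
  refine Finite.of_injective g ?_
  rintro (_ | a | k) (_ | b | k') h <;> simp_all [g]

/-- All indices of extended symbols in the vocabulary item lie in `I`. -/
def Vocab.In {S : Type u} {ι : Type} (I : Set ι) : Vocab S ι → Prop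
  | .ext k => k ∈ I
  | _ => True

/-- The alphabet enlarged by the names of the hidden units of the MLPs. -/
abbrev Letters (S : Type u) (L M : ℕ) : Type u := S ⊕ (Fin L × Fin M)

/-- Regard a vocabulary item as an item over the enlarged alphabet. -/
def Vocab.lift {S : Type u} {ι : Type} (L M : ℕ) : Vocab S ι → Vocab (Letters S L M) ι
  | .start => .start
  | .sym a => .sym (.inl a)
  | .ext k => .ext k

theorem Vocab.In.lift {S : Type u} {ι : Type} {I : Set ι} {ω : Vocab S ι} (h : ω.In I) (L M : ℕ) :
    (ω.lift L M).In I := by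
  cases ω <;> exact h

theorem inputToken_in {S : Type u} {w : Word S} {I : Set ℕ} (hw : ∀ k, Sum.inr k ∈ w → k ∈ I)
    (i : Fin (inputLength w)) : (inputToken w i).In I := by
  induction i using Fin.cases with
  | zero => trivial
  | succ i =>
    have hmem : w.get i ∈ w := List.get_mem w i
    change (Sum.elim Vocab.sym Vocab.ext (w.get i) : Vocab S ℕ).In I
    generalize w.get i = z at hmem
    cases z with
    | inl a => trivial
    | inr k => exact hw k hmem

/-- The values of all product functions of a transformer without positional encodings, together
with the remaining data that its computation depends on. -/
structure ProductTable (S : Type u) (L Hd M : ℕ) where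
  roundPrec : ℕ
  act : Fin L → Fin M → Act
  bias : Fin L → Fin M → ℝ
  attn : Fin L → Fin Hd → (Fin L → Option (Fin Hd)) → (Fin L → Option (Fin Hd)) →
    Vocab (Letters S L M) ℕ → Vocab (Letters S L M) ℕ → ℝ
  unembed : (Fin L → Option (Fin Hd)) → Vocab S ℕ → Vocab (Letters S L M) ℕ → ℝ
  mlp : (Fin L → Option (Fin Hd)) → Fin L → Fin M → Vocab (Letters S L M) ℕ → ℝ

/-- A transformer without positional encodings at a fixed offset, with the hyperparameters as
indices. -/
structure Sys (S : Type u) (L Hd M : ℕ) (H : Type) [NormedAddCommGroup H]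
    [InnerProductSpace ℝ H] where
  roundPrec : ℕ
  emb : Vocab S ℕ → H
  K : Fin L → Fin Hd → (H →L[ℝ] H)
  Q : Fin L → Fin Hd → (H →L[ℝ] H)
  V : Fin L → Fin Hd → (H →L[ℝ] H)
  A : Fin L → Fin M → (H →ₗ[ℝ] ℝ)
  B : Fin L → Fin M → H
  bias : Fin L → Fin M → ℝ
  act : Fin L → Fin M → Act
  U : Vocab S ℕ → (H →ₗ[ℝ] ℝ)

/-- In the reversed product all factors to the left of position `l` are trivial, so the new factor
comes out in front. This lets a path grow by a value matrix of a higher layer. -/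
theorem prod_reverse_ofFn_update {G : Type*} [Monoid G] {L : ℕ} (g : Fin L → G) (l : Fin L) (a : G)
    (hg : ∀ l', l ≤ l' → g l' = 1) :
    (List.ofFn (Function.update g l a)).reverse.prod = a * (List.ofFn g).reverse.prod := by
  induction L with
  | zero => exact l.elim0
  | succ L ih =>
    rw [List.ofFn_succ', List.ofFn_succ', List.concat_eq_append, List.concat_eq_append,
      List.reverse_append, List.reverse_append]
    simp only [List.reverse_cons, List.reverse_nil, List.nil_append, List.prod_cons,
      List.singleton_append]
    induction l using Fin.lastCases with
    | last =>
      rw [Function.update_self, hg _ le_rfl, one_mul]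
      congr 4
      funext i
      rw [Function.update_of_ne (Fin.castSucc_lt_last i).ne]
    | cast l0 =>
      rw [Function.update_of_ne (Fin.castSucc_lt_last l0).ne', hg _ (Fin.le_last _), one_mul,
        one_mul, ← ih (fun i => g i.castSucc) l0 (fun l' h => hg _ (by simpa using h))]
      congr 3
      funext i
      by_cases h : i = l0
      · subst h; simp
      · rw [Function.update_of_ne h, Function.update_of_ne (by simpa using h)]

/-- Runs two networks with different residual spaces in lockstep. The index of `R` counts the layers
that may already have been used. -/
theorem List.foldl_finRange_invariant {β γ : Type*} {L : ℕ} (R : ℕ → β → γ → Prop)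
    (hmono : ∀ {s t : ℕ} {y z}, s ≤ t → R s y z → R t y z) (f : β → Fin L → β) (g : γ → Fin L → γ)
    (hstep : ∀ (l : Fin L) y z, R l y z → R (l + 1) (f y l) (g z l)) (y : β) (z : γ)
    (h : R 0 y z) : R L ((List.finRange L).foldl f y) ((List.finRange L).foldl g z) := by
  -- The induction is over arbitrary increasing lists of layers, with `s` a lower bound for the
  -- remaining ones; monotonicity of `R` bridges skipped layers.
  suffices key : ∀ (ls : List (Fin L)), ls.Pairwise (· < ·) → ∀ (s : ℕ), s ≤ L →
      (∀ l ∈ ls, s ≤ (l : ℕ)) → ∀ y z, R s y z → R L (ls.foldl f y) (ls.foldl g z) from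
    key _ (List.pairwise_lt_finRange L) 0 (Nat.zero_le _) (fun _ _ => Nat.zero_le _) y z h
  intro ls
  induction ls with
  | nil => intro _ s hs _ y z h; exact hmono hs h
  | cons l ls ih =>
    intro hp s hs hl y z h
    rw [List.pairwise_cons] at hp
    simp only [List.foldl_cons]
    refine ih hp.2 (l + 1) l.2 (fun l' h' => ?_) _ _
      (hstep l y z (hmono (hl l (by simp)) h))
    exact hp.1 l' h'

namespace Sys

variable {S : Type u} {L Hd M : ℕ} {H : Type} [NormedAddCommGroup H] [InnerProductSpace ℝ H]

def weight (Y : Sys S L Hd M H) (n : ℕ) (l : Fin L) (h : Fin Hd) (yi yj : H) : ℝ :=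
  roundTo Y.roundPrec (Real.exp (Real.log n * roundTo Y.roundPrec ⟪Y.K l h yj, Y.Q l h yi⟫_ℝ))

def attention (Y : Sys S L Hd M H) {n : ℕ} (l : Fin L) (y : Fin n → H) : Fin n → H := fun i =>
  y i + ∑ h : Fin Hd, (∑ j ∈ Finset.Iic i, Y.weight n l h (y i) (y j))⁻¹ •
      ∑ j ∈ Finset.Iic i, Y.weight n l h (y i) (y j) • Y.V l h (y j)

def layer (Y : Sys S L Hd M H) (ε : ℝ) {n : ℕ} (l : Fin L) (y : Fin n → H) : Fin n → H := fun i =>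
  Y.attention l y i +
    ∑ s, (Y.act l s).eval ε (Y.A l s (Y.attention l y i) + Y.bias l s) • Y.B l s

def final (Y : Sys S L Hd M H) (ε : ℝ) {n : ℕ} (y : Fin n → H) : Fin n → H :=
  (List.finRange L).foldl (fun y l => Y.layer ε l y) y

def logits (Y : Sys S L Hd M H) (ε : ℝ) (w : Word S) (i : Fin (inputLength w))
    (ω : Vocab S ℕ) : ℝ :=
  Y.U ω (Y.final ε (fun i => Y.emb (inputToken w i)) i)

/-- The vectors that are written into the residual stream. -/
def gen (Y : Sys S L Hd M H) : Vocab (Letters S L M) ℕ → H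
  | .start => Y.emb .start
  | .sym (.inl a) => Y.emb (.sym a)
  | .sym (.inr (l, s)) => Y.B l s
  | .ext k => Y.emb (.ext k)

/-- The product of a set of value matrices. -/
def path (Y : Sys S L Hd M H) (P : Fin L → Option (Fin Hd)) : H →L[ℝ] H :=
  (List.ofFn (fun l => (P l).elim (1 : H →L[ℝ] H) (fun h => Y.V l h))).reverse.prod

theorem gen_lift (Y : Sys S L Hd M H) (ω : Vocab S ℕ) : Y.gen (ω.lift L M) = Y.emb ω := by
  cases ω <;> rfl

theorem path_none (Y : Sys S L Hd M H) (v : H) : Y.path (fun _ => none) v = v := by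
  simp [path]

theorem path_update (Y : Sys S L Hd M H) (P : Fin L → Option (Fin Hd)) (l : Fin L) (h : Fin Hd)
    (hP : ∀ l', l ≤ l' → P l' = none) (v : H) :
    Y.path (Function.update P l (some h)) v = Y.V l h (Y.path P v) := by
  have key := prod_reverse_ofFn_update
    (fun l => (P l).elim (1 : H →L[ℝ] H) (fun h => Y.V l h)) l (Y.V l h)
    (fun l' hl => by simp [hP l' hl])
  have : (fun l' => (Function.update P l (some h) l').elim (1 : H →L[ℝ] H) (fun h => Y.V l' h)) =
      Function.update (fun l => (P l).elim (1 : H →L[ℝ] H) (fun h => Y.V l h)) l (Y.V l h) := by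
    funext l'
    by_cases e : l' = l
    · subst e; simp
    · simp [Function.update_of_ne e]
  unfold path
  rw [this, key]
  rfl

/-- The product functions of the system, on symbols with indices in `I`, are those of the
table. -/
structure Realizes (Y : Sys S L Hd M H) (I : Set ℕ) (D : ProductTable S L Hd M) : Prop where
  roundPrec_eq : Y.roundPrec = D.roundPrec
  act_eq : Y.act = D.act
  bias_eq : Y.bias = D.bias
  attn : ∀ l h P P' x y, x.In I → y.In I →
    ⟪Y.K l h (Y.path P (Y.gen x)), Y.Q l h (Y.path P' (Y.gen y))⟫_ℝ = D.attn l h P P' x y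
  unembed : ∀ P ω y, ω.In I → y.In I → Y.U ω (Y.path P (Y.gen y)) = D.unembed P ω y
  mlp : ∀ P l s y, y.In I → Y.A l s (Y.path P (Y.gen y)) = D.mlp P l s y

variable {H' : Type} [NormedAddCommGroup H'] [InnerProductSpace ℝ H']

/-- Pairs of activations with the same symbolic expansion, built by the layers below `t`. -/
def related (Y : Sys S L Hd M H) (Y' : Sys S L Hd M H') (I : Set ℕ) (t : ℕ) :
    Submodule ℝ (H × H') :=
  Submodule.span ℝ {q | ∃ (P : Fin L → Option (Fin Hd)) (x : Vocab (Letters S L M) ℕ),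
    (∀ l : Fin L, t ≤ (l : ℕ) → P l = none) ∧ x.In I ∧
      q = (Y.path P (Y.gen x), Y'.path P (Y'.gen x))}

variable {Y : Sys S L Hd M H} {Y' : Sys S L Hd M H'} {I : Set ℕ} {D : ProductTable S L Hd M}

theorem related_mono {s t : ℕ} (h : s ≤ t) : related Y Y' I s ≤ related Y Y' I t := by
  refine Submodule.span_mono ?_
  rintro _ ⟨P, x, hP, hx, rfl⟩
  exact ⟨P, x, fun l hl => hP l (h.trans hl), hx, rfl⟩

theorem gen_mem_related {x : Vocab (Letters S L M) ℕ} (hx : x.In I) (t : ℕ) :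
    (Y.gen x, Y'.gen x) ∈ related Y Y' I t := by
  refine Submodule.subset_span ⟨fun _ => none, x, fun _ _ => rfl, hx, ?_⟩
  rw [path_none, path_none]

/-- Expansions below layer `l` use no value matrix of layer `l` or higher, so one more application
is again a product with at most one matrix per layer. -/
theorem related_V {l : Fin L} (h : Fin Hd) {q : H × H'} (hq : q ∈ related Y Y' I l) :
    (Y.V l h q.1, Y'.V l h q.2) ∈ related Y Y' I (l + 1) := by
  induction hq using Submodule.span_induction with
  | mem q hq =>
    obtain ⟨P, x, hP, hx, rfl⟩ := hq
    refine Submodule.subset_span ⟨Function.update P l (some h), x, fun l' hl => ?_, hx, ?_⟩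
    · rw [Function.update_of_ne, hP l' (by omega)]
      intro e; rw [e] at hl; omega
    · have hP' : ∀ l', l ≤ l' → P l' = none := fun l' hl => hP l' hl
      rw [path_update _ _ _ _ hP', path_update _ _ _ _ hP']
  | zero =>
    simp only [Prod.fst_zero, Prod.snd_zero, map_zero]
    exact Submodule.zero_mem _
  | add a b _ _ ha hb => simpa using Submodule.add_mem _ ha hb
  | smul c a _ ha => simpa using Submodule.smul_mem _ c ha

/-- By bilinearity it suffices to compare generators, where both sides are the same entry of the
table. -/
theorem related_inner (hY : Y.Realizes I D) (hY' : Y'.Realizes I D) {t : ℕ} (l : Fin L) (h : Fin Hd)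
    {q q' : H × H'} (hq : q ∈ related Y Y' I t) (hq' : q' ∈ related Y Y' I t) :
    ⟪Y.K l h q.1, Y.Q l h q'.1⟫_ℝ = ⟪Y'.K l h q.2, Y'.Q l h q'.2⟫_ℝ := by
  induction hq using Submodule.span_induction with
  | mem q hq =>
    obtain ⟨P, x, -, hx, rfl⟩ := hq
    induction hq' using Submodule.span_induction with
    | mem q' hq' =>
      obtain ⟨P', y, -, hy, rfl⟩ := hq'
      exact (hY.attn l h P P' x y hx hy).trans (hY'.attn l h P P' x y hx hy).symm
    | zero => simp
    | add a b _ _ ha hb => simp only [Prod.fst_add, Prod.snd_add, map_add, inner_add_right, ha, hb]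
    | smul c a _ ha => simp only [Prod.smul_fst, Prod.smul_snd, map_smul, inner_smul_right, ha]
  | zero => simp
  | add a b _ _ ha hb => simp only [Prod.fst_add, Prod.snd_add, map_add, inner_add_left, ha, hb]
  | smul c a _ ha =>
    simp only [Prod.smul_fst, Prod.smul_snd, map_smul, inner_smul_left, ha]

theorem related_A (hY : Y.Realizes I D) (hY' : Y'.Realizes I D) {t : ℕ} (l : Fin L) (s : Fin M)
    {q : H × H'} (hq : q ∈ related Y Y' I t) : Y.A l s q.1 = Y'.A l s q.2 := by
  induction hq using Submodule.span_induction with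
  | mem q hq =>
    obtain ⟨P, x, -, hx, rfl⟩ := hq
    exact (hY.mlp P l s x hx).trans (hY'.mlp P l s x hx).symm
  | zero => simp
  | add a b _ _ ha hb => simp only [Prod.fst_add, Prod.snd_add, map_add, ha, hb]
  | smul c a _ ha => simp only [Prod.smul_fst, Prod.smul_snd, map_smul, ha]

theorem related_U (hY : Y.Realizes I D) (hY' : Y'.Realizes I D) {t : ℕ} {ω : Vocab S ℕ}
    (hω : ω.In I) {q : H × H'} (hq : q ∈ related Y Y' I t) : Y.U ω q.1 = Y'.U ω q.2 := by
  induction hq using Submodule.span_induction with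
  | mem q hq =>
    obtain ⟨P, x, -, hx, rfl⟩ := hq
    exact (hY.unembed P ω x hω hx).trans (hY'.unembed P ω x hω hx).symm
  | zero => simp
  | add a b _ _ ha hb => simp only [Prod.fst_add, Prod.snd_add, map_add, ha, hb]
  | smul c a _ ha => simp only [Prod.smul_fst, Prod.smul_snd, map_smul, ha]

theorem mem_sum_pair {α : Type*} (R : Submodule ℝ (H × H')) (F : Finset α) (f : α → H)
    (f' : α → H') (h : ∀ a ∈ F, (f a, f' a) ∈ R) : (∑ a ∈ F, f a, ∑ a ∈ F, f' a) ∈ R := by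
  have : (∑ a ∈ F, f a, ∑ a ∈ F, f' a) = ∑ a ∈ F, (f a, f' a) :=
    Prod.ext (by rw [Prod.fst_sum]) (by rw [Prod.snd_sum])
  rw [this]
  exact R.sum_mem h

theorem mem_smul_pair (R : Submodule ℝ (H × H')) {c c' : ℝ} (hc : c = c') {a : H} {a' : H'}
    (h : (a, a') ∈ R) : (c • a, c' • a') ∈ R := by
  subst hc
  exact R.smul_mem c h

theorem mem_add_pair (R : Submodule ℝ (H × H')) {a b : H} {a' b' : H'}
    (h : (a, a') ∈ R) (h' : (b, b') ∈ R) : (a + b, a' + b') ∈ R := R.add_mem h h'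

/-- The unrounded logits already coincide, so the attention weights are equal numbers and both sides
form the same linear combination. -/
theorem related_attention (hY : Y.Realizes I D) (hY' : Y'.Realizes I D) {n : ℕ} (l : Fin L)
    {y : Fin n → H} {y' : Fin n → H'} (h : ∀ i, (y i, y' i) ∈ related Y Y' I l) (i : Fin n) :
    (Y.attention l y i, Y'.attention l y' i) ∈ related Y Y' I (l + 1) := by
  have hw : ∀ hd j, Y.weight n l hd (y i) (y j) = Y'.weight n l hd (y' i) (y' j) := by
    intro hd j
    unfold weight
    rw [related_inner hY hY' l hd (h j) (h i), hY.roundPrec_eq, hY'.roundPrec_eq]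
  refine mem_add_pair _ (related_mono (Nat.le_succ _) (h i)) (mem_sum_pair _ _ _ _ fun hd _ => ?_)
  refine mem_smul_pair _ (by simp only [hw]) (mem_sum_pair _ _ _ _ fun j _ => ?_)
  exact mem_smul_pair _ (hw hd j) (related_V hd (h j))

/-- The nonlinearity enters only through scalar coefficients of the columns of `B`, which are
themselves generators of the expansion. -/
theorem related_layer (hY : Y.Realizes I D) (hY' : Y'.Realizes I D) (ε : ℝ) {n : ℕ} (l : Fin L)
    {y : Fin n → H} {y' : Fin n → H'} (h : ∀ i, (y i, y' i) ∈ related Y Y' I l) (i : Fin n) :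
    (Y.layer ε l y i, Y'.layer ε l y' i) ∈ related Y Y' I (l + 1) := by
  have ha := related_attention hY hY' l h i
  refine mem_add_pair _ ha (mem_sum_pair _ _ _ _ fun s _ => mem_smul_pair _ ?_ ?_)
  · rw [related_A hY hY' l s ha, hY.act_eq, hY'.act_eq, hY.bias_eq, hY'.bias_eq]
  · exact gen_mem_related (x := .sym (.inr (l, s))) trivial _

theorem Realizes.mono {I' : Set ℕ} (h : I' ⊆ I) (hY : Y.Realizes I D) : Y.Realizes I' D := by
  have key : ∀ {T : Type u} {x : Vocab T ℕ}, x.In I' → x.In I := by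
    rintro T (_ | a | k) hx
    · trivial
    · trivial
    · exact h hx
  exact ⟨hY.roundPrec_eq, hY.act_eq, hY.bias_eq,
    fun l h P P' x y hx hy => hY.attn l h P P' x y (key hx) (key hy),
    fun P ω y hω hy => hY.unembed P ω y (key hω) (key hy),
    fun P l s y hy => hY.mlp P l s y (key hy)⟩

/-- The logits depend only on the product functions. -/
theorem logits_eq_of_realizes (hY : Y.Realizes I D) (hY' : Y'.Realizes I D) (ε : ℝ) (w : Word S)
    (hw : ∀ k, Sum.inr k ∈ w → k ∈ I) (i : Fin (inputLength w)) {ω : Vocab S ℕ} (hω : ω.In I) :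
    Y.logits ε w i ω = Y'.logits ε w i ω := by
  have key := List.foldl_finRange_invariant (L := L)
    (fun t (y : Fin (inputLength w) → H) (y' : Fin (inputLength w) → H') =>
      ∀ i, (y i, y' i) ∈ related Y Y' I t)
    (fun hst h i => related_mono hst (h i)) (fun y l => Y.layer ε l y) (fun y l => Y'.layer ε l y)
    (fun l y z h i => related_layer hY hY' ε l h i)
    (fun i => Y.emb (inputToken w i)) (fun i => Y'.emb (inputToken w i))
    (fun i => by
      have := gen_mem_related (Y := Y) (Y' := Y') ((inputToken_in hw i).lift L M) 0
      rwa [gen_lift, gen_lift] at this)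
  exact related_U hY hY' hω (key i)

end Sys

end SymbolicLimit

end

/-! ### Transformers at a character offset, their tables and their codes. -/

noncomputable section

namespace SymbolicLimit

universe u

/-- The item `x`, with indices of extended symbols measured relative to those of `y`. -/
def Vocab.rel {A B : Type*} : Vocab A ℕ → Vocab B ℕ → Vocab A ℕ
  | .ext i, .ext j => .ext (i - j)
  | .ext _, _ => .ext 0
  | x, _ => x

/-- The indices of extended symbols that are in the context window at character offset `oc`. -/
def window (N : ℕ∞) (oc : ℕ) : Set ℕ := {k | ((k + oc : ℕ) : ℕ∞) < N}

theorem window_of_le {N : ℕ∞} {oc i j : ℕ} (h : i ∈ window N oc) (hij : j ≤ i) :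
    j ∈ window N 0 :=
  show ((j + 0 : ℕ) : ℕ∞) < N from
    lt_of_le_of_lt (Nat.cast_le.2 (by omega : j + 0 ≤ i + oc)) (show ((i + oc : ℕ) : ℕ∞) < N from h)

theorem Vocab.In.rel {A B : Type*} {N : ℕ∞} {oc : ℕ} {x : Vocab A ℕ} {y : Vocab B ℕ}
    (hx : x.In (window N oc)) : (x.rel y).In (window N 0) := by
  cases x <;> cases y <;> first | trivial | exact window_of_le hx (by omega)

namespace Transformer

variable {S : Type u} {N : ℕ∞} {H : Type} [NormedAddCommGroup H] [InnerProductSpace ℝ H] {m M : ℕ}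

/-- The functional `y ↦ U y ω`. -/
def row (T : Transformer S N H m) (ω : Vocab S (Slot N)) : H →ₗ[ℝ] ℝ where
  toFun y := T.U y ω
  map_add' := by simp
  map_smul' := by simp

@[simp] theorem row_apply (T : Transformer S N H m) (ω : Vocab S (Slot N)) (y : H) :
    T.row ω y = T.U y ω := rfl

/-- The system computed by a transformer at character offset `oc`, with the hidden units named
by `hid`. -/
def sys (T : Transformer S N H m) (oc : ℕ) (hid : Fin T.layers → Fin M → Fin m) :
    Sys S T.layers T.heads M H where
  roundPrec := T.roundPrec
  emb := T.embAt oc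
  K := T.K
  Q := T.Q
  V := T.V
  A l s := (EuclideanSpace.proj (𝕜 := ℝ) (hid l s)).toLinearMap ∘ₗ (T.A l).toLinearMap
  B l s := T.B l (EuclideanSpace.single (hid l s) 1)
  bias l s := T.b l (hid l s)
  act l s := T.act l (hid l s)
  U ω := (shifted N oc ω).elim 0 T.row

/-- The hidden units named by `hid` are all those that contribute to the output. -/
def Covers (T : Transformer S N H m) (hid : Fin T.layers → Fin M → Fin m) : Prop :=
  ∀ l, Function.Injective (hid l) ∧
    ∀ s, s ∉ Set.range (hid l) → T.B l (EuclideanSpace.single s 1) = 0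

theorem mlp_eq_sum (T : Transformer S N H m) {hid : Fin T.layers → Fin M → Fin m}
    (hc : T.Covers hid) (l : Fin T.layers) (z : EuclideanSpace ℝ (Fin m)) :
    T.B l z = ∑ s, z (hid l s) • T.B l (EuclideanSpace.single (hid l s) 1) := by
  classical
  have hz : z = ∑ s, z s • EuclideanSpace.single s (1 : ℝ) := by
    have := (EuclideanSpace.basisFun (Fin m) ℝ).sum_repr z
    simpa using this.symm
  conv_lhs => rw [hz]
  rw [map_sum]
  simp only [map_smul]
  symm
  refine Finset.sum_of_injOn (hid l) ((hc l).1.injOn) (by simp) (fun s _ hs => ?_) (by simp)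
  rw [(hc l).2 s (by simpa using hs), smul_zero]

/-- The positional offset drops out because all positional encodings vanish, and hidden units with
zero output column may be left out of the system. -/
theorem logits_eq_sys (T : Transformer S N H m) (hT : T.NoPE)
    {hid : Fin T.layers → Fin M → Fin m} (hc : T.Covers hid) (ε : ℝ) (op oc : ℕ) (w : Word S)
    (i : Fin (inputLength w)) (ω : Vocab S ℕ) :
    T.logits ε op oc w i ω = (T.sys oc hid).logits ε w i ω := by
  have hpos : ∀ i, T.posAt i = 0 := by
    intro i
    unfold posAt
    split
    · exact hT _
    · rfl
  have hinit : T.init op oc w = fun i => T.embAt oc (inputToken w i) := by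
    funext i
    simp [init, hpos]
  have hlayer : (fun (y : Fin (inputLength w) → H) l => T.layer ε l y) =
      fun y l => (T.sys oc hid).layer ε l y := by
    funext y l i
    change T.attention l y i + T.B l _ = T.attention l y i + ∑ s, _
    rw [T.mlp_eq_sum hc]
    rfl
  have hfinal : T.final ε (T.init op oc w) =
      (T.sys oc hid).final ε (fun i => (T.sys oc hid).emb (inputToken w i)) := by
    rw [hinit]
    unfold final Sys.final
    rw [hlayer]
    rfl
  unfold logits Sys.logits
  rw [hfinal]
  change _ = ((shifted N oc ω).elim 0 T.row) _
  cases shifted N oc ω <;> rfl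

/-- The name of a vector of the system. -/
def source (T : Transformer S N H m) (hid : Fin T.layers → Fin M → Fin m) (oc : ℕ) :
    (x : Vocab (Letters S T.layers M) ℕ) → x.In (window N oc) → Source S N T.layers m
  | .start, _ => .tok .start
  | .sym (.inl a), _ => .tok (.sym a)
  | .sym (.inr (l, s)), _ => .mlp l (hid l s)
  | .ext k, h => .tok (.ext ⟨k + oc, h⟩)

theorem shifted_ext {oc k : ℕ} (h : k ∈ window N oc) :
    shifted N oc (.ext k : Vocab S ℕ) = some (.ext ⟨k + oc, h⟩) :=
  dif_pos (show ((k + oc : ℕ) : ℕ∞) < N from h)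

theorem embAt_ext (T : Transformer S N H m) {oc k : ℕ} (h : k ∈ window N oc) :
    T.embAt oc (.ext k) = T.emb (.ext ⟨k + oc, h⟩) := by
  unfold embAt
  rw [shifted_ext h]
  rfl

theorem vec_source (T : Transformer S N H m) (hid : Fin T.layers → Fin M → Fin m) (oc : ℕ)
    (x : Vocab (Letters S T.layers M) ℕ) (hx : x.In (window N oc)) :
    T.vec (T.source hid oc x hx) = (T.sys oc hid).gen x := by
  rcases x with _ | (a | ⟨l, s⟩) | k
  · rfl
  · rfl
  · rfl
  · exact (T.embAt_ext hx).symm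

/-- The product functions of a translation invariant transformer, tabulated at character
offset `0`. -/
def table (T : Transformer S N H m) (hid : Fin T.layers → Fin M → Fin m) :
    ProductTable S T.layers T.heads M where
  roundPrec := T.roundPrec
  act := (T.sys 0 hid).act
  bias := (T.sys 0 hid).bias
  attn l h P P' x y := ⟪T.K l h (T.pathProd P ((T.sys 0 hid).gen (x.rel y))),
    T.Q l h (T.pathProd P' ((T.sys 0 hid).gen (y.rel x)))⟫_ℝ
  unembed P ω y := (T.sys 0 hid).U (ω.rel y) (T.pathProd P ((T.sys 0 hid).gen (y.rel ω)))
  mlp P l s y := T.A l (T.pathProd P ((T.sys 0 hid).gen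
    (y.rel (Vocab.start : Vocab S ℕ)))) (hid l s)

theorem table_attn (T : Transformer S N H m) (hid : Fin T.layers → Fin M → Fin m) (l h P P' x y)
    {oc : ℕ} (hx : x.In (window N oc)) (hy : y.In (window N oc)) :
    (T.table hid).attn l h P P' x y =
      T.prodAttn l h P P' (T.source hid 0 _ (hx.rel (y := y))) (T.source hid 0 _ (hy.rel (y := x))) := by
  unfold prodAttn
  rw [vec_source, vec_source]
  rfl

/-- A vocabulary item as an item of the context window. -/
def item (N : ℕ∞) (oc : ℕ) : (ω : Vocab S ℕ) → ω.In (window N oc) → Vocab S (Slot N)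
  | .start, _ => .start
  | .sym a, _ => .sym a
  | .ext k, h => .ext ⟨k + oc, h⟩

theorem sys_U (T : Transformer S N H m) (hid : Fin T.layers → Fin M → Fin m) (oc : ℕ)
    (ω : Vocab S ℕ) (h : ω.In (window N oc)) (y : H) :
    (T.sys oc hid).U ω y = T.U y (item N oc ω h) := by
  cases ω with
  | start => rfl
  | sym a => rfl
  | ext k =>
    change ((shifted N oc (.ext k)).elim 0 T.row) y = _
    rw [shifted_ext h]
    rfl

theorem table_unembed (T : Transformer S N H m) (hid : Fin T.layers → Fin M → Fin m) (P ω y)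
    {oc : ℕ} (hω : ω.In (window N oc)) (hy : y.In (window N oc)) :
    (T.table hid).unembed P ω y =
      T.prodUnembed P (item N 0 _ (hω.rel (y := y))) (T.source hid 0 _ (hy.rel (y := ω))) := by
  unfold prodUnembed
  rw [vec_source, ← T.sys_U hid]
  rfl

theorem table_mlp (T : Transformer S N H m) (hid : Fin T.layers → Fin M → Fin m) (P l s y)
    {oc : ℕ} (hy : y.In (window N oc)) :
    (T.table hid).mlp P l s y =
      T.prodMlp P l (hid l s) (T.source hid 0 _ (hy.rel (y := (Vocab.start : Vocab S ℕ)))) := by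
  unfold prodMlp
  rw [vec_source]
  rfl

/-- The indices `k + oc`, `k' + oc` have the same difference as the tabulated `k - k'`, `k' - k`
(truncated subtraction, one of them is `0`). All other products do not see the index at all. The
tabulated indices are no larger than the original ones, hence lie in the window. -/
theorem realizes_table (T : Transformer S N H m) (hT : T.TranslationInvariant)
    (hid : Fin T.layers → Fin M → Fin m) (oc : ℕ) :
    (T.sys oc hid).Realizes (window N oc) (T.table hid) := by
  refine ⟨rfl, rfl, rfl, fun l h P P' x y hx hy => ?_, fun P ω y hω hy => ?_,
    fun P l s y hy => ?_⟩
  · rw [T.table_attn hid l h P P' x y hx hy, ← T.vec_source hid oc x hx,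
      ← T.vec_source hid oc y hy]
    change T.prodAttn l h P P' _ _ = _
    rcases x with _ | (a | ⟨l, s⟩) | k <;> rcases y with _ | (a' | ⟨l', s'⟩) | k'
    case ext.ext => exact hT.attn_ext _ _ _ _ _ _ _ _ (by simp only []; omega)
    all_goals
      exact hT.attn_const _ _ _ _ _ _ _ _ (by trivial) (by trivial)
        (fun h => h.1) (fun h => by first | exact h.1 | exact h.2)
  · rw [T.table_unembed hid P ω y hω hy, T.sys_U hid oc ω hω, ← T.vec_source hid oc y hy]
    change T.prodUnembed P _ _ = _
    rcases ω with _ | a | k <;> rcases y with _ | (a' | ⟨l', s'⟩) | k'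
    case ext.ext => exact hT.unembed_ext _ _ _ _ _ (by simp only []; omega)
    all_goals
      exact hT.unembed_const _ _ _ _ _ (by trivial) (by trivial)
        (fun h => by first | exact h.1 | exact h.2)
  · rw [T.table_mlp hid P l s y hy, ← T.vec_source hid oc y hy]
    change T.prodMlp P l _ _ = _
    rcases y with _ | (a' | ⟨l', s'⟩) | k' <;>
      exact hT.mlp_const _ _ _ _ _ (by trivial)

end Transformer

/-- A product table together with its hyperparameters. -/
structure Code (S : Type u) where
  layers : ℕ
  heads : ℕ
  units : ℕ
  table : ProductTable S layers heads units

variable {S : Type u}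

/-- The transformer has no positional encodings, and at every character offset its product
functions are those of the code. -/
def Transformer.HasCode {N : ℕ∞} {H : Type} [NormedAddCommGroup H] [InnerProductSpace ℝ H] {m : ℕ}
    (T : Transformer S N H m) (Z : Code S) : Prop :=
  T.NoPE ∧ ∃ (M : ℕ) (hid : Fin T.layers → Fin M → Fin m)
    (D : ProductTable S T.layers T.heads M), Z = ⟨T.layers, T.heads, M, D⟩ ∧ T.Covers hid ∧
      ∀ oc, (T.sys oc hid).Realizes (window N oc) D

/-- With the dimensions of both systems as free variables, equality of the codes can be eliminated
by `cases`, and no casts between tables of different shapes appear. -/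
theorem Sys.logits_eq_of_code_eq {L Hd M L' Hd' M' : ℕ} {D : ProductTable S L Hd M}
    {D' : ProductTable S L' Hd' M'} (h : (⟨L, Hd, M, D⟩ : Code S) = ⟨L', Hd', M', D'⟩)
    {H : Type} [NormedAddCommGroup H] [InnerProductSpace ℝ H]
    {H' : Type} [NormedAddCommGroup H'] [InnerProductSpace ℝ H']
    {Y : Sys S L Hd M H} {Y' : Sys S L' Hd' M' H'} {I : Set ℕ} (hY : Y.Realizes I D)
    (hY' : Y'.Realizes I D') (ε : ℝ) (w : Word S) (hw : ∀ k, Sum.inr k ∈ w → k ∈ I)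
    (i : Fin (inputLength w)) {ω : Vocab S ℕ} (hω : ω.In I) :
    Y.logits ε w i ω = Y'.logits ε w i ω := by
  cases h
  exact Sys.logits_eq_of_realizes hY hY' ε w hw i hω

/-- Transformers with the same code agree wherever both are defined. -/
theorem Transformer.HasCode.logits_eq {N N' : ℕ∞}
    {H : Type} [NormedAddCommGroup H] [InnerProductSpace ℝ H]
    {H' : Type} [NormedAddCommGroup H'] [InnerProductSpace ℝ H'] {m m' : ℕ}
    {T : Transformer S N H m} {T' : Transformer S N' H' m'} {Z : Code S} (hT : T.HasCode Z)
    (hT' : T'.HasCode Z) (ε : ℝ) (op oc op' oc' : ℕ) (w : Word S)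
    (hw : ∀ k, Sum.inr k ∈ w → k ∈ window N oc) (hw' : ∀ k, Sum.inr k ∈ w → k ∈ window N' oc')
    (i : Fin (inputLength w)) {ω : Vocab S ℕ} (hω : ω.In (window N oc))
    (hω' : ω.In (window N' oc')) :
    T.logits ε op oc w i ω = T'.logits ε op' oc' w i ω := by
  obtain ⟨hpe, M, hid, D, hZ, hc, hD⟩ := hT
  obtain ⟨hpe', M', hid', D', hZ', hc', hD'⟩ := hT'
  rw [T.logits_eq_sys hpe hc, T'.logits_eq_sys hpe' hc']
  -- The windows may differ; both realizations are cut down to the intersection, which contains all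
  -- symbols involved.
  refine Sys.logits_eq_of_code_eq (hZ.symm.trans hZ')
    ((hD oc).mono Set.inter_subset_left) ((hD' oc').mono Set.inter_subset_right) ε w
    (fun k hk => ⟨hw k hk, hw' k hk⟩) i ?_
  cases ω <;> trivial

end SymbolicLimit

end

/-! ### Finiteness of the set of bounded codes. -/

noncomputable section

namespace SymbolicLimit

universe u

variable {S : Type u}

instance Act.instFinite : Finite Act := by
  let g : Act → Option Bool := fun a => match a with
    | .relu => none
    | .heaviside => some true
    | .recip => some false
  refine Finite.of_injective g ?_
  rintro (_ | _ | _) (_ | _ | _) h <;> simp_all [g]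

/-- Numbers with `p` fractional bits and absolute value at most `c`. -/
def grid (p : ℕ) (c : ℝ) : Set ℝ := {x | IsBit p x ∧ |x| ≤ c}

theorem grid_finite (p : ℕ) (c : ℝ) : (grid p c).Finite := by
  refine ((Set.finite_Icc (-⌈c * 2 ^ p⌉) ⌈c * 2 ^ p⌉).image
    (fun z : ℤ => (z : ℝ) / 2 ^ p)).subset ?_
  rintro x ⟨⟨z, rfl⟩, hx⟩
  refine ⟨z, ?_, rfl⟩
  rw [abs_div, abs_of_pos (by positivity : (0 : ℝ) < 2 ^ p), div_le_iff₀ (by positivity)] at hx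
  rw [Set.mem_Icc, ← abs_le]
  have : ((|z| : ℤ) : ℝ) ≤ (⌈c * 2 ^ p⌉ : ℝ) := by
    rw [Int.cast_abs]
    exact hx.trans (Int.le_ceil _)
  exact_mod_cast this

theorem zero_mem_grid {p : ℕ} {c : ℝ} (hc : 0 ≤ c) : (0 : ℝ) ∈ grid p c :=
  ⟨⟨0, by simp⟩, by simpa⟩

/-- Apply a function to the index of an extended symbol. -/
def Vocab.mapExt {A : Type*} {ι κ : Type} (g : ι → κ) : Vocab A ι → Vocab A κ
  | .start => .start
  | .sym a => .sym a
  | .ext k => .ext (g k)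

namespace ProductTable

variable {L Hd M : ℕ}

/-- The entries of the table have finite precision and are bounded, translation invariant and
local. -/
structure Good (D : ProductTable S L Hd M) (Δ p : ℕ) (c : ℝ) : Prop where
  attn_mem : ∀ l h P P' x y, D.attn l h P P' x y ∈ grid p c
  unembed_mem : ∀ P ω y, D.unembed P ω y ∈ grid p c
  mlp_mem : ∀ P l s y, D.mlp P l s y ∈ grid p c
  bias_mem : ∀ l s, D.bias l s ∈ grid p c
  attn_rel : ∀ l h P P' x y, D.attn l h P P' x y = D.attn l h P P' (x.rel y) (y.rel x)
  unembed_rel : ∀ P ω y, D.unembed P ω y = D.unembed P (ω.rel y) (y.rel ω)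
  mlp_rel : ∀ P l s y, D.mlp P l s y = D.mlp P l s (y.rel (Vocab.start : Vocab S ℕ))
  attn_local : ∀ l h P P' i j, Δ < Nat.dist i j → D.attn l h P P' (.ext i) (.ext j) = 0
  unembed_local : ∀ P i j, Δ < Nat.dist i j → D.unembed P (.ext i) (.ext j) = 0
  -- By translation invariance such an entry is the same for all `i`; unless it is zero, the
  -- resulting logits over an infinite vocabulary are not square-summable.
  unembed_ext : ∀ P i y, (∀ j, y ≠ .ext j) → D.unembed P (.ext i) y = 0

theorem exists_rel_eq_mapExt {A B : Type*} {Δ : ℕ} (x : Vocab A ℕ) (y : Vocab B ℕ)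
    (h : ∀ i j, x = .ext i → y = .ext j → i - j ≤ Δ) :
    ∃ x' : Vocab A (Fin (Δ + 1)), x.rel y = x'.mapExt Fin.val := by
  rcases x with _ | a | i
  · exact ⟨.start, rfl⟩
  · exact ⟨.sym a, rfl⟩
  · rcases y with _ | b | j
    · exact ⟨.ext 0, rfl⟩
    · exact ⟨.ext 0, rfl⟩
    · exact ⟨.ext ⟨i - j, Nat.lt_succ_of_le (h i j rfl rfl)⟩, rfl⟩

/-- Either two items are far apart extended symbols, or their relative indices are at
most `Δ`. -/
theorem exists_rel_eq {A B : Type*} (Δ : ℕ) (x : Vocab A ℕ) (y : Vocab B ℕ) :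
    (∃ i j, Δ < Nat.dist i j ∧ x = .ext i ∧ y = .ext j) ∨
      ∃ (x' : Vocab A (Fin (Δ + 1))) (y' : Vocab B (Fin (Δ + 1))),
        x.rel y = x'.mapExt Fin.val ∧ y.rel x = y'.mapExt Fin.val := by
  by_cases h : ∃ i j, Δ < Nat.dist i j ∧ x = .ext i ∧ y = .ext j
  · exact Or.inl h
  · right
    obtain ⟨x', hx'⟩ := exists_rel_eq_mapExt (Δ := Δ) x y fun i j hi hj => by
      by_contra hlt
      exact h ⟨i, j, by unfold Nat.dist; omega, hi, hj⟩
    obtain ⟨y', hy'⟩ := exists_rel_eq_mapExt (Δ := Δ) y x fun j i hj hi => by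
      by_contra hlt
      exact h ⟨i, j, by unfold Nat.dist; omega, hi, hj⟩
    exact ⟨x', y', hx', hy'⟩

/-- Passing to relative indices, each entry either belongs to a far pair and vanishes or is an entry
with indices at most `Δ`. Thus a good table is determined by finitely many entries, each with
finitely many possible values. -/
theorem good_finite [Finite S] (L Hd M Δ p r : ℕ) (c : ℝ) :
    {D : ProductTable S L Hd M | D.Good Δ p c ∧ D.roundPrec ≤ r}.Finite := by
  have := (grid_finite p c).to_subtype
  let X := Vocab (Letters S L M) (Fin (Δ + 1))
  let Pth := Fin L → Option (Fin Hd)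
  have hX : Finite X := Vocab.instFinite
  have hP : Finite Pth := Pi.finite
  let F : {D : ProductTable S L Hd M | D.Good Δ p c ∧ D.roundPrec ≤ r} →
      (Fin (r + 1) × (Fin L → Fin M → Act) × (Fin L → Fin M → grid p c)) ×
      (Fin L × Fin Hd × Pth × Pth × X × X → grid p c) ×
      (Pth × Vocab S (Fin (Δ + 1)) × X → grid p c) × (Pth × Fin L × Fin M × X → grid p c) :=
    fun D => ((⟨D.1.roundPrec, Nat.lt_succ_of_le D.2.2⟩, D.1.act,
        fun l s => ⟨D.1.bias l s, D.2.1.bias_mem l s⟩),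
      fun (l, h, P, P', x, y) =>
        ⟨_, D.2.1.attn_mem l h P P' (x.mapExt Fin.val) (y.mapExt Fin.val)⟩,
      fun (P, ω, y) => ⟨_, D.2.1.unembed_mem P (ω.mapExt Fin.val) (y.mapExt Fin.val)⟩,
      fun (P, l, s, y) => ⟨_, D.2.1.mlp_mem P l s (y.mapExt Fin.val)⟩)
  suffices hF : Function.Injective F from Set.finite_coe_iff.1 (Finite.of_injective F hF)
  rintro ⟨D, hD, hr⟩ ⟨D', hD', hr'⟩ h
  simp only [F, Prod.mk.injEq, Fin.mk.injEq, funext_iff, Subtype.mk.injEq, Prod.forall] at h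
  obtain ⟨⟨h1, h2, h3⟩, h4, h5, h6⟩ := h
  rw [Subtype.mk.injEq]
  have e2 : D.act = D'.act := funext₂ h2
  have e3 : D.bias = D'.bias := funext₂ h3
  have e4 : D.attn = D'.attn := by
    funext l h P P' x y
    rcases exists_rel_eq Δ x y with ⟨i, j, hij, rfl, rfl⟩ | ⟨x', y', hx, hy⟩
    · rw [hD.attn_local _ _ _ _ _ _ hij, hD'.attn_local _ _ _ _ _ _ hij]
    · rw [hD.attn_rel, hD'.attn_rel, hx, hy, h4]
  have e5 : D.unembed = D'.unembed := by
    funext P x y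
    rcases exists_rel_eq Δ x y with ⟨i, j, hij, rfl, rfl⟩ | ⟨x', y', hx, hy⟩
    · rw [hD.unembed_local _ _ _ hij, hD'.unembed_local _ _ _ hij]
    · rw [hD.unembed_rel, hD'.unembed_rel, hx, hy, h5]
  have e6 : D.mlp = D'.mlp := by
    funext P l s y
    rcases exists_rel_eq Δ y (Vocab.start : Vocab S ℕ) with ⟨i, j, -, -, h⟩ | ⟨y', x', hy, -⟩
    · cases h
    · rw [hD.mlp_rel, hD'.mlp_rel, hy, h6]
  cases D; cases D'
  simp only at h1 e2 e3 e4 e5 e6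
  subst h1 e2 e3 e4 e5 e6
  rfl

end ProductTable

/-- The code has bounded size, and its entries have bounded precision and size. -/
def Code.Bounded (Z : Code S) (n : ℕ) : Prop :=
  (Z.layers ≤ n ∧ Z.heads ≤ n ∧ Z.units ≤ n ∧ Z.table.roundPrec ≤ n) ∧ Z.table.Good n n n

theorem Code.bounded_finite [Finite S] (n : ℕ) : {Z : Code S | Z.Bounded n}.Finite := by
  have h : (⋃ q ∈ (Set.Iic n ×ˢ Set.Iic n ×ˢ Set.Iic n : Set (ℕ × ℕ × ℕ)),
      (fun D => (⟨q.1, q.2.1, q.2.2, D⟩ : Code S)) ''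
        {D | D.Good n n n ∧ D.roundPrec ≤ n}).Finite := by
    refine Set.Finite.biUnion ?_ fun q _ => (ProductTable.good_finite _ _ _ _ _ _ _).image _
    exact (Set.finite_Iic n).prod ((Set.finite_Iic n).prod (Set.finite_Iic n))
  refine h.subset ?_
  rintro ⟨L, Hd, M, D⟩ ⟨⟨h1, h2, h3, h4⟩, h5⟩
  simp only [Set.mem_iUnion]
  exact ⟨(L, Hd, M), ⟨h1, h2, h3⟩, D, ⟨h5, h4⟩, rfl⟩

end SymbolicLimit

end

/-! ### Sparse matrices as bounded operators. -/

noncomputable section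

namespace SymbolicLimit

/-- `ℓ²`. -/
abbrev L2 (I : Type*) : Type _ := lp (fun _ : I => ℝ) 2

theorem sum_sq_le_norm_sq {I : Type*} (x : L2 I) (F : Finset I) : ∑ i ∈ F, x i ^ 2 ≤ ‖x‖ ^ 2 := by
  have h := lp.sum_rpow_le_norm_rpow (p := 2) (by norm_num) x F
  simpa using h

theorem norm_le_of_sum_sq_le {I : Type*} (x : L2 I) {C : ℝ} (hC : 0 ≤ C)
    (h : ∀ F : Finset I, ∑ i ∈ F, x i ^ 2 ≤ C ^ 2) : ‖x‖ ≤ C :=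
  lp.norm_le_of_forall_sum_le (p := 2) (by norm_num) hC fun F => by simpa using h F

/-- The nonzero entries of the matrix have absolute value at most `c`, and there are at most `k` of
them in each row and in each column. -/
structure Sparse {I J : Type*} (A : I → J → ℝ) (k : ℕ) (c : ℝ) : Prop where
  abs_le : ∀ i j, |A i j| ≤ c
  row : ∀ i, ∃ s : Finset J, s.card ≤ k ∧ ∀ j, A i j ≠ 0 → j ∈ s
  col : ∀ j, ∃ s : Finset I, s.card ≤ k ∧ ∀ i, A i j ≠ 0 → i ∈ s

namespace Sparse

variable {I J : Type*} {A : I → J → ℝ} {k : ℕ} {c : ℝ}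

/-- A finite set that contains the support of a row. -/
def support (h : Sparse A k c) (i : I) : Finset J := by
  classical
  exact (h.row i).choose.filter fun j => A i j ≠ 0

theorem mem_support (h : Sparse A k c) (i : I) (j : J) : j ∈ h.support i ↔ A i j ≠ 0 := by
  classical
  unfold support
  rw [Finset.mem_filter]
  exact ⟨fun h => h.2, fun hj => ⟨(h.row i).choose_spec.2 j hj, hj⟩⟩

theorem card_support_le (h : Sparse A k c) (i : I) : (h.support i).card ≤ k := by
  classical
  exact (Finset.card_filter_le _ _).trans (h.row i).choose_spec.1

/-- The action of the matrix on a function. -/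
def mulVec (h : Sparse A k c) (x : J → ℝ) (i : I) : ℝ := ∑ j ∈ h.support i, A i j * x j

/-- A Schur-type estimate: Cauchy–Schwarz in each row costs a factor `k * c ^ 2`, and each `x j ^ 2`
then occurs in at most `k` rows. The bound does not involve the sizes of the index sets, so it is
uniform in the context window. -/
theorem sum_mulVec_sq_le (h : Sparse A k c) (x : L2 J) (F : Finset I) :
    ∑ i ∈ F, h.mulVec x i ^ 2 ≤ (k * c * ‖x‖) ^ 2 := by
  classical
  have h1 : ∀ i ∈ F, h.mulVec x i ^ 2 ≤ k * c ^ 2 * ∑ j ∈ h.support i, x j ^ 2 := by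
    intro i _
    have hcs := sq_sum_le_card_mul_sum_sq (s := h.support i) (f := fun j => A i j * x j)
    have h2 : ∑ j ∈ h.support i, (A i j * x j) ^ 2 ≤ c ^ 2 * ∑ j ∈ h.support i, x j ^ 2 := by
      rw [Finset.mul_sum]
      refine Finset.sum_le_sum fun j _ => ?_
      rw [mul_pow]
      refine mul_le_mul_of_nonneg_right ?_ (sq_nonneg _)
      rw [← sq_abs]
      exact pow_le_pow_left₀ (abs_nonneg _) (h.abs_le i j) 2
    have h3 : ((h.support i).card : ℝ) ≤ k := by exact_mod_cast h.card_support_le i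
    calc h.mulVec x i ^ 2 ≤ (h.support i).card * ∑ j ∈ h.support i, (A i j * x j) ^ 2 := hcs
      _ ≤ k * (c ^ 2 * ∑ j ∈ h.support i, x j ^ 2) :=
        mul_le_mul h3 h2 (Finset.sum_nonneg fun _ _ => sq_nonneg _) (Nat.cast_nonneg _)
      _ = _ := by ring
  have h2 : ∑ i ∈ F, ∑ j ∈ h.support i, x j ^ 2 ≤ k * ‖x‖ ^ 2 := by
    have e : ∀ i ∈ F, ∑ j ∈ h.support i, x j ^ 2 =
        ∑ j ∈ F.biUnion h.support, if A i j ≠ 0 then x j ^ 2 else 0 := by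
      intro i hi
      rw [← Finset.sum_filter]
      refine Finset.sum_congr ?_ fun _ _ => rfl
      ext j
      simp only [Finset.mem_filter, Finset.mem_biUnion, h.mem_support]
      exact ⟨fun hj => ⟨⟨i, hi, hj⟩, hj⟩, fun hj => hj.2⟩
    rw [Finset.sum_congr rfl e, Finset.sum_comm]
    calc ∑ j ∈ F.biUnion h.support, ∑ i ∈ F, (if A i j ≠ 0 then x j ^ 2 else 0)
        ≤ ∑ j ∈ F.biUnion h.support, k * x j ^ 2 := by
          refine Finset.sum_le_sum fun j _ => ?_
          rw [← Finset.sum_filter, Finset.sum_const, nsmul_eq_mul]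
          refine mul_le_mul_of_nonneg_right ?_ (sq_nonneg _)
          obtain ⟨s, hs, hs'⟩ := h.col j
          have : (F.filter fun i => A i j ≠ 0).card ≤ s.card :=
            Finset.card_le_card fun i hi => hs' i (Finset.mem_filter.1 hi).2
          exact_mod_cast this.trans hs
      _ = k * ∑ j ∈ F.biUnion h.support, x j ^ 2 := by rw [Finset.mul_sum]
      _ ≤ _ := mul_le_mul_of_nonneg_left (sum_sq_le_norm_sq x _) (Nat.cast_nonneg _)
  calc ∑ i ∈ F, h.mulVec x i ^ 2 ≤ ∑ i ∈ F, k * c ^ 2 * ∑ j ∈ h.support i, x j ^ 2 :=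
        Finset.sum_le_sum h1
    _ = k * c ^ 2 * ∑ i ∈ F, ∑ j ∈ h.support i, x j ^ 2 := by rw [Finset.mul_sum]
    _ ≤ k * c ^ 2 * (k * ‖x‖ ^ 2) := mul_le_mul_of_nonneg_left h2 (by positivity)
    _ = _ := by ring

/-- A sparse matrix as an operator on `ℓ²`. -/
def toL2 (h : Sparse A k c) (hc : 0 ≤ c) : L2 J →L[ℝ] L2 I :=
  LinearMap.mkContinuous
    { toFun := fun x => ⟨fun i => h.mulVec x i, memℓp_gen' (C := (k * c * ‖x‖) ^ 2) fun F => by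
        simpa using h.sum_mulVec_sq_le x F⟩
      map_add' := fun x y => by
        ext i
        simp [mulVec, mul_add, Finset.sum_add_distrib]
        rfl
      map_smul' := fun a x => by
        ext i
        simp [mulVec, Finset.mul_sum, mul_left_comm] }
    (k * c) fun x => norm_le_of_sum_sq_le _ (by positivity) fun F => h.sum_mulVec_sq_le x F

theorem norm_toL2_le (h : Sparse A k c) (hc : 0 ≤ c) : ‖h.toL2 hc‖ ≤ k * c :=
  LinearMap.mkContinuous_norm_le _ (by positivity) _

theorem toL2_single [DecidableEq J] (h : Sparse A k c) (hc : 0 ≤ c) (i : I) (j : J) :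
    h.toL2 hc (lp.single 2 j (1 : ℝ)) i = A i j := by
  change ∑ j' ∈ h.support i, A i j' * (lp.single 2 j (1 : ℝ) : L2 J) j' = A i j
  by_cases hj : A i j = 0
  · rw [hj]
    refine Finset.sum_eq_zero fun j' hj' => ?_
    rw [h.mem_support] at hj'
    have : j' ≠ j := fun e => hj' (e ▸ hj)
    rw [lp.coeFn_single, Pi.single_eq_of_ne this, mul_zero]
  · rw [Finset.sum_eq_single j]
    · simp
    · intro j' _ hne
      rw [lp.coeFn_single, Pi.single_eq_of_ne hne, mul_zero]
    · intro hj'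
      rw [h.mem_support] at hj'
      exact absurd hj hj'

variable {H H' : Type*} [NormedAddCommGroup H] [InnerProductSpace ℝ H] [NormedAddCommGroup H']
  [InnerProductSpace ℝ H']

/-- A sparse matrix as an operator between Hilbert spaces with orthonormal bases. -/
def toCLM (h : Sparse A k c) (hc : 0 ≤ c) (b : HilbertBasis J ℝ H) (b' : HilbertBasis I ℝ H') :
    H →L[ℝ] H' :=
  (b'.repr.symm.toContinuousLinearEquiv : L2 I →L[ℝ] H').comp
    ((h.toL2 hc).comp (b.repr.toContinuousLinearEquiv : H →L[ℝ] L2 J))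

theorem toCLM_apply (h : Sparse A k c) (hc : 0 ≤ c) (b : HilbertBasis J ℝ H)
    (b' : HilbertBasis I ℝ H') (x : H) : h.toCLM hc b b' x = b'.repr.symm (h.toL2 hc (b.repr x)) :=
  rfl

theorem norm_toCLM_le (h : Sparse A k c) (hc : 0 ≤ c) (b : HilbertBasis J ℝ H)
    (b' : HilbertBasis I ℝ H') : ‖h.toCLM hc b b'‖ ≤ k * c := by
  refine ContinuousLinearMap.opNorm_le_bound _ (by positivity) fun x => ?_
  rw [toCLM_apply, LinearIsometryEquiv.norm_map]
  refine ((h.toL2 hc).le_of_opNorm_le (h.norm_toL2_le hc) _).trans_eq ?_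
  rw [LinearIsometryEquiv.norm_map]

theorem repr_toCLM (h : Sparse A k c) (hc : 0 ≤ c) (b : HilbertBasis J ℝ H)
    (b' : HilbertBasis I ℝ H') (i : I) (j : J) : b'.repr (h.toCLM hc b b' (b j)) i = A i j := by
  classical
  rw [toCLM_apply, LinearIsometryEquiv.apply_symm_apply, HilbertBasis.repr_self, toL2_single]

theorem inner_toCLM (h : Sparse A k c) (hc : 0 ≤ c) (b : HilbertBasis J ℝ H)
    (b' : HilbertBasis I ℝ H') (i : I) (j : J) : ⟪b' i, h.toCLM hc b b' (b j)⟫_ℝ = A i j := by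
  rw [← HilbertBasis.repr_apply_apply, repr_toCLM]

theorem toCLM_eq_of_single (h : Sparse A k c) (hc : 0 ≤ c) (b : HilbertBasis J ℝ H)
    (b' : HilbertBasis I ℝ H') (i : I) (j : J) (h1 : A i j = 1) (h0 : ∀ i', i' ≠ i → A i' j = 0) :
    h.toCLM hc b b' (b j) = b' i := by
  classical
  apply b'.repr.injective
  ext i'
  rw [repr_toCLM, HilbertBasis.repr_self, lp.coeFn_single]
  by_cases e : i' = i
  · subst e; rw [h1, Pi.single_eq_same]
  · rw [h0 _ e, Pi.single_eq_of_ne e]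

theorem toCLM_eq_zero (h : Sparse A k c) (hc : 0 ≤ c) (b : HilbertBasis J ℝ H)
    (b' : HilbertBasis I ℝ H') (j : J) (h0 : ∀ i, A i j = 0) : h.toCLM hc b b' (b j) = 0 := by
  apply b'.repr.injective
  ext i'
  rw [repr_toCLM, h0, map_zero]
  rfl

end Sparse

end SymbolicLimit

end

/-! ### Coordinates and matrices that realize a given table. -/

noncomputable section

namespace SymbolicLimit

universe u

section Form

variable {A B : Type*} {N : ℕ∞}

/-- The extended symbol with a given index, or the direction shared by all extended symbols if the
index is outside of the context window. -/
def slotAt (N : ℕ∞) (k : ℕ) : Option (Slot N) := open Classical in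
  if h : (k : ℕ∞) < N then some ⟨k, h⟩ else none

theorem slotAt_val (k : Slot N) : slotAt N k.1 = some k := dif_pos k.2

/-- The index of an extended symbol; `0` for all other items. -/
def Vocab.index : Vocab A (Option (Slot N)) → ℕ
  | .ext (some k) => k
  | _ => 0

/-- All items other than extended symbols at a distance larger than `Δ` from `i`. -/
def near (B : Type*) [Finite B] (N : ℕ∞) (Δ i : ℕ) : Finset (Vocab B (Option (Slot N))) := by
  classical
  letI := Fintype.ofFinite (Vocab B Unit)
  exact (Finset.univ.image fun x : Vocab B Unit => x.mapExt fun _ => none) ∪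
    -- These are the indices from `i - Δ` to `i + Δ`. Truncation at `0` and indices beyond the
    -- window only produce repetitions, which is harmless for an upper bound on the cardinality.
    (Finset.range (2 * Δ + 1)).image fun t => .ext (slotAt N (i + t - Δ))

theorem card_near_le [Finite B] (Δ i : ℕ) :
    (near B N Δ i).card ≤ Nat.card (Vocab B Unit) + (2 * Δ + 1) := by
  classical
  refine (Finset.card_union_le _ _).trans (Nat.add_le_add ?_ ?_)
  · let := Fintype.ofFinite (Vocab B Unit)
    rw [Nat.card_eq_fintype_card]
    exact Finset.card_image_le
  · exact Finset.card_image_le.trans_eq (Finset.card_range _)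

theorem mem_near [Finite B] {Δ i : ℕ} {y : Vocab B (Option (Slot N))}
    (h : ∀ j : Slot N, y = .ext (some j) → Nat.dist i j ≤ Δ) : y ∈ near B N Δ i := by
  classical
  let := Fintype.ofFinite (Vocab B Unit)
  unfold near
  rw [Finset.mem_union, Finset.mem_image, Finset.mem_image]
  rcases y with _ | b | (_ | j)
  · exact Or.inl ⟨.start, Finset.mem_univ _, rfl⟩
  · exact Or.inl ⟨.sym b, Finset.mem_univ _, rfl⟩
  · exact Or.inl ⟨.ext (), Finset.mem_univ _, rfl⟩
  · right
    have hj := h j rfl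
    unfold Nat.dist at hj
    refine ⟨j + Δ - i, Finset.mem_range.2 (by omega), ?_⟩
    rw [show i + (j + Δ - i) - Δ = (j : ℕ) by omega, slotAt_val]

/-- The interactions `F` as a matrix, in coordinates in which each extended symbol is the sum of a
direction of its own and a direction shared by all extended symbols. -/
def form (F : Vocab A ℕ → Vocab B ℕ → ℝ) :
    Vocab A (Option (Slot N)) → Vocab B (Option (Slot N)) → ℝ
  | .ext (some i), .ext (some j) => F (.ext i) (.ext j)
  | .ext (some _), _ => 0
  | _, .ext (some _) => 0
  | .ext none, .ext none => 0
  | x, y => F (x.mapExt fun _ => 0) (y.mapExt fun _ => 0)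

theorem form_mem (F : Vocab A ℕ → Vocab B ℕ → ℝ) {G : Set ℝ} (hG : (0 : ℝ) ∈ G)
    (h : ∀ x y, F x y ∈ G) (x : Vocab A (Option (Slot N))) (y : Vocab B (Option (Slot N))) :
    form F x y ∈ G := by
  rcases x with _ | a | (_ | i) <;> rcases y with _ | b | (_ | j) <;>
    first | exact hG | exact h _ _

/-- This is what the shared direction is for. The constant interaction of all extended symbols with
another item would fill a whole row or column; moved to the shared direction it is a single entry,
and what remains in the private directions is banded by locality. -/
theorem form_near_right [Finite B] (F : Vocab A ℕ → Vocab B ℕ → ℝ) {Δ : ℕ}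
    (h : ∀ i j, Δ < Nat.dist i j → F (.ext i) (.ext j) = 0) (x : Vocab A (Option (Slot N)))
    (y : Vocab B (Option (Slot N))) (hxy : form F x y ≠ 0) : y ∈ near B N Δ x.index := by
  refine mem_near fun j hj => ?_
  subst hj
  by_contra hlt
  rcases x with _ | a | (_ | i)
  · exact hxy rfl
  · exact hxy rfl
  · exact hxy rfl
  · exact hxy (h _ _ (not_le.1 hlt))

theorem form_near_left [Finite A] (F : Vocab A ℕ → Vocab B ℕ → ℝ) {Δ : ℕ}
    (h : ∀ i j, Δ < Nat.dist i j → F (.ext i) (.ext j) = 0) (x : Vocab A (Option (Slot N)))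
    (y : Vocab B (Option (Slot N))) (hxy : form F x y ≠ 0) : x ∈ near A N Δ y.index := by
  refine mem_near fun j hj => ?_
  subst hj
  by_contra hlt
  rcases y with _ | a | (_ | i)
  · exact hxy rfl
  · exact hxy rfl
  · exact hxy rfl
  · exact hxy (h _ _ (by rw [Nat.dist_comm]; exact not_le.1 hlt))

variable {E : Type*} [AddCommGroup E] [Module ℝ E] {E' : Type*} [AddCommGroup E'] [Module ℝ E']

/-- The vector that represents an item: for an extended symbol, the sum of its own and of the shared
direction. -/
def spread (b : Vocab A (Option (Slot N)) → E) : Vocab A (Slot N) → E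
  | .start => b .start
  | .sym a => b (.sym a)
  | .ext k => b (.ext (some k)) + b (.ext none)

theorem map_spread (f : E →ₗ[ℝ] E') (b : Vocab A (Option (Slot N)) → E) (x : Vocab A (Slot N)) :
    f (spread b x) = spread (fun y => f (b y)) x := by
  rcases x with _ | a | k <;> simp [spread]

/-- An item of the context window as an item of the full vocabulary. -/
abbrev Vocab.full (x : Vocab A (Slot N)) : Vocab A ℕ := x.mapExt fun k : Slot N => k.1

/-- Expanding the sums, exactly one term survives: private with private for two extended symbols,
and the shared direction, evaluated at index `0`, for an extended symbol and another item. There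
`hF` moves the index to `0`. -/
theorem spread_form (F : Vocab A ℕ → Vocab B ℕ → ℝ) (hF : ∀ x y, F x y = F (x.rel y) (y.rel x))
    (x : Vocab A (Slot N)) (y : Vocab B (Slot N)) :
    spread (fun x' => spread (fun y' => form F x' y') y) x = F x.full y.full := by
  rcases x with _ | a | i <;> rcases y with _ | b | j <;>
    simp only [spread, form, add_zero, zero_add, Vocab.full, Vocab.mapExt]
  all_goals
    symm
    exact hF _ _

/-- The output space `ℓ²` of the vocabulary has no shared direction, so a row of an extended symbol
consists of its private part alone. The constant interactions that this loses have to vanish, which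
is `h0`. -/
theorem spread_form_row (F : Vocab A ℕ → Vocab B ℕ → ℝ)
    (hF : ∀ x y, F x y = F (x.rel y) (y.rel x)) (h0 : ∀ i y, (∀ j, y ≠ .ext j) → F (.ext i) y = 0)
    (x : Vocab A (Slot N)) (y : Vocab B (Slot N)) :
    spread (fun y' => form F (x.mapExt some) y') y = F x.full y.full := by
  rcases x with _ | a | i <;> rcases y with _ | b | j <;>
    simp only [spread, form, add_zero, zero_add, Vocab.full, Vocab.mapExt]
  case ext.start => exact (h0 _ _ (fun _ h => by cases h)).symm
  case ext.sym => exact (h0 _ _ (fun _ h => by cases h)).symm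
  all_goals
    symm
    exact hF _ _

end Form

variable {S : Type u} {L Hd M m : ℕ} {N : ℕ∞}

/-- The coordinates of the residual stream: a vector of the symbolic expansion together with the
value matrices that were applied to it. -/
abbrev Coord (S : Type u) (L Hd M : ℕ) (N : ℕ∞) : Type u :=
  (Fin L → Option (Fin Hd)) × Vocab (Letters S L M) (Option (Slot N))

namespace ProductTable

/-- A bound on the number of nonzero entries in rows and columns of the matrices of the model. -/
def width (_ : ProductTable S L Hd M) (Δ : ℕ) : ℕ :=
  Fintype.card (Fin L → Option (Fin Hd)) *
    (Nat.card (Vocab (Letters S L M) Unit) + Nat.card (Vocab S Unit) + (2 * Δ + 1)) + M + 1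

/-- A value matrix acts by recording itself in the path. Coordinates whose path already uses layer
`l` are sent to zero; a product with at most one matrix per layer, applied to a generator, never
meets them. -/
def valueMatrix (S : Type u) (M : ℕ) (N : ℕ∞) (l : Fin L) (h : Fin Hd) :
    Coord S L Hd M N → Coord S L Hd M N → ℝ := fun q q' => open Classical in
  if q'.1 l = none ∧ q = (Function.update q'.1 l (some h), q'.2) then 1 else 0

def queryMatrix (D : ProductTable S L Hd M) (N : ℕ∞) (l : Fin L) (h : Fin Hd) :
    Coord S L Hd M N → Coord S L Hd M N → ℝ := fun q q' =>
  form (D.attn l h q.1 q'.1) q.2 q'.2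

def unembedMatrix (D : ProductTable S L Hd M) (N : ℕ∞) :
    Vocab S (Slot N) → Coord S L Hd M N → ℝ := fun ω q =>
  form (D.unembed q.1) (ω.mapExt some) q.2

/-- An input row of an MLP is treated as an interaction with the start symbol, so that extended
symbols act only through the shared direction. -/
def mlpEntry (D : ProductTable S L Hd M) (N : ℕ∞) (l : Fin L) (q : Coord S L Hd M N)
    (t : Fin M) : ℝ :=
  form (fun _ : Vocab S ℕ => D.mlp q.1 l t) .start q.2

def inMatrix (D : ProductTable S L Hd M) (N : ℕ∞) (hid : Fin L → Fin M → Fin m) (l : Fin L) :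
    Fin m → Coord S L Hd M N → ℝ := fun s q =>
  Function.extend (hid l) (D.mlpEntry N l q) 0 s

def unitCoord (S : Type u) (Hd : ℕ) (N : ℕ∞) (l : Fin L) (t : Fin M) : Coord S L Hd M N :=
  (fun _ => none, .sym (.inr (l, t)))

def outMatrix (S : Type u) (Hd : ℕ) (N : ℕ∞) (hid : Fin L → Fin M → Fin m) (l : Fin L) :
    Coord S L Hd M N → Fin m → ℝ := fun q s => open Classical in
  Function.extend (hid l) (fun t => if q = unitCoord S Hd N l t then 1 else 0) 0 s

variable {D : ProductTable S L Hd M} {Δ p : ℕ} {c : ℝ}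

theorem one_le_width : 1 ≤ D.width Δ := Nat.le_add_left _ _

theorem units_le_width : M ≤ D.width Δ := by unfold width; omega

theorem card_near_le_width [Finite S] (i : ℕ) :
    ((Finset.univ : Finset (Fin L → Option (Fin Hd))) ×ˢ near (Letters S L M) N Δ i).card ≤
      D.width Δ := by
  rw [Finset.card_product, Finset.card_univ]
  have h := card_near_le (B := Letters S L M) (N := N) Δ i
  have := Nat.mul_le_mul_left (Fintype.card (Fin L → Option (Fin Hd)))
    (h.trans (by omega : _ ≤ Nat.card (Vocab (Letters S L M) Unit) +
      Nat.card (Vocab S Unit) + (2 * Δ + 1)))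
  unfold width
  omega

theorem le_width_of_card_near [Finite S] (hcard : 1 ≤ Fintype.card (Fin L → Option (Fin Hd)))
    (i : ℕ) : (near S N Δ i).card ≤ D.width Δ := by
  have h := card_near_le (B := S) (N := N) Δ i
  have := Nat.mul_le_mul hcard
    (h.trans (by omega : _ ≤ Nat.card (Vocab (Letters S L M) Unit) +
      Nat.card (Vocab S Unit) + (2 * Δ + 1)))
  unfold width
  omega

theorem extend_mem {α β : Type*} {f : α → β} (hf : Function.Injective f) {g : α → ℝ} {G : Set ℝ}
    (hG : (0 : ℝ) ∈ G) (hg : ∀ a, g a ∈ G) (b : β) : Function.extend f g 0 b ∈ G := by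
  by_cases h : ∃ a, f a = b
  · obtain ⟨a, rfl⟩ := h
    rw [hf.extend_apply]
    exact hg a
  · rw [Function.extend_apply' _ _ _ h]
    exact hG

theorem mem_image_of_extend_ne_zero {α β : Type*} {f : α → β} [Fintype α] [DecidableEq β]
    {g : α → ℝ} {b : β} (h : Function.extend f g 0 b ≠ 0) : b ∈ Finset.univ.image f := by
  rw [Finset.mem_image]
  by_contra hb
  exact h (Function.extend_apply' _ _ _ fun ⟨a, ha⟩ => hb ⟨a, Finset.mem_univ _, ha⟩)

namespace Good

theorem zero_mem (_hD : D.Good Δ p c) : (0 : ℝ) ∈ grid p (max c 1) :=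
  zero_mem_grid (zero_le_one.trans (le_max_right _ _))

theorem one_mem (_hD : D.Good Δ p c) : (1 : ℝ) ∈ grid p (max c 1) :=
  ⟨⟨2 ^ p, by push_cast; field_simp⟩, by simp⟩

theorem grid_max {x : ℝ} (h : x ∈ grid p c) : x ∈ grid p (max c 1) :=
  ⟨h.1, h.2.trans (le_max_left _ _)⟩

theorem valueMatrix_mem (hD : D.Good Δ p c) (l : Fin L) (h : Fin Hd)
    (q q' : Coord S L Hd M N) : valueMatrix S M N l h q q' ∈ grid p (max c 1) := by
  unfold valueMatrix
  split
  · exact hD.one_mem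
  · exact hD.zero_mem

theorem queryMatrix_mem (hD : D.Good Δ p c) (l h q q') :
    D.queryMatrix N l h q q' ∈ grid p (max c 1) :=
  form_mem _ hD.zero_mem (fun _ _ => grid_max (hD.attn_mem _ _ _ _ _ _)) _ _

theorem unembedMatrix_mem (hD : D.Good Δ p c) (ω q) :
    D.unembedMatrix N ω q ∈ grid p (max c 1) :=
  form_mem _ hD.zero_mem (fun _ _ => grid_max (hD.unembed_mem _ _ _)) _ _

theorem mlpEntry_mem (hD : D.Good Δ p c) (l q t) : D.mlpEntry N l q t ∈ grid p (max c 1) :=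
  form_mem _ hD.zero_mem (fun _ _ => grid_max (hD.mlp_mem _ _ _ _)) _ _

theorem inMatrix_mem (hD : D.Good Δ p c) {hid : Fin L → Fin M → Fin m}
    (hi : ∀ l, Function.Injective (hid l)) (l s q) :
    D.inMatrix N hid l s q ∈ grid p (max c 1) :=
  extend_mem (hi l) hD.zero_mem (fun _ => hD.mlpEntry_mem _ _ _) _

theorem outMatrix_mem (hD : D.Good Δ p c) {hid : Fin L → Fin M → Fin m}
    (hi : ∀ l, Function.Injective (hid l)) (l q s) :
    outMatrix S Hd N hid l q s ∈ grid p (max c 1) := by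
  refine extend_mem (hi l) hD.zero_mem (fun _ => ?_) _
  split
  · exact hD.one_mem
  · exact hD.zero_mem

theorem sparse_value (hD : D.Good Δ p c) (l : Fin L) (h : Fin Hd) :
    Sparse (valueMatrix S M N l h) (D.width Δ) (max c 1) where
  abs_le q q' := (hD.valueMatrix_mem l h q q').2
  row q := by
    refine ⟨{(Function.update q.1 l none, q.2)}, by simpa using one_le_width, fun q' h' => ?_⟩
    unfold valueMatrix at h'
    have : q'.1 l = none ∧ q = (Function.update q'.1 l (some h), q'.2) := by
      by_contra hn; exact h' (if_neg hn)
    obtain ⟨h1, rfl⟩ := this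
    simp [← h1]
  col q' := by
    refine ⟨{(Function.update q'.1 l (some h), q'.2)}, by simpa using one_le_width, fun q h' => ?_⟩
    unfold valueMatrix at h'
    rw [Finset.mem_singleton]
    by_contra hn
    exact h' (if_neg fun h => hn h.2)

theorem sparse_query [Finite S] (hD : D.Good Δ p c) (l : Fin L) (h : Fin Hd) :
    Sparse (D.queryMatrix N l h) (D.width Δ) (max c 1) where
  abs_le q q' := (hD.queryMatrix_mem l h q q').2
  row q := ⟨_, card_near_le_width q.2.index, fun q' h' => Finset.mem_product.2
    ⟨Finset.mem_univ _, form_near_right _ (hD.attn_local l h q.1 q'.1) _ _ h'⟩⟩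
  col q' := ⟨_, card_near_le_width q'.2.index, fun q h' => Finset.mem_product.2
    ⟨Finset.mem_univ _, form_near_left _ (hD.attn_local l h q.1 q'.1) _ _ h'⟩⟩

theorem mapExt_some_injective :
    Function.Injective (Vocab.mapExt some : Vocab S (Slot N) → Vocab S (Option (Slot N))) := by
  rintro (_ | a | k) (_ | b | k') h <;> simp_all [Vocab.mapExt]

theorem sparse_unembed [Finite S] (hD : D.Good Δ p c) :
    Sparse (D.unembedMatrix N) (D.width Δ) (max c 1) where
  abs_le q q' := (hD.unembedMatrix_mem q q').2
  row ω := ⟨_, card_near_le_width (ω.mapExt some).index, fun q h' => Finset.mem_product.2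
    ⟨Finset.mem_univ _, form_near_right _ (hD.unembed_local q.1) _ _ h'⟩⟩
  col q := by
    classical
    refine ⟨(near S N Δ q.2.index).preimage _ mapExt_some_injective.injOn, ?_, fun ω h' =>
      Finset.mem_preimage.2 (form_near_left _ (hD.unembed_local q.1) _ _ h')⟩
    rw [Finset.card_preimage]
    exact (Finset.card_filter_le _ _).trans
      (le_width_of_card_near (Fintype.card_pos_iff.2 ⟨q.1⟩) _)

theorem sparse_in [Finite S] (hD : D.Good Δ p c) {hid : Fin L → Fin M → Fin m}
    (hi : ∀ l, Function.Injective (hid l)) (l : Fin L) :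
    Sparse (D.inMatrix N hid l) (D.width Δ) (max c 1) where
  abs_le s q := (hD.inMatrix_mem hi l s q).2
  row s := by
    -- The centre `0` is arbitrary: entries at private directions vanish, so any neighbourhood
    -- contains the support.
    refine ⟨_, card_near_le_width 0, fun q h' => Finset.mem_product.2 ⟨Finset.mem_univ _, ?_⟩⟩
    have hs := mem_image_of_extend_ne_zero h'
    obtain ⟨t, -, rfl⟩ := Finset.mem_image.1 hs
    unfold inMatrix at h'
    rw [(hi l).extend_apply] at h'
    exact mem_near fun j hj => absurd (by unfold mlpEntry; rw [hj]; rfl) h'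
  col q := ⟨Finset.univ.image (hid l), (Finset.card_image_le.trans_eq (by simp)).trans
    units_le_width, fun s h' => mem_image_of_extend_ne_zero h'⟩

theorem sparse_out (hD : D.Good Δ p c) {hid : Fin L → Fin M → Fin m}
    (hi : ∀ l, Function.Injective (hid l)) (l : Fin L) :
    Sparse (outMatrix S Hd N hid l) (D.width Δ) (max c 1) where
  abs_le q s := (hD.outMatrix_mem hi l q s).2
  row q := ⟨Finset.univ.image (hid l), (Finset.card_image_le.trans_eq (by simp)).trans
    units_le_width, fun s h' => mem_image_of_extend_ne_zero h'⟩
  col s := by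
    by_cases hs : ∃ t, hid l t = s
    · obtain ⟨t, rfl⟩ := hs
      refine ⟨{unitCoord S Hd N l t}, by simpa using one_le_width, fun q h' => ?_⟩
      unfold outMatrix at h'
      rw [(hi l).extend_apply] at h'
      rw [Finset.mem_singleton]
      by_contra hn
      exact h' (if_neg hn)
    · exact ⟨∅, by simp, fun q h' => absurd (Function.extend_apply' _ _ _ hs) h'⟩

theorem attn_congr (hD : D.Good Δ p c) {l h P P'} {x y x' y' : Vocab (Letters S L M) ℕ} (hx : x.rel y = x'.rel y')
    (hy : y.rel x = y'.rel x') : D.attn l h P P' x y = D.attn l h P P' x' y' := by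
  rw [hD.attn_rel, hx, hy, ← hD.attn_rel]

theorem unembed_congr (hD : D.Good Δ p c) {P} {x x' : Vocab S ℕ} {y y' : Vocab (Letters S L M) ℕ}
    (hx : x.rel y = x'.rel y') (hy : y.rel x = y'.rel x') :
    D.unembed P x y = D.unembed P x' y' := by
  rw [hD.unembed_rel, hx, hy, ← hD.unembed_rel]

theorem mlp_congr (hD : D.Good Δ p c) {P l t} {y y' : Vocab (Letters S L M) ℕ}
    (hy : y.rel (Vocab.start : Vocab S ℕ) = y'.rel (Vocab.start : Vocab S ℕ)) :
    D.mlp P l t y = D.mlp P l t y' := by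
  rw [hD.mlp_rel, hy, ← hD.mlp_rel]

theorem spread_mlpEntry (hD : D.Good Δ p c) (l : Fin L) (t : Fin M)
    (P : Fin L → Option (Fin Hd)) (y : Vocab (Letters S L M) (Slot N)) :
    spread (fun y' => D.mlpEntry N l (P, y') t) y = D.mlp P l t y.full := by
  rcases y with _ | b | j <;>
    simp only [spread, mlpEntry, form, zero_add, Vocab.full, Vocab.mapExt]
  symm
  exact hD.mlp_rel _ _ _ _

end Good

end ProductTable

end SymbolicLimit

end

/-! ### The model of a table and its product functions. -/

noncomputable section

namespace SymbolicLimit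

universe u

variable {S : Type u} [Finite S] {L Hd M m : ℕ} {N : ℕ∞} {D : ProductTable S L Hd M} {Δ p : ℕ}
  {c : ℝ} {H : Type} [NormedAddCommGroup H] [InnerProductSpace ℝ H]

theorem max_one_nonneg (c : ℝ) : 0 ≤ max c 1 := zero_le_one.trans (le_max_right _ _)

/-- The standard basis of a Euclidean space, with its coordinates renamed. -/
def coordBasis {I : Type*} {d : ℕ} (e : I ≃ Fin d) :
    HilbertBasis I ℝ (EuclideanSpace ℝ (Fin d)) :=
  letI := Fintype.ofEquiv _ e.symm
  ((EuclideanSpace.basisFun _ ℝ).reindex e.symm).toHilbertBasis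

theorem coordBasis_symm {I : Type*} {d : ℕ} (e : I ≃ Fin d) (j : Fin d) :
    coordBasis e (e.symm j) = stdVec j := by
  simp [coordBasis, stdVec]

theorem coordBasis_repr {I : Type*} {d : ℕ} (e : I ≃ Fin d) (x : EuclideanSpace ℝ (Fin d))
    (j : Fin d) : (coordBasis e).repr x (e.symm j) = x j := by
  rw [HilbertBasis.repr_apply_apply, coordBasis_symm, stdVec, EuclideanSpace.inner_single_left]
  simp

/-- The standard basis of a Euclidean space. -/
def euclideanBasis (m : ℕ) : HilbertBasis (Fin m) ℝ (EuclideanSpace ℝ (Fin m)) :=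
  coordBasis (Equiv.refl _)

theorem euclideanBasis_apply (s : Fin m) : euclideanBasis m s = EuclideanSpace.single s 1 :=
  coordBasis_symm (Equiv.refl _) s

theorem euclideanBasis_repr (x : EuclideanSpace ℝ (Fin m)) (s : Fin m) :
    (euclideanBasis m).repr x s = x s :=
  coordBasis_repr (Equiv.refl _) x s

namespace ProductTable.Good

/-- A transformer with a given table of product functions, on a Hilbert space with a basis indexed
by the symbolic coordinates. -/
def model (hD : D.Good Δ p c) (bas : HilbertBasis (Coord S L Hd M N) ℝ H)
    (hid : Fin L → Fin M → Fin m) (hi : ∀ l, Function.Injective (hid l)) :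
    Transformer S N H m where
  layers := L
  heads := Hd
  prec := p
  roundPrec := D.roundPrec
  emb ω := spread (fun g => bas (fun _ => none, g)) (ω.lift L M)
  pos _ := 0
  K _ _ := ContinuousLinearMap.id ℝ H
  Q l h := (hD.sparse_query l h).toCLM (max_one_nonneg c) bas bas
  V l h := (hD.sparse_value l h).toCLM (max_one_nonneg c) bas bas
  A l := (hD.sparse_in hi l).toCLM (max_one_nonneg c) bas (euclideanBasis m)
  B l := (hD.sparse_out hi l).toCLM (max_one_nonneg c) (euclideanBasis m) bas
  b l := WithLp.toLp 2 (Function.extend (hid l) (D.bias l) 0)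
  act l := Function.extend (hid l) (D.act l) fun _ => .relu
  U := hD.sparse_unembed.toCLM (max_one_nonneg c) bas
    (HilbertBasis.ofRepr (LinearIsometryEquiv.refl ℝ _))

variable (hD : D.Good Δ p c) (bas : HilbertBasis (Coord S L Hd M N) ℝ H)
  {hid : Fin L → Fin M → Fin m} (hi : ∀ l, Function.Injective (hid l))

theorem model_Q (l : Fin L) (h : Fin Hd) (q q' : Coord S L Hd M N) :
    ⟪bas q, (hD.model bas hid hi).Q l h (bas q')⟫_ℝ = D.queryMatrix N l h q q' :=
  Sparse.inner_toCLM _ _ _ _ _ _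

theorem model_U (ω : Vocab S (Slot N)) (q : Coord S L Hd M N) :
    (hD.model bas hid hi).U (bas q) ω = D.unembedMatrix N ω q :=
  hD.sparse_unembed.repr_toCLM (max_one_nonneg c) bas
    (HilbertBasis.ofRepr (LinearIsometryEquiv.refl ℝ _)) ω q

theorem model_A (l : Fin L) (s : Fin m) (q : Coord S L Hd M N) :
    (hD.model bas hid hi).A l (bas q) s = D.inMatrix N hid l s q := by
  rw [← euclideanBasis_repr]
  exact Sparse.repr_toCLM _ _ _ _ _ _

theorem model_V (l : Fin L) (h : Fin Hd) (P : Fin L → Option (Fin Hd))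
    (g : Vocab (Letters S L M) (Option (Slot N))) (hP : P l = none) :
    (hD.model bas hid hi).V l h (bas (P, g)) = bas (Function.update P l (some h), g) :=
  Sparse.toCLM_eq_of_single _ _ _ _ _ _ (if_pos ⟨hP, rfl⟩)
    fun _ hne => if_neg fun h => hne h.2

theorem model_B (l : Fin L) (t : Fin M) :
    (hD.model bas hid hi).B l (EuclideanSpace.single (hid l t) 1) =
      bas (unitCoord S Hd N l t) := by
  rw [← euclideanBasis_apply]
  refine Sparse.toCLM_eq_of_single _ _ _ _ _ _ ?_ fun _ hne => ?_
  · exact ((hi l).extend_apply _ _ _).trans (if_pos rfl)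
  · exact ((hi l).extend_apply _ _ _).trans (if_neg hne)

theorem model_B_zero (l : Fin L) (s : Fin m) (hs : s ∉ Set.range (hid l)) :
    (hD.model bas hid hi).B l (EuclideanSpace.single s 1) = 0 := by
  rw [← euclideanBasis_apply]
  exact Sparse.toCLM_eq_zero _ _ _ _ _ fun q => Function.extend_apply' _ _ _ hs

theorem model_covers : (hD.model bas hid hi).Covers hid :=
  fun l => ⟨hi l, fun s hs => model_B_zero hD bas hi l s hs⟩

theorem model_noPE : (hD.model bas hid hi).NoPE := fun _ => rfl

/-- Distinct paths and generators lead to distinct basis vectors, so the matrices that read from the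
residual stream can prescribe each product function independently of the others. -/
theorem model_path (P : Fin L → Option (Fin Hd))
    (g : Vocab (Letters S L M) (Option (Slot N))) :
    (hD.model bas hid hi).pathProd P (bas (fun _ => none, g)) = bas (P, g) := by
  -- The path is built from the lowest layers upwards; when the matrix of layer `t` is applied, the
  -- recorded path is still empty there.
  have key : ∀ t : ℕ, t ≤ L → (hD.model bas hid hi).pathProd
      (fun l : Fin L => if (l : ℕ) < t then P l else none) (bas (fun _ => none, g)) =
        bas (fun l => if (l : ℕ) < t then P l else none, g) := by
    intro t
    induction t with
    | zero =>
      intro _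
      simp only [Nat.not_lt_zero, if_false]
      exact ((hD.model bas hid hi).sys 0 hid).path_none _
    | succ t ih =>
      intro ht
      have ih := ih (by omega)
      set P' : Fin L → Option (Fin Hd) := fun l => if (l : ℕ) < t then P l else none with hP'
      have hnone : ∀ l' : Fin L, (⟨t, ht⟩ : Fin L) ≤ l' → P' l' = none := by
        intro l' hl
        have : t ≤ (l' : ℕ) := hl
        simp [hP', not_lt.2 this]
      have e : (fun l : Fin L => if (l : ℕ) < t + 1 then P l else none) =
          Function.update P' ⟨t, ht⟩ (P ⟨t, ht⟩) := by
        funext l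
        by_cases hl : l = ⟨t, ht⟩
        · subst hl; simp
        · rw [Function.update_of_ne hl]
          have : (l : ℕ) ≠ t := fun h => hl (Fin.ext h)
          simp only [hP']
          congr 1
          exact propext (by omega)
      refine (congrArg (fun P : Fin L → Option (Fin Hd) =>
        (hD.model bas hid hi).pathProd P (bas (fun _ => none, g)) = bas (P, g)) e).mpr ?_
      cases hPt : P ⟨t, ht⟩ with
      | none =>
        rw [Function.update_eq_self_iff.2 (hnone _ le_rfl).symm]
        exact ih
      | some h =>
        have := ((hD.model bas hid hi).sys 0 hid).path_update P' ⟨t, ht⟩ h hnone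
          (bas (fun _ => none, g))
        refine this.trans ?_
        refine Eq.trans (congrArg _ ih) ?_
        exact model_V hD bas hi ⟨t, ht⟩ h P' g (hnone _ le_rfl)
  have := key L le_rfl
  simpa using this

/-- The item of the enlarged alphabet that a vector of the model represents, if it is not zero. -/
def letter (S : Type u) (N : ℕ∞) (hid : Fin L → Fin M → Fin m) :
    Source S N L m → Option (Vocab (Letters S L M) (Slot N))
  | .pos _ => none
  | .tok ω => some (ω.lift L M)
  | .mlp l s => Function.extend (hid l) (fun t => some (.sym (.inr (l, t)))) (fun _ => none) s

theorem model_vec (P : Fin L → Option (Fin Hd)) (v : Source S N L m) :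
    (hD.model bas hid hi).pathProd P ((hD.model bas hid hi).vec v) =
      (letter S N hid v).elim 0 (spread fun g => bas (P, g)) := by
  rcases v with i | ω | ⟨l, s⟩
  · exact map_zero _
  · refine (map_spread ((hD.model bas hid hi).pathProd P : H →ₗ[ℝ] H)
      (fun g => bas (fun _ => none, g)) (ω.lift L M)).trans ?_
    exact congrArg (spread · (ω.lift L M)) (funext fun g => model_path hD bas hi P g)
  · change (hD.model bas hid hi).pathProd P
      ((hD.model bas hid hi).B l (EuclideanSpace.single s 1)) = _
    by_cases hs : ∃ t, hid l t = s
    · obtain ⟨t, rfl⟩ := hs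
      rw [model_B]
      simp only [letter, (hi l).extend_apply]
      exact model_path hD bas hi P _
    · rw [model_B_zero hD bas hi l s hs, map_zero]
      simp only [letter, Function.extend_apply' _ _ _ hs]
      rfl

/-- `K` is the identity, so the product is the bilinear expansion of the query matrix over the
directions of both vectors, which `spread_form` evaluates. Positions and unnamed hidden units are
zero vectors. -/
theorem model_attn (l : Fin L) (h : Fin Hd) (P P' : Fin L → Option (Fin Hd))
    (v w : Source S N L m) :
    (hD.model bas hid hi).prodAttn l h P P' v w =
      (letter S N hid v).elim 0 fun x => (letter S N hid w).elim 0 fun y =>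
        D.attn l h P P' x.full y.full := by
  unfold Transformer.prodAttn
  rw [model_vec hD bas hi P v, model_vec hD bas hi P' w]
  cases letter S N hid v with
  | none => simp
  | some x =>
    cases letter S N hid w with
    | none => simp
    | some y =>
      simp only [Option.elim]
      rw [← spread_form _ (hD.attn_rel l h P P')]
      have h1 := map_spread ((innerₗ H).flip (((hD.model bas hid hi).Q l h)
        (spread (fun g => bas (P', g)) y))) (fun g => bas (P, g)) x
      refine h1.trans (congrArg (spread · x) (funext fun x' => ?_))
      refine (map_spread ((innerₗ H (bas (P, x'))) ∘ₗ
        ((hD.model bas hid hi).Q l h : H →ₗ[ℝ] H)) (fun g => bas (P', g)) y).trans ?_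
      exact congrArg (spread · y) (funext fun y' => model_Q hD bas hi l h (P, x') (P', y'))

theorem model_unembed (P : Fin L → Option (Fin Hd)) (ω : Vocab S (Slot N)) (w : Source S N L m) :
    (hD.model bas hid hi).prodUnembed P ω w =
      (letter S N hid w).elim 0 fun y => D.unembed P ω.full y.full := by
  unfold Transformer.prodUnembed
  rw [model_vec hD bas hi P w]
  cases letter S N hid w with
  | none => simp
  | some y =>
    simp only [Option.elim]
    rw [← spread_form_row _ (hD.unembed_rel P) (hD.unembed_ext P), ← Transformer.row_apply,
      map_spread]
    congr 1
    funext y'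
    exact model_U hD bas hi ω (P, y')

theorem model_mlp (P : Fin L → Option (Fin Hd)) (l : Fin L) (s : Fin m) (w : Source S N L m) :
    (hD.model bas hid hi).prodMlp P l s w =
      (letter S N hid w).elim 0 fun y =>
        Function.extend (hid l) (fun t => D.mlp P l t y.full) 0 s := by
  unfold Transformer.prodMlp
  rw [model_vec hD bas hi P w]
  cases letter S N hid w with
  | none => simp
  | some y =>
    simp only [Option.elim]
    refine (map_spread ((EuclideanSpace.proj (𝕜 := ℝ) s).toLinearMap ∘ₗ
      ((hD.model bas hid hi).A l).toLinearMap) (fun g => bas (P, g)) y).trans ?_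
    by_cases hs : ∃ t, hid l t = s
    · obtain ⟨t, rfl⟩ := hs
      rw [(hi l).extend_apply, ← spread_mlpEntry hD]
      refine congrArg (spread · y) (funext fun y' => ?_)
      exact (model_A hD bas hi l _ (P, y')).trans ((hi l).extend_apply _ _ _)
    · rw [Function.extend_apply' _ _ _ hs]
      have h0 : ∀ y', (hD.model bas hid hi).A l (bas (P, y')) s = 0 := fun y' =>
        (model_A hD bas hi l _ (P, y')).trans (Function.extend_apply' _ _ _ hs)
      rcases y with _ | b | j
      · exact h0 _
      · exact h0 _
      · exact (congrArg₂ (· + ·) (h0 _) (h0 _)).trans (add_zero _)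

end ProductTable.Good

end SymbolicLimit

end

/-! ### The model is translation invariant and local, and has the given code. -/

noncomputable section

namespace SymbolicLimit

universe u

theorem Vocab.rel_full_eq {A B : Type*} {N : ℕ∞} {x x' : Vocab A (Slot N)} {y y' : Vocab B (Slot N)}
    (hx : x.SameKind x') (hy : y.SameKind y') (h : ¬ (x.IsExt ∧ y.IsExt)) :
    x.full.rel y.full = x'.full.rel y'.full := by
  rcases x with _ | a | i <;> rcases x' with _ | a' | i' <;> cases hx <;>
    rcases y with _ | b | j <;> rcases y' with _ | b' | j' <;> cases hy <;>
    first | rfl | exact absurd ⟨trivial, trivial⟩ h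

theorem Vocab.rel_mapExt_add {A B : Type*} (x : Vocab A ℕ) (y : Vocab B ℕ) (oc : ℕ) :
    (x.mapExt (· + oc)).rel (y.mapExt (· + oc)) = x.rel y := by
  rcases x with _ | a | i <;> rcases y with _ | b | j <;> try rfl
  simp only [Vocab.mapExt, Vocab.rel, Nat.add_sub_add_right]

variable {S : Type u} [Finite S] {L Hd M m : ℕ} {N : ℕ∞} {D : ProductTable S L Hd M} {Δ p : ℕ}
  {c : ℝ} {H : Type} [NormedAddCommGroup H] [InnerProductSpace ℝ H]

namespace ProductTable.Good

omit [Finite S] in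
-- Transfers the case distinctions of translation invariance from sources to letters; the letter of
-- a hidden unit is never an extended symbol.
theorem letter_sameKind {hid : Fin L → Fin M → Fin m} {v v' : Source S N L m}
    (h : v.SameKind v') :
    (letter S N hid v = none ∧ letter S N hid v' = none) ∨
      ∃ x x', letter S N hid v = some x ∧ letter S N hid v' = some x' ∧ x.SameKind x' ∧
        (x.IsExt → v.IsExt) := by
  rcases v with i | ω | ⟨l, s⟩
  · rcases v' with i' | ω' | ⟨l', s'⟩
    · exact Or.inl ⟨rfl, rfl⟩
    · cases h
    · cases h
  · rcases v' with i' | ω' | ⟨l', s'⟩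
    · cases h
    · refine Or.inr ⟨_, _, rfl, rfl, ?_, ?_⟩
      · rcases ω with _ | a | i <;> rcases ω' with _ | a' | i' <;> first
          | exact trivial
          | (cases h; done)
          | (cases h; exact rfl)
      · rcases ω with _ | a | i <;> exact id
    · cases h
  · have : v' = .mlp l s := by
      rcases v' with i' | ω' | ⟨l', s'⟩
      · cases h
      · cases h
      · exact (show Source.mlp l s = Source.mlp l' s' from h).symm
    subst this
    by_cases hs : ∃ x, letter S N hid (.mlp l s) = some x
    · obtain ⟨x, hx⟩ := hs
      refine Or.inr ⟨x, x, hx, hx, ?_, ?_⟩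
      · rcases x with _ | a | i <;> first | rfl | trivial
      · intro hxe
        by_cases ht : ∃ t, hid l t = s
        · rw [letter, Function.extend_def, dif_pos ht] at hx
          cases hx
          exact hxe.elim
        · rw [letter, Function.extend_apply' _ _ _ ht] at hx
          cases hx
    · left
      rw [Option.eq_none_iff_forall_ne_some]
      exact ⟨fun x hx => hs ⟨x, hx⟩, fun x hx => hs ⟨x, hx⟩⟩

variable (hD : D.Good Δ p c) (bas : HilbertBasis (Coord S L Hd M N) ℝ H)
  {hid : Fin L → Fin M → Fin m} (hi : ∀ l, Function.Injective (hid l))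

theorem model_translationInvariant : (hD.model bas hid hi).TranslationInvariant where
  attn_pos l h P P' i j i' j' _ := by
    exact (model_attn hD bas hi l h P P' _ _).trans (model_attn hD bas hi l h P P' _ _).symm
  attn_ext l h P P' i j i' j' hij := by
    refine (model_attn hD bas hi l h P P' _ _).trans (Eq.trans ?_ (model_attn hD bas hi l h P P' _ _).symm)
    refine hD.attn_congr ?_ ?_ <;> refine congrArg Vocab.ext ?_ <;> simp only [] <;> omega
  unembed_ext P i j i' j' hij := by
    refine (model_unembed hD bas hi P _ _).trans (Eq.trans ?_ (model_unembed hD bas hi P _ _).symm)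
    refine hD.unembed_congr ?_ ?_ <;> refine congrArg Vocab.ext ?_ <;> simp only [] <;> omega
  attn_const l h P P' v w v' w' hv hw _ hn := by
    refine (model_attn hD bas hi l h P P' _ _).trans (Eq.trans ?_ (model_attn hD bas hi l h P P' _ _).symm)
    rcases letter_sameKind (hid := hid) hv with ⟨h1, h2⟩ | ⟨x, x', h1, h2, hx, hxe⟩
    · rw [h1, h2]; rfl
    rcases letter_sameKind (hid := hid) hw with ⟨h3, h4⟩ | ⟨y, y', h3, h4, hy, hye⟩
    · rw [h1, h2, h3, h4]; rfl
    rw [h1, h2, h3, h4]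
    have hn' : ¬ (x.IsExt ∧ y.IsExt) := fun h => hn ⟨hxe h.1, hye h.2⟩
    exact hD.attn_congr (Vocab.rel_full_eq hx hy hn')
      (Vocab.rel_full_eq hy hx fun h => hn' h.symm)
  unembed_const P ω w ω' w' hω hw hn := by
    refine (model_unembed hD bas hi P _ _).trans (Eq.trans ?_ (model_unembed hD bas hi P _ _).symm)
    rcases letter_sameKind (hid := hid) hw with ⟨h3, h4⟩ | ⟨y, y', h3, h4, hy, hye⟩
    · rw [h3, h4]; rfl
    rw [h3, h4]
    have hn' : ¬ (ω.IsExt ∧ y.IsExt) := fun h => hn ⟨h.1, hye h.2⟩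
    exact hD.unembed_congr (Vocab.rel_full_eq hω hy hn')
      (Vocab.rel_full_eq hy hω fun h => hn' h.symm)
  mlp_const P l s w w' hw := by
    refine (model_mlp hD bas hi P l s _).trans (Eq.trans ?_ (model_mlp hD bas hi P l s _).symm)
    rcases letter_sameKind (hid := hid) hw with ⟨h3, h4⟩ | ⟨y, y', h3, h4, hy, hye⟩
    · rw [h3, h4]
    rw [h3, h4]
    have : (fun t => D.mlp P l t y.full) = fun t => D.mlp P l t y'.full := by
      funext t
      exact hD.mlp_congr (Vocab.rel_full_eq (x := y) (x' := y') (y := (.start : Vocab S (Slot N)))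
        (y' := .start) hy rfl fun h => h.2)
    simp only [Option.elim, this]

theorem model_local : (hD.model bas hid hi).Local Δ where
  attn_pos l h P P' i j _ := (model_attn hD bas hi l h P P' _ _)
  attn_ext l h P P' i j hij := by
    exact (model_attn hD bas hi l h P P' _ _).trans (hD.attn_local _ _ _ _ _ _ hij)
  unembed_ext P i j hij := by
    exact (model_unembed hD bas hi P _ _).trans (hD.unembed_local _ _ _ hij)

/-- An offset shifts all extended indices alike, and a good table depends on them only through
`Vocab.rel`, which is invariant under a common shift. -/
theorem model_realizes (oc : ℕ) : ((hD.model bas hid hi).sys oc hid).Realizes (window N oc) D := by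
  have hsource : ∀ (x : Vocab (Letters S L M) ℕ) (hx : x.In (window N oc)),
      ∃ x', letter S N hid ((hD.model bas hid hi).source hid oc x hx) = some x' ∧
        x'.full = x.mapExt (· + oc) := by
    intro x hx
    rcases x with _ | (a | ⟨l, s⟩) | k
    · exact ⟨_, rfl, rfl⟩
    · exact ⟨_, rfl, rfl⟩
    · exact ⟨.sym (.inr (l, s)), (hi l).extend_apply
        (fun t => some (.sym (.inr (l, t)) : Vocab (Letters S L M) (Slot N))) (fun _ => none) s, rfl⟩
    · exact ⟨_, rfl, rfl⟩
  have hitem : ∀ (ω : Vocab S ℕ) (hω : ω.In (window N oc)),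
      (Transformer.item N oc ω hω).full = ω.mapExt (· + oc) := by
    intro x hx
    rcases x with _ | a | k <;> rfl
  refine ⟨rfl, ?_, ?_, fun l h P P' x y hx hy => ?_, fun P ω y hω hy => ?_,
    fun P l s y hy => ?_⟩
  · exact funext₂ fun l s => (hi l).extend_apply (D.act l) (fun _ => .relu) s
  · exact funext₂ fun l s => (hi l).extend_apply (D.bias l) 0 s
  · obtain ⟨x', hx1, hx2⟩ := hsource x hx
    obtain ⟨y', hy1, hy2⟩ := hsource y hy
    rw [← Transformer.vec_source _ hid oc x hx, ← Transformer.vec_source _ hid oc y hy]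
    refine (model_attn hD bas hi l h P P' _ _).trans ?_
    rw [hx1, hy1]
    simp only [Option.elim, hx2, hy2]
    exact hD.attn_congr (Vocab.rel_mapExt_add _ _ _) (Vocab.rel_mapExt_add _ _ _)
  · obtain ⟨y', hy1, hy2⟩ := hsource y hy
    rw [← Transformer.vec_source _ hid oc y hy]
    refine (Transformer.sys_U (hD.model bas hid hi) hid oc ω hω _).trans ?_
    refine (model_unembed hD bas hi P _ _).trans ?_
    rw [hy1]
    simp only [Option.elim, hitem, hy2]
    exact hD.unembed_congr (Vocab.rel_mapExt_add _ _ _) (Vocab.rel_mapExt_add _ _ _)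
  · obtain ⟨y', hy1, hy2⟩ := hsource y hy
    rw [← Transformer.vec_source _ hid oc y hy]
    refine (model_mlp hD bas hi P l _ _).trans ?_
    rw [hy1]
    simp only [Option.elim, (hi l).extend_apply, hy2]
    refine hD.mlp_congr ?_
    exact Vocab.rel_mapExt_add y (Vocab.start : Vocab S ℕ) oc

theorem model_hasCode : (hD.model bas hid hi).HasCode ⟨L, Hd, M, D⟩ :=
  ⟨model_noPE hD bas hi, M, hid, D, rfl, model_covers hD bas hi, model_realizes hD bas hi⟩

end ProductTable.Good

end SymbolicLimit

end

/-! ### Regularizer bounds that are uniform in the window, and existence of realizations. -/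

noncomputable section

namespace SymbolicLimit

universe u

theorem IsBit.zero (p : ℕ) : IsBit p 0 := ⟨0, by simp⟩

theorem IsBit.one (p : ℕ) : IsBit p 1 := ⟨2 ^ p, by push_cast; field_simp⟩

theorem IsBit.add {p : ℕ} {x y : ℝ} (hx : IsBit p x) (hy : IsBit p y) : IsBit p (x + y) := by
  obtain ⟨a, rfl⟩ := hx
  obtain ⟨b, rfl⟩ := hy
  exact ⟨a + b, by push_cast; ring⟩

theorem IsBit.mul {p q : ℕ} {x y : ℝ} (hx : IsBit p x) (hy : IsBit q y) : IsBit (p + q) (x * y) := by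
  obtain ⟨a, rfl⟩ := hx
  obtain ⟨b, rfl⟩ := hy
  exact ⟨a * b, by push_cast; rw [pow_add, div_mul_div_comm]⟩

theorem IsBit.sum {α : Type*} {p : ℕ} (F : Finset α) {f : α → ℝ} (h : ∀ a ∈ F, IsBit p (f a)) :
    IsBit p (∑ a ∈ F, f a) :=
  Finset.sum_induction f (IsBit p) (fun _ _ => IsBit.add) (IsBit.zero p) h

theorem IsBit.mono {p q : ℕ} (hpq : p ≤ q) {x : ℝ} (hx : IsBit p x) : IsBit q x := by
  obtain ⟨a, rfl⟩ := hx
  refine ⟨a * 2 ^ (q - p), ?_⟩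
  push_cast
  rw [div_eq_div_iff (by positivity) (by positivity), mul_assoc, ← pow_add]
  congr 2
  omega

theorem Sparse.transpose {I J : Type*} {A : I → J → ℝ} {k : ℕ} {c : ℝ} (h : Sparse A k c) :
    Sparse (fun j i => A i j) k c :=
  ⟨fun j i => h.abs_le i j, h.col, h.row⟩

/-- Sparsity alone does not bound a Frobenius norm. Here in addition at most `k` rows are nonzero,
as in the MLP matrices, which involve only the `M` named hidden units. -/
theorem Sparse.sum_sq_le {I J : Type*} [Fintype I] [Fintype J] {A : I → J → ℝ} {k : ℕ} {c : ℝ}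
    (h : Sparse A k c) (s : Finset I) (hs : s.card ≤ k) (h0 : ∀ i j, A i j ≠ 0 → i ∈ s) :
    ∑ i, ∑ j, A i j ^ 2 ≤ (k * c) ^ 2 := by
  have h1 : ∀ i, ∑ j, A i j ^ 2 ≤ k * c ^ 2 := by
    intro i
    obtain ⟨t, ht, ht'⟩ := h.row i
    rw [← Finset.sum_subset (Finset.subset_univ t) fun j _ hj => by
      rw [pow_eq_zero_iff two_ne_zero]
      by_contra hne
      exact hj (ht' j hne)]
    calc ∑ j ∈ t, A i j ^ 2 ≤ t.card • c ^ 2 := Finset.sum_le_card_nsmul _ _ _ fun j _ => by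
          rw [← sq_abs]
          exact pow_le_pow_left₀ (abs_nonneg _) (h.abs_le i j) 2
      _ ≤ k * c ^ 2 := by
          rw [nsmul_eq_mul]
          exact mul_le_mul_of_nonneg_right (by exact_mod_cast ht) (sq_nonneg c)
  rw [← Finset.sum_subset (Finset.subset_univ s) fun i _ hi => by
    refine Finset.sum_eq_zero fun j _ => ?_
    rw [pow_eq_zero_iff two_ne_zero]
    by_contra hne
    exact hi (h0 i j hne)]
  calc ∑ i ∈ s, ∑ j, A i j ^ 2 ≤ s.card • (k * c ^ 2) :=
        Finset.sum_le_card_nsmul _ _ _ fun i _ => h1 i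
    _ ≤ k * (k * c ^ 2) := by
        rw [nsmul_eq_mul]
        exact mul_le_mul_of_nonneg_right (by exact_mod_cast hs) (by positivity)
    _ = _ := by ring

/-- If one index is `0` and the distance is at most `Δ`, both indices are at most `Δ`. So at most
`(Δ + 1) ^ 2` terms survive, whatever `n` is. -/
theorem sum_local_sq_le {n : ℕ} (f : Slot (n : ℕ∞) → Slot (n : ℕ∞) → ℝ) {Δ : ℕ} {c : ℝ}
    (h0 : ∀ i j : Slot (n : ℕ∞), Δ < Nat.dist i j → f i j = 0) (hc : ∀ i j, |f i j| ≤ c) :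
    (∑ i : Slot (n : ℕ∞), ∑ j : Slot (n : ℕ∞),
      if (i : ℕ) = 0 ∨ (j : ℕ) = 0 then |f i j| ^ 2 else 0) ≤ ((Δ + 1 : ℕ) * c) ^ 2 := by
  let χ : Slot (n : ℕ∞) → ℝ := fun i => if (i : ℕ) ≤ Δ then 1 else 0
  have hχ : ∑ i, χ i ≤ (Δ + 1 : ℕ) := by
    rw [Finset.sum_boole]
    have : (Finset.univ.filter fun i : Slot (n : ℕ∞) => (i : ℕ) ≤ Δ).card ≤
        (Finset.range (Δ + 1)).card :=
      Finset.card_le_card_of_injOn (fun i => (i : ℕ)) (fun i hi => by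
        simp only [Finset.coe_filter, Set.mem_ofPred_eq] at hi
        simp only [Finset.coe_range, Set.mem_Iio]
        omega) (fun i _ j _ hij => Subtype.ext hij)
    rw [Finset.card_range] at this
    exact_mod_cast this
  have hχ0 : 0 ≤ ∑ i, χ i := Finset.sum_nonneg fun i _ => by
    simp only [χ]; split <;> norm_num
  calc _ ≤ ∑ i, ∑ j, χ i * χ j * c ^ 2 := by
        refine Finset.sum_le_sum fun i _ => Finset.sum_le_sum fun j _ => ?_
        have hsq : |f i j| ^ 2 ≤ c ^ 2 := pow_le_pow_left₀ (abs_nonneg _) (hc i j) 2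
        by_cases hij : (i : ℕ) ≤ Δ ∧ (j : ℕ) ≤ Δ
        · simp only [χ, if_pos hij.1, if_pos hij.2, one_mul]
          split
          · exact hsq
          · exact sq_nonneg c
        · have hn : 0 ≤ χ i * χ j * c ^ 2 := by
            simp only [χ]
            split <;> split <;> simp [sq_nonneg]
          refine le_trans ?_ hn
          split
          · rename_i h
            rw [h0 i j (by unfold Nat.dist; omega)]
            simp
          · exact le_rfl
    _ = (∑ i, χ i) ^ 2 * c ^ 2 := by
        rw [sq (∑ i, χ i), Finset.sum_mul_sum, Finset.sum_mul]
        simp only [Finset.sum_mul]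
    _ ≤ ((Δ + 1 : ℕ) : ℝ) ^ 2 * c ^ 2 :=
        mul_le_mul_of_nonneg_right (pow_le_pow_left₀ hχ0 hχ 2) (sq_nonneg c)
    _ = _ := by rw [mul_pow]

variable {S : Type u} [Finite S] {L Hd M : ℕ} {D : ProductTable S L Hd M} {Δ p : ℕ} {c : ℝ}

namespace ProductTable.Good

omit [Finite S] in
theorem norm_spread_le {N : ℕ∞} {H : Type} [NormedAddCommGroup H] [InnerProductSpace ℝ H]
    (bas : HilbertBasis (Coord S L Hd M N) ℝ H) (P : Fin L → Option (Fin Hd))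
    (x : Vocab (Letters S L M) (Slot N)) : ‖spread (fun g => bas (P, g)) x‖ ≤ 2 := by
  have h1 : ∀ q, ‖bas q‖ = 1 := bas.orthonormal.1
  rcases x with _ | a | k
  · exact (h1 _).trans_le one_le_two
  · exact (h1 _).trans_le one_le_two
  · exact (norm_add_le _ _).trans_eq (by rw [h1, h1]; norm_num)

end ProductTable.Good

theorem Sparse.toCLM_stdVec {I J : Type*} {A : I → J → ℝ} {k : ℕ} {c : ℝ} (h : Sparse A k c)
    (hc : 0 ≤ c) {d d' : ℕ} (e : J ≃ Fin d) (e' : I ≃ Fin d') (i : Fin d') (j : Fin d) :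
    h.toCLM hc (coordBasis e) (coordBasis e') (stdVec j) i = A (e'.symm i) (e.symm j) := by
  rw [← coordBasis_repr e', ← coordBasis_symm e, Sparse.repr_toCLM]

theorem Sparse.frobenius_toCLM {I J : Type*} [Fintype I] [Fintype J] {A : I → J → ℝ} {k : ℕ}
    {c : ℝ} (h : Sparse A k c) (hc : 0 ≤ c) {d d' : ℕ} (e : J ≃ Fin d) (e' : I ≃ Fin d') :
    frobenius (h.toCLM hc (coordBasis e) (coordBasis e')) = Real.sqrt (∑ i, ∑ j, A i j ^ 2) := by
  unfold frobenius
  congr 1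
  refine (e'.sum_comp _).symm.trans (Finset.sum_congr rfl fun i _ => ?_)
  refine (e.sum_comp _).symm.trans (Finset.sum_congr rfl fun j _ => ?_)
  rw [Sparse.toCLM_stdVec, Equiv.symm_apply_apply, Equiv.symm_apply_apply]

namespace ProductTable.Good

section Finite

variable {n d : ℕ} (hD : D.Good Δ p c) (e : Coord S L Hd M (n : ℕ∞) ≃ Fin d)
  {hid : Fin L → Fin M → Fin d} (hi : ∀ l, Function.Injective (hid l))

theorem isBit_coordBasis {I : Type*} {d : ℕ} (e : I ≃ Fin d) (p : ℕ) (q : I) (j : Fin d) :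
    IsBit p (coordBasis e q j) := by
  obtain ⟨i, rfl⟩ := e.symm.surjective q
  rw [coordBasis_symm, stdVec, PiLp.single_apply]
  split
  · exact .one p
  · exact .zero p

theorem model_inTheta : InTheta ⟨d, hD.model (coordBasis e) hid hi⟩ where
  bit_emb ω j := by
    rcases ω with _ | a | k
    · exact isBit_coordBasis e p _ j
    · exact isBit_coordBasis e p _ j
    · exact (isBit_coordBasis e p _ j).add (isBit_coordBasis e p _ j)
  bit_pos i j := IsBit.zero p
  bit_K l h i j := by
    have := isBit_coordBasis e p (e.symm j) i
    rwa [coordBasis_symm] at this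
  bit_Q l h i j := (Set.mem_of_eq_of_mem ((hD.sparse_query l h).toCLM_stdVec _ e e i j)
    (hD.queryMatrix_mem l h _ _)).1
  bit_V l h i j := (Set.mem_of_eq_of_mem ((hD.sparse_value l h).toCLM_stdVec _ e e i j)
    (hD.valueMatrix_mem l h _ _)).1
  bit_A l i j := (Set.mem_of_eq_of_mem
    ((hD.sparse_in hi l).toCLM_stdVec _ e (Equiv.refl _) i j) (hD.inMatrix_mem hi l _ _)).1
  bit_B l i j := (Set.mem_of_eq_of_mem
    ((hD.sparse_out hi l).toCLM_stdVec _ (Equiv.refl _) e i j) (hD.outMatrix_mem hi l _ _)).1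
  bit_b l j := (extend_mem (hi l) hD.zero_mem (fun t => grid_max (hD.bias_mem l t)) j).1
  bit_U ω j := by
    have := (Set.mem_of_eq_of_mem (model_U hD (coordBasis e) hi ω (e.symm j))
      (hD.unembedMatrix_mem ω _)).1
    rwa [coordBasis_symm] at this
  translationInvariant := model_translationInvariant hD _ hi

theorem frobenius_model_A (l : Fin L) :
    frobenius ((hD.model (coordBasis e) hid hi).A l) ≤ D.width Δ * max c 1 := by
  let := Fintype.ofFinite (Coord S L Hd M (n : ℕ∞))
  refine ((hD.sparse_in hi l).frobenius_toCLM _ e (Equiv.refl _)).trans_le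
    (Real.sqrt_le_iff.2 ⟨mul_nonneg (Nat.cast_nonneg _) (max_one_nonneg c), ?_⟩)
  exact (hD.sparse_in hi l).sum_sq_le (Finset.univ.image (hid l))
    ((Finset.card_image_le.trans_eq (by simp)).trans units_le_width)
    fun i j h => mem_image_of_extend_ne_zero h

theorem frobenius_model_B (l : Fin L) :
    frobenius ((hD.model (coordBasis e) hid hi).B l) ≤ D.width Δ * max c 1 := by
  let := Fintype.ofFinite (Coord S L Hd M (n : ℕ∞))
  refine ((hD.sparse_out hi l).frobenius_toCLM _ (Equiv.refl _) e).trans_le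
    (Real.sqrt_le_iff.2 ⟨mul_nonneg (Nat.cast_nonneg _) (max_one_nonneg c), ?_⟩)
  rw [Finset.sum_comm]
  exact (hD.sparse_out hi l).transpose.sum_sq_le (Finset.univ.image (hid l))
    ((Finset.card_image_le.trans_eq (by simp)).trans units_le_width)
    fun i j h => mem_image_of_extend_ne_zero h

theorem norm_model_b (l : Fin L) :
    ‖(hD.model (coordBasis e) hid hi).b l‖ ≤ M * max c 1 := by
  have h : (WithLp.toLp 2 (Function.extend (hid l) (D.bias l) 0) : EuclideanSpace ℝ (Fin d)) =
      ∑ t, D.bias l t • stdVec (hid l t) := by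
    ext s
    rw [WithLp.ofLp_sum, Finset.sum_apply]
    simp only [PiLp.smul_apply, stdVec, PiLp.single_apply, smul_eq_mul, mul_ite, mul_one, mul_zero]
    by_cases hs : ∃ t, hid l t = s
    · obtain ⟨t, rfl⟩ := hs
      rw [(hi l).extend_apply, Finset.sum_eq_single t]
      · simp
      · intro t' _ hne
        exact if_neg fun h => hne (hi l h).symm
      · simp
    · rw [Function.extend_apply' _ _ _ hs]
      exact (Finset.sum_eq_zero fun t _ => if_neg fun h => hs ⟨t, Eq.symm h⟩).symm
  refine (congrArg norm h).trans_le ?_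
  have h2 : ∀ t ∈ (Finset.univ : Finset (Fin M)), ‖D.bias l t • stdVec (hid l t)‖ ≤ max c 1 := ?_
  · exact (norm_sum_le_of_le _ h2).trans_eq
      (by rw [Finset.sum_const, Finset.card_univ, Fintype.card_fin, nsmul_eq_mul])
  intro t _
  rw [norm_smul, stdVec, PiLp.norm_single, norm_one, mul_one, Real.norm_eq_abs]
  exact (hD.bias_mem l t).2.trans (le_max_left _ _)

theorem norm_model_KQ {H : Type} [NormedAddCommGroup H] [InnerProductSpace ℝ H] [CompleteSpace H]
    {N : ℕ∞} {m : ℕ} (bas : HilbertBasis (Coord S L Hd M N) ℝ H) {hid : Fin L → Fin M → Fin m}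
    (hi : ∀ l, Function.Injective (hid l)) (l : Fin L) (h : Fin Hd) :
    ‖(ContinuousLinearMap.adjoint ((hD.model bas hid hi).K l h)).comp
      ((hD.model bas hid hi).Q l h)‖ ≤ D.width Δ * max c 1 := by
  refine (ContinuousLinearMap.opNorm_comp_le _ _).trans ?_
  rw [LinearIsometryEquiv.norm_map]
  refine (mul_le_of_le_one_left (norm_nonneg _) ContinuousLinearMap.norm_id_le).trans ?_
  exact Sparse.norm_toCLM_le _ _ _ _

theorem zeta_model_le :
    zeta ⟨d, hD.model (coordBasis e) hid hi⟩ ≤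
      (∑ _l : Fin L, ∑ _h : Fin Hd, ∑ _P₁ : Fin L → Option (Fin Hd),
        ∑ _P₂ : Fin L → Option (Fin Hd), ((Δ + 1 : ℕ) * c) ^ 2) +
      ∑ _P : Fin L → Option (Fin Hd), ((Δ + 1 : ℕ) * c) ^ 2 := by
  have hattn := model_attn hD (coordBasis e) hi
  have hun := model_unembed hD (coordBasis e) hi
  unfold zeta
  refine add_le_add (Finset.sum_le_sum fun l _ => Finset.sum_le_sum fun h _ =>
    Finset.sum_le_sum fun P _ => Finset.sum_le_sum fun P' _ => ?_)
    (Finset.sum_le_sum fun P _ => ?_)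
  · refine (add_le_add (le_of_eq ?_) ?_).trans_eq (zero_add _)
    · refine Finset.sum_eq_zero fun i _ => Finset.sum_eq_zero fun j _ => ?_
      have : (hD.model (coordBasis e) hid hi).prodAttn l h P P' (.pos i) (.pos j) = 0 :=
        hattn l h P P' _ _
      rw [this]
      simp
    · refine sum_local_sq_le (fun i j => (hD.model (coordBasis e) hid hi).prodAttn l h P P'
        (.tok (.ext i)) (.tok (.ext j))) (fun i j hij => ?_) fun i j => ?_
      · exact (hattn l h P P' _ _).trans (hD.attn_local _ _ _ _ _ _ hij)
      · exact (congrArg abs (hattn l h P P' _ _)).trans_le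
          (hD.attn_mem l h P P' (.ext i) (.ext j)).2
  · refine sum_local_sq_le (fun i j => (hD.model (coordBasis e) hid hi).prodUnembed P
        (.ext i) (.tok (.ext j))) (fun i j hij => ?_) fun i j => ?_
    · exact (hun P _ _).trans (hD.unembed_local _ _ _ hij)
    · exact (congrArg abs (hun P _ _)).trans_le (hD.unembed_mem P (.ext i) (.ext j)).2

/-- A bound on the regularizer of the realizations of a table with finite context windows. -/
def regularizerBound (D : ProductTable S L Hd M) (Δ p : ℕ) (c : ℝ) : ℝ :=
  ((L : ℝ) + Hd) + ((p : ℝ) + D.roundPrec) +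
    ((D.width Δ * max c 1 + D.width Δ * max c 1 + D.width Δ * max c 1 + D.width Δ * max c 1 +
      D.width Δ * max c 1)) + (0 + 2 + M * max c 1) +
  ((∑ _l : Fin L, ∑ _h : Fin Hd, ∑ _P₁ : Fin L → Option (Fin Hd),
    ∑ _P₂ : Fin L → Option (Fin Hd), ((Δ + 1 : ℕ) * c) ^ 2) +
      ∑ _P : Fin L → Option (Fin Hd), ((Δ + 1 : ℕ) * c) ^ 2)

/-- The point is that neither the window `n` nor the dimension `d` occurs in the bound. -/
theorem regularizer_model_le :
    regularizer ⟨d, hD.model (coordBasis e) hid hi⟩ ≤ regularizerBound D Δ p c := by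
  have hW : (0 : ℝ) ≤ D.width Δ * max c 1 :=
    mul_nonneg (Nat.cast_nonneg _) (max_one_nonneg c)
  refine add_le_add (add_le_add (add_le_add le_rfl (add_le_add (add_le_add (add_le_add (add_le_add
      (Real.iSup_le (fun q => ?_) hW) (Real.iSup_le (fun q => ?_) hW))
      (Real.iSup_le (fun l => ?_) hW)) (Real.iSup_le (fun l => ?_) hW)) ?_))
    (add_le_add (add_le_add (Real.iSup_le (fun i => ?_) le_rfl)
      (Real.iSup_le (fun ω => ?_) zero_le_two))
      (Real.iSup_le (fun l => ?_) (mul_nonneg (Nat.cast_nonneg _) (max_one_nonneg c)))))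
    (zeta_model_le hD e hi)
  · exact norm_model_KQ hD (coordBasis e) hi q.1 q.2
  · exact (hD.sparse_value q.1 q.2).norm_toCLM_le _ _ _
  · exact frobenius_model_A hD e hi l
  · exact frobenius_model_B hD e hi l
  · exact hD.sparse_unembed.norm_toCLM_le _ _ _
  · exact norm_zero.le
  · exact norm_spread_le (coordBasis e) _ _
  · exact norm_model_b hD e hi l

/-- The MLPs must have exactly as many hidden units as the width. The `M` used ones are embedded
among them through the coordinates `unitCoord`, which are distinct, and the others stay idle. -/
theorem exists_finTransformer (hD : D.Good Δ p c) (n : ℕ) :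
    ∃ T : FinTransformer S n, InTheta T ∧ T.model.HasCode ⟨L, Hd, M, D⟩ ∧
      regularizer T ≤ regularizerBound D Δ p c := by
  let e : Coord S L Hd M (n : ℕ∞) ≃ Fin (Nat.card (Coord S L Hd M (n : ℕ∞))) := Finite.equivFin _
  have hi : ∀ l : Fin L, Function.Injective fun t : Fin M => e (unitCoord S Hd n l t) := by
    intro l t t' h
    have := e.injective h
    simpa [unitCoord] using this
  exact ⟨⟨_, hD.model (coordBasis e) (fun l t => e (unitCoord S Hd n l t)) hi⟩,
    model_inTheta hD e hi, model_hasCode hD _ hi, regularizer_model_le hD e hi⟩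

end Finite

section Limit

/-- The coordinates live in the universe of `S`, while the Hilbert space has to live in `Type`.
Indexing by `ℕ` allows `ℓ²(ℕ)` to be used. -/
theorem nonempty_coordEquiv : Nonempty (Coord S L Hd M ⊤ ≃ ℕ) := by
  have h1 : Countable (Vocab (Letters S L M) (Option (Slot ⊤))) := by
    let g : Vocab (Letters S L M) (Option (Slot ⊤)) →
        Option (Letters S L M ⊕ Option (Slot ⊤)) := fun ω => match ω with
      | .start => none
      | .sym a => some (.inl a)
      | .ext k => some (.inr k)
    refine Function.Injective.countable (f := g) ?_
    rintro (_ | a | k) (_ | b | k') h <;> simp_all [g]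
  have h2 : Infinite (Vocab (Letters S L M) (Option (Slot ⊤))) :=
    Infinite.of_injective
      (fun k : ℕ => .ext (some ⟨k, ENat.natCast_lt_top k⟩)) fun k k' h => by simpa using h
  have h3 : Infinite (Coord S L Hd M ⊤) := Prod.infinite_of_right
  exact nonempty_equiv_of_countable

theorem model_isSymbolicLimit {H : Type} [NormedAddCommGroup H] [InnerProductSpace ℝ H] {m : ℕ}
    (hD : D.Good Δ p c) (bas : HilbertBasis (Coord S L Hd M ⊤) ℝ H) {hid : Fin L → Fin M → Fin m}
    (hi : ∀ l, Function.Injective (hid l)) : IsSymbolicLimit (hD.model bas hid hi) where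
  bounded_pos := ⟨0, fun _ => norm_zero.le⟩
  bounded_ext := ⟨2, fun k => norm_spread_le bas (fun _ => none) (.ext k)⟩
  bit_attn l h P P' v w := by
    refine (congrArg (IsBit p) (model_attn hD bas hi l h P P' v w)).mpr ?_
    cases letter S ⊤ hid v with
    | none => exact .zero _
    | some x =>
      cases letter S ⊤ hid w with
      | none => exact .zero _
      | some y => exact (hD.attn_mem _ _ _ _ _ _).1
  bit_unembed P ω w := by
    refine (congrArg (IsBit p) (model_unembed hD bas hi P ω w)).mpr ?_
    cases letter S ⊤ hid w with
    | none => exact .zero _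
    | some y => exact (hD.unembed_mem _ _ _).1
  bit_mlp P l s w := by
    refine (congrArg (IsBit p) (model_mlp hD bas hi P l s w)).mpr ?_
    cases letter S ⊤ hid w with
    | none => exact .zero _
    | some y =>
      exact (extend_mem (hi l) hD.zero_mem (fun t => grid_max (hD.mlp_mem P l t y.full)) s).1
  bit_bias l s := (extend_mem (hi l) hD.zero_mem (fun t => grid_max (hD.bias_mem l t)) s).1
  translationInvariant := model_translationInvariant hD bas hi
  isLocal := ⟨Δ, model_local hD bas hi⟩

theorem exists_limitTransformer (hD : D.Good Δ p c) :
    ∃ (H : Type) (_ : NormedAddCommGroup H) (_ : InnerProductSpace ℝ H) (_ : CompleteSpace H)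
      (m : ℕ) (T : Transformer S ⊤ H m), IsSymbolicLimit T ∧ T.HasCode ⟨L, Hd, M, D⟩ := by
  obtain ⟨e⟩ := nonempty_coordEquiv (S := S) (L := L) (Hd := Hd) (M := M)
  let b₀ : HilbertBasis ℕ ℝ (L2 ℕ) := HilbertBasis.ofRepr (LinearIsometryEquiv.refl ℝ _)
  let bas : HilbertBasis (Coord S L Hd M ⊤) ℝ (L2 ℕ) :=
    HilbertBasis.mk (b₀.orthonormal.comp e e.injective) (by
      rw [e.surjective.range_comp, b₀.dense_span])
  have hi : ∀ l : Fin L, Function.Injective ((fun _ t => t : Fin L → Fin M → Fin M) l) :=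
    fun _ => Function.injective_id
  exact ⟨L2 ℕ, inferInstance, inferInstance, inferInstance, M, hD.model bas _ hi,
    model_isSymbolicLimit hD bas hi, model_hasCode hD bas hi⟩

end Limit

end ProductTable.Good

end SymbolicLimit

end

/-! ### Tables of bounded transformers are good. -/

noncomputable section

namespace SymbolicLimit

universe u

/-- One of `i - j` and `j - i` is `0`, so relative indices are already in normal form. -/
theorem Vocab.rel_rel {A B : Type*} (x : Vocab A ℕ) (y : Vocab B ℕ) :
    (x.rel y).rel (y.rel x) = x.rel y := by
  rcases x with _ | a | i <;> rcases y with _ | b | j <;> try rfl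
  simp only [Vocab.rel]
  congr 1
  omega

theorem IsBit.eq_zero {p : ℕ} {x : ℝ} (h : IsBit p x) (hx : |x| < 1 / 2 ^ p) : x = 0 := by
  obtain ⟨z, rfl⟩ := h
  rw [abs_div, abs_of_pos (by positivity : (0 : ℝ) < 2 ^ p),
    div_lt_div_iff_of_pos_right (by positivity)] at hx
  have : |z| < 1 := by exact_mod_cast hx
  rw [Int.abs_lt_one_iff.1 this]
  simp

namespace Transformer

variable {S : Type u} {N : ℕ∞} {H : Type} [NormedAddCommGroup H] [InnerProductSpace ℝ H] {m M : ℕ}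

/-- Tables are indexed by all natural numbers. Outside the window the default vector is zero, so the
entries there vanish and the conditions on a good table need checking only inside. -/
theorem gen_eq_vec_or_zero (T : Transformer S N H m) (hid : Fin T.layers → Fin M → Fin m)
    (x : Vocab (Letters S T.layers M) ℕ) :
    (∃ hx : x.In (window N 0), (T.sys 0 hid).gen x = T.vec (T.source hid 0 x hx)) ∨
      (∃ k, x = .ext k ∧ k ∉ window N 0) ∧ (T.sys 0 hid).gen x = 0 := by
  by_cases hx : x.In (window N 0)
  · exact Or.inl ⟨hx, (T.vec_source hid 0 x hx).symm⟩
  · right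
    rcases x with _ | a | k
    · exact absurd trivial hx
    · exact absurd trivial hx
    · refine ⟨⟨k, rfl, hx⟩, ?_⟩
      change (shifted N 0 (.ext k)).elim 0 T.emb = 0
      have : shifted N 0 (.ext k : Vocab S ℕ) = none := dif_neg hx
      rw [this]
      rfl

theorem sys_U_or_zero (T : Transformer S N H m) (hid : Fin T.layers → Fin M → Fin m)
    (ω : Vocab S ℕ) :
    (∃ hω : ω.In (window N 0), ∀ y, (T.sys 0 hid).U ω y = T.U y (item N 0 ω hω)) ∨
      ∀ y, (T.sys 0 hid).U ω y = 0 := by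
  by_cases hω : ω.In (window N 0)
  · exact Or.inl ⟨hω, T.sys_U hid 0 ω hω⟩
  · right
    rcases ω with _ | a | k
    · exact absurd trivial hω
    · exact absurd trivial hω
    · intro y
      change (shifted N 0 (.ext k)).elim 0 T.row y = 0
      have : shifted N 0 (.ext k : Vocab S ℕ) = none := dif_neg hω
      rw [this]
      rfl

/-- Interactions of extended symbols in the output with anything else vanish. -/
def UnembedSeparated (T : Transformer S N H m) : Prop :=
  ∀ P i v, ¬ Source.IsExt v → T.prodUnembed P (.ext i) v = 0

theorem table_good (T : Transformer S N H m) (hid : Fin T.layers → Fin M → Fin m) {Δ p : ℕ} {c : ℝ}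
    (hc : 0 ≤ c) (hT : T.Local Δ) (h0 : T.UnembedSeparated)
    (hattn : ∀ l h P P' v w, T.prodAttn l h P P' v w ∈ grid p c)
    (hun : ∀ P ω w, T.prodUnembed P ω w ∈ grid p c)
    (hmlp : ∀ P l s w, T.prodMlp P l s w ∈ grid p c) (hb : ∀ l s, T.b l s ∈ grid p c) :
    (T.table hid).Good Δ p c where
  attn_mem l h P P' x y := by
    change ⟪T.K l h (T.pathProd P ((T.sys 0 hid).gen (x.rel y))),
      T.Q l h (T.pathProd P' ((T.sys 0 hid).gen (y.rel x)))⟫_ℝ ∈ _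
    rcases T.gen_eq_vec_or_zero hid (x.rel y) with ⟨hx, e⟩ | ⟨-, e⟩
    · rcases T.gen_eq_vec_or_zero hid (y.rel x) with ⟨hy, e'⟩ | ⟨-, e'⟩
      · rw [e, e']
        exact hattn _ _ _ _ _ _
      · rw [e', map_zero, map_zero, inner_zero_right]
        exact zero_mem_grid hc
    · rw [e, map_zero, map_zero, inner_zero_left]
      exact zero_mem_grid hc
  unembed_mem P ω y := by
    change (T.sys 0 hid).U (ω.rel y) (T.pathProd P ((T.sys 0 hid).gen (y.rel ω))) ∈ _
    rcases T.gen_eq_vec_or_zero hid (y.rel ω) with ⟨hy, e⟩ | ⟨-, e⟩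
    · rcases T.sys_U_or_zero hid (ω.rel y) with ⟨hω, e'⟩ | e'
      · rw [e, e']
        exact hun _ _ _
      · rw [e']
        exact zero_mem_grid hc
    · rw [e, map_zero, map_zero]
      exact zero_mem_grid hc
  mlp_mem P l s y := by
    change T.A l (T.pathProd P ((T.sys 0 hid).gen
      (y.rel (Vocab.start : Vocab S ℕ)))) (hid l s) ∈ _
    rcases T.gen_eq_vec_or_zero hid (y.rel (Vocab.start : Vocab S ℕ)) with ⟨hy, e⟩ | ⟨-, e⟩
    · rw [e]
      exact hmlp _ _ _ _
    · rw [e, map_zero, map_zero]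
      exact zero_mem_grid hc
  bias_mem l s := hb _ _
  attn_rel l h P P' x y := by
    simp only [table, Vocab.rel_rel]
  unembed_rel P ω y := by
    simp only [table, Vocab.rel_rel]
  mlp_rel P l s y := by
    have := Vocab.rel_rel y (Vocab.start : Vocab S ℕ)
    simp only [table]
    rw [show ((y.rel (Vocab.start : Vocab S ℕ)).rel (Vocab.start : Vocab S ℕ)) = _ from this]
  attn_local l h P P' i j hij := by
    change ⟪T.K l h (T.pathProd P ((T.sys 0 hid).gen (.ext (i - j)))),
      T.Q l h (T.pathProd P' ((T.sys 0 hid).gen (.ext (j - i))))⟫_ℝ = 0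
    rcases T.gen_eq_vec_or_zero hid (.ext (i - j)) with ⟨hx, e⟩ | ⟨-, e⟩
    · rcases T.gen_eq_vec_or_zero hid (.ext (j - i)) with ⟨hy, e'⟩ | ⟨-, e'⟩
      · rw [e, e']
        refine hT.attn_ext l h P P' _ _ ?_
        unfold Nat.dist at hij ⊢
        simp only []
        omega
      · rw [e', map_zero, map_zero, inner_zero_right]
    · rw [e, map_zero, map_zero, inner_zero_left]
  unembed_local P i j hij := by
    change (T.sys 0 hid).U (.ext (i - j)) (T.pathProd P ((T.sys 0 hid).gen (.ext (j - i)))) = 0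
    rcases T.gen_eq_vec_or_zero hid (.ext (j - i)) with ⟨hy, e⟩ | ⟨-, e⟩
    · rcases T.sys_U_or_zero hid (.ext (i - j)) with ⟨hω, e'⟩ | e'
      · rw [e, e']
        refine hT.unembed_ext P _ _ ?_
        unfold Nat.dist at hij ⊢
        simp only []
        omega
      · rw [e']
    · rw [e, map_zero, map_zero]
  unembed_ext P i y hy := by
    have hrel : y.rel (Vocab.ext i : Vocab S ℕ) = y := by
      rcases y with _ | b | j
      · rfl
      · rfl
      · exact absurd rfl (hy j)
    have hrel' : (Vocab.ext i : Vocab S ℕ).rel y = .ext 0 := by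
      rcases y with _ | b | j
      · rfl
      · rfl
      · exact absurd rfl (hy j)
    change (T.sys 0 hid).U ((Vocab.ext i).rel y) (T.pathProd P ((T.sys 0 hid).gen
      (y.rel (Vocab.ext i : Vocab S ℕ)))) = 0
    rw [hrel, hrel']
    rcases T.sys_U_or_zero hid (.ext 0) with ⟨hω, e'⟩ | e'
    · have hyw : y.In (window N 0) := by
        rcases y with _ | b | j
        · trivial
        · trivial
        · exact absurd rfl (hy j)
      rw [e', ← T.vec_source hid 0 y hyw]
      refine h0 P _ _ ?_
      rcases y with _ | (b | ⟨l, s⟩) | j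
      · exact id
      · exact id
      · exact id
      · exact absurd rfl (hy j)
    · exact e' _

theorem norm_list_prod_le {C : ℝ} (hC : 1 ≤ C) (ls : List (H →L[ℝ] H)) (h : ∀ f ∈ ls, ‖f‖ ≤ C) :
    ‖ls.prod‖ ≤ C ^ ls.length := by
  induction ls with
  | nil =>
    rw [List.prod_nil, List.length_nil, pow_zero]
    exact ContinuousLinearMap.norm_id_le
  | cons f ls ih =>
    rw [List.prod_cons, List.length_cons, pow_succ']
    refine (norm_mul_le _ _).trans ?_
    exact mul_le_mul (h f (by simp)) (ih fun g hg => h g (by simp [hg])) (norm_nonneg _)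
      (zero_le_one.trans hC)

theorem norm_pathProd_le (T : Transformer S N H m) {C : ℝ} (hC : 1 ≤ C)
    (hV : ∀ l h, ‖T.V l h‖ ≤ C) (P : T.Path) : ‖T.pathProd P‖ ≤ C ^ T.layers := by
  refine (norm_list_prod_le hC _ fun f hf => ?_).trans_eq (by simp)
  rw [List.mem_reverse, List.mem_ofFn] at hf
  obtain ⟨l, rfl⟩ := hf
  cases P l with
  | none => exact ContinuousLinearMap.norm_id_le.trans hC
  | some h => exact hV l h

/-- Bounds on the operators and vectors that determine the product functions. -/
structure BoundedBy (T : Transformer S N H m) (C : ℝ) : Prop where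
  one_le : 1 ≤ C
  KQ : ∀ l h a b, |⟪T.K l h a, T.Q l h b⟫_ℝ| ≤ C * ‖a‖ * ‖b‖
  V : ∀ l h, ‖T.V l h‖ ≤ C
  A : ∀ l, ‖T.A l‖ ≤ C
  U : ‖T.U‖ ≤ C
  vec : ∀ v, ‖T.vec v‖ ≤ C

namespace BoundedBy

variable {T : Transformer S N H m} {C : ℝ} (hT : T.BoundedBy C)

include hT

theorem norm_path (P : T.Path) (v : Source S N T.layers m) :
    ‖T.pathProd P (T.vec v)‖ ≤ C ^ (T.layers + 1) := by
  rw [pow_succ]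
  exact (T.pathProd P).le_of_opNorm_le_of_le (T.norm_pathProd_le hT.one_le hT.V P) (hT.vec v)

theorem nonneg : 0 ≤ C := zero_le_one.trans hT.one_le

/-- The exponent is the one attention products need: two paths applied to vectors, `L + 1` each, and
one factor for `K` and `Q`. It is used for all kinds of products alike. -/
theorem norm_unembed (P : T.Path) (v : Source S N T.layers m) :
    ‖T.U (T.pathProd P (T.vec v))‖ ≤ C ^ (2 * T.layers + 3) := by
  refine (T.U.le_of_opNorm_le_of_le hT.U (hT.norm_path P v)).trans ?_
  rw [← pow_succ']
  exact pow_le_pow_right₀ hT.one_le (by omega)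

theorem abs_prodUnembed (P : T.Path) (ω : Vocab S (Slot N)) (v : Source S N T.layers m) :
    |T.prodUnembed P ω v| ≤ C ^ (2 * T.layers + 3) :=
  (lp.norm_apply_le_norm two_ne_zero (T.U (T.pathProd P (T.vec v))) ω).trans (hT.norm_unembed P v)

theorem abs_prodMlp (P : T.Path) (l : Fin T.layers) (s : Fin m) (v : Source S N T.layers m) :
    |T.prodMlp P l s v| ≤ C ^ (2 * T.layers + 3) := by
  refine (PiLp.norm_apply_le (T.A l (T.pathProd P (T.vec v))) s).trans ?_
  refine ((T.A l).le_of_opNorm_le_of_le (hT.A l) (hT.norm_path P v)).trans ?_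
  rw [← pow_succ']
  exact pow_le_pow_right₀ hT.one_le (by omega)

theorem abs_prodAttn (l h) (P P' : T.Path) (v w : Source S N T.layers m) :
    |T.prodAttn l h P P' v w| ≤ C ^ (2 * T.layers + 3) := by
  refine (hT.KQ l h _ _).trans ?_
  have := hT.nonneg
  calc C * ‖T.pathProd P (T.vec v)‖ * ‖T.pathProd P' (T.vec w)‖
      ≤ C * C ^ (T.layers + 1) * C ^ (T.layers + 1) := by
        gcongr
        · exact hT.norm_path P v
        · exact hT.norm_path P' w
    _ = C ^ (2 * T.layers + 3) := by ring

/-- By translation invariance a product `a` of an extended output symbol with another source is the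
same for all output symbols, so `n * a ^ 2` is at most the squared norm of the logits, which is
bounded. For large `n` this forces `|a| < 2⁻q`, hence `a = 0` by finite precision. -/
theorem unembed_ext_eq_zero (hinv : T.TranslationInvariant) {q n : ℕ} (hn : (n : ℕ∞) ≤ N)
    (hlt : (C ^ (2 * T.layers + 3) * 2 ^ q) ^ 2 < n) (hq : ∀ P ω w, IsBit q (T.prodUnembed P ω w)) :
    T.UnembedSeparated := by
  intro P i v hv
  refine (hq P (.ext i) v).eq_zero ?_
  by_contra hge
  rw [not_lt] at hge
  let F : Finset (Vocab S (Slot N)) := Finset.univ.map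
    ⟨fun k : Fin n => .ext ⟨k, lt_of_lt_of_le (Nat.cast_lt.2 k.2) hn⟩, fun k k' h => by
      simpa [Fin.ext_iff] using h⟩
  have h1 := sum_sq_le_norm_sq (T.U (T.pathProd P (T.vec v))) F
  have h2 : ∑ ω ∈ F, T.U (T.pathProd P (T.vec v)) ω ^ 2 = n * T.prodUnembed P (.ext i) v ^ 2 := by
    rw [Finset.sum_map]
    refine (Finset.sum_congr rfl fun k _ => ?_).trans (by
      rw [Finset.sum_const, Finset.card_univ, Fintype.card_fin, nsmul_eq_mul])
    have hrefl : v.SameKind v := by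
      rcases v with _ | (_ | _ | _) | _ <;> trivial
    exact congrArg (· ^ 2) (hinv.unembed_const P _ v (.ext i) v trivial hrefl fun h => hv h.2)
  rw [h2] at h1
  have h3 : (1 / 2 ^ q : ℝ) ^ 2 ≤ T.prodUnembed P (.ext i) v ^ 2 := by
    rw [← sq_abs (T.prodUnembed _ _ _)]
    exact pow_le_pow_left₀ (by positivity) hge 2
  have h4 : ‖T.U (T.pathProd P (T.vec v))‖ ^ 2 ≤ (C ^ (2 * T.layers + 3)) ^ 2 :=
    pow_le_pow_left₀ (norm_nonneg _) (hT.norm_unembed P v) 2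
  have h5 : (n : ℝ) * (1 / 2 ^ q : ℝ) ^ 2 ≤ (C ^ (2 * T.layers + 3)) ^ 2 :=
    (mul_le_mul_of_nonneg_left h3 (Nat.cast_nonneg _)).trans (h1.trans h4)
  rw [div_pow, one_pow, mul_one_div, div_le_iff₀ (by positivity)] at h5
  rw [mul_pow] at hlt
  exact absurd hlt (not_lt.2 h5)

end BoundedBy

theorem covers_id (T : Transformer S N H m) : T.Covers fun _ s => s :=
  fun _ => ⟨Function.injective_id, fun s hs => absurd ⟨s, rfl⟩ hs⟩

theorem hasCode_table (T : Transformer S N H m) (hpe : T.NoPE) (hT : T.TranslationInvariant)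
    {hid : Fin T.layers → Fin M → Fin m} (hc : T.Covers hid) :
    T.HasCode ⟨T.layers, T.heads, M, T.table hid⟩ :=
  ⟨hpe, M, hid, T.table hid, rfl, hc, T.realizes_table hT hid⟩

end Transformer

variable {S : Type u} [Finite S]

theorem IsSymbolicLimit.exists_boundedBy {H : Type} [NormedAddCommGroup H] [InnerProductSpace ℝ H]
    {m : ℕ} {T : Transformer S ⊤ H m} (hT : IsSymbolicLimit T) : ∃ C, T.BoundedBy C := by
  obtain ⟨C1, h1⟩ := hT.bounded_pos
  obtain ⟨C2, h2⟩ := hT.bounded_ext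
  obtain ⟨C3, h3⟩ := (Set.finite_range fun a : S => ‖T.emb (.sym a)‖).bddAbove
  obtain ⟨C4, h4⟩ := (Set.finite_range fun q : Fin T.layers × Fin m =>
    ‖T.B q.1 (EuclideanSpace.single q.2 1)‖).bddAbove
  obtain ⟨C5, h5⟩ := (Set.finite_range fun q : Fin T.layers × Fin T.heads =>
    ‖T.K q.1 q.2‖ * ‖T.Q q.1 q.2‖).bddAbove
  obtain ⟨C6, h6⟩ := (Set.finite_range fun q : Fin T.layers × Fin T.heads => ‖T.V q.1 q.2‖).bddAbove
  obtain ⟨C7, h7⟩ := (Set.finite_range fun l : Fin T.layers => ‖T.A l‖).bddAbove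
  obtain ⟨C, hC⟩ : ∃ C, C ∈ upperBounds
      ({1, C1, C2, C3, C4, C5, C6, C7, ‖T.U‖, ‖T.emb .start‖} : Set ℝ) :=
    (Set.toFinite _).bddAbove
  simp only [mem_upperBounds, Set.mem_insert_iff, Set.mem_singleton_iff, forall_eq_or_imp,
    forall_eq] at hC h3 h4 h5 h6 h7
  obtain ⟨c0, c1, c2, c3, c4, c5, c6, c7, c8, c9⟩ := hC
  refine ⟨C, c0, fun l h a b => ?_, fun l h => (h6 _ ⟨(l, h), rfl⟩).trans c6,
    fun l => (h7 _ ⟨l, rfl⟩).trans c7, c8, fun v => ?_⟩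
  · refine (abs_real_inner_le_norm _ _).trans ?_
    have hk := (T.K l h).le_opNorm a
    have hq := (T.Q l h).le_opNorm b
    calc ‖T.K l h a‖ * ‖T.Q l h b‖ ≤ (‖T.K l h‖ * ‖a‖) * (‖T.Q l h‖ * ‖b‖) := by gcongr
      _ = (‖T.K l h‖ * ‖T.Q l h‖) * ‖a‖ * ‖b‖ := by ring
      _ ≤ C * ‖a‖ * ‖b‖ := by
        gcongr
        exact (h5 _ ⟨(l, h), rfl⟩).trans c5
  · rcases v with i | (_ | a | k) | ⟨l, s⟩
    · exact (h1 i).trans c1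
    · exact c9
    · exact (h3 _ ⟨a, rfl⟩).trans c3
    · exact (h2 k).trans c2
    · exact (h4 _ ⟨(l, s), rfl⟩).trans c4

/-- The table of a symbolic limit transformer without positional encodings. -/
theorem IsSymbolicLimit.exists_good {H : Type} [NormedAddCommGroup H] [InnerProductSpace ℝ H]
    {m : ℕ} {T : Transformer S ⊤ H m} (hT : IsSymbolicLimit T) :
    ∃ (Δ : ℕ) (c : ℝ), (T.table (fun _ s => s : Fin T.layers → Fin m → Fin m)).Good Δ T.prec c := by
  obtain ⟨C, hC⟩ := hT.exists_boundedBy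
  obtain ⟨Δ, hΔ⟩ := hT.isLocal
  obtain ⟨Cb, hb⟩ := (Set.finite_range fun q : Fin T.layers × Fin m => |T.b q.1 q.2|).bddAbove
  obtain ⟨n, hn⟩ := exists_nat_gt ((C ^ (2 * T.layers + 3) * 2 ^ T.prec) ^ 2)
  have h0 := hC.unembed_ext_eq_zero hT.translationInvariant (le_top : (n : ℕ∞) ≤ ⊤) hn
    hT.bit_unembed
  have hle := le_max_left (C ^ (2 * T.layers + 3)) Cb
  refine ⟨Δ, max (C ^ (2 * T.layers + 3)) Cb, T.table_good _
    ((pow_nonneg hC.nonneg _).trans hle) hΔ h0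
    (fun l h P P' v w => ⟨hT.bit_attn l h P P' v w, (hC.abs_prodAttn l h P P' v w).trans hle⟩)
    (fun P ω w => ⟨hT.bit_unembed P ω w, (hC.abs_prodUnembed P ω w).trans hle⟩)
    (fun P l s w => ⟨hT.bit_mlp P l s w, (hC.abs_prodMlp P l s w).trans hle⟩)
    (fun l s => ⟨hT.bit_bias l s, (hb ⟨(l, s), rfl⟩).trans (le_max_right _ _)⟩)⟩

end SymbolicLimit

end

/-! ### Codes of finite transformers with bounded regularizer. -/

noncomputable section

namespace SymbolicLimit

universe u

section Euclidean

variable {d e : ℕ}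

theorem map_eq_sum_stdVec {E : Type*} [AddCommGroup E] [Module ℝ E]
    (g : EuclideanSpace ℝ (Fin d) →ₗ[ℝ] E) (x : EuclideanSpace ℝ (Fin d)) :
    g x = ∑ j, x j • g (stdVec j) := by
  have hx : x = ∑ j, x j • stdVec j := by
    have := (EuclideanSpace.basisFun (Fin d) ℝ).sum_repr x
    simpa [stdVec] using this.symm
  conv_lhs => rw [hx]
  simp only [map_sum, map_smul]

theorem isBit_map {p q : ℕ} (g : EuclideanSpace ℝ (Fin d) →ₗ[ℝ] ℝ)
    (hg : ∀ j, IsBit p (g (stdVec j))) {x : EuclideanSpace ℝ (Fin d)} (hx : ∀ j, IsBit q (x j)) :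
    IsBit (q + p) (g x) := by
  rw [map_eq_sum_stdVec]
  exact IsBit.sum _ fun j _ => (hx j).mul (hg j)

theorem isBit_apply {p q : ℕ} (f : EuclideanSpace ℝ (Fin d) →L[ℝ] EuclideanSpace ℝ (Fin e))
    (hf : ∀ i j, IsBit p (f (stdVec j) i)) {x : EuclideanSpace ℝ (Fin d)}
    (hx : ∀ j, IsBit q (x j)) (i : Fin e) : IsBit (q + p) (f x i) :=
  isBit_map ((EuclideanSpace.proj (𝕜 := ℝ) i).toLinearMap ∘ₗ f.toLinearMap) (hf i) hx

theorem isBit_list_prod {p q : ℕ}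
    (ls : List (EuclideanSpace ℝ (Fin d) →L[ℝ] EuclideanSpace ℝ (Fin d)))
    (h : ∀ f ∈ ls, ∀ i j, IsBit p (f (stdVec j) i)) {x : EuclideanSpace ℝ (Fin d)}
    (hx : ∀ j, IsBit q (x j)) (i : Fin d) : IsBit (q + ls.length * p) (ls.prod x i) := by
  induction ls generalizing i with
  | nil => simpa using hx i
  | cons f ls ih =>
    rw [List.prod_cons, List.length_cons, add_mul, one_mul, ← add_assoc]
    exact isBit_apply f (h f (by simp)) (ih fun g hg => h g (by simp [hg])) i

theorem frobenius_nonneg (f : EuclideanSpace ℝ (Fin d) →L[ℝ] EuclideanSpace ℝ (Fin e)) :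
    0 ≤ frobenius f := Real.sqrt_nonneg _

theorem frobenius_sq (f : EuclideanSpace ℝ (Fin d) →L[ℝ] EuclideanSpace ℝ (Fin e)) :
    frobenius f ^ 2 = ∑ j, ∑ i, (f (stdVec j) i) ^ 2 := by
  unfold frobenius
  rw [Real.sq_sqrt (Finset.sum_nonneg fun i _ => Finset.sum_nonneg fun j _ => sq_nonneg _),
    Finset.sum_comm]

theorem norm_le_frobenius (f : EuclideanSpace ℝ (Fin d) →L[ℝ] EuclideanSpace ℝ (Fin e)) :
    ‖f‖ ≤ frobenius f := by
  refine f.opNorm_le_bound (frobenius_nonneg f) fun x => ?_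
  refine abs_le_of_sq_le_sq' ?_ (mul_nonneg (frobenius_nonneg f) (norm_nonneg x)) |>.2
  rw [mul_pow, frobenius_sq, Finset.sum_comm, EuclideanSpace.real_norm_sq_eq,
    EuclideanSpace.real_norm_sq_eq, Finset.sum_mul]
  refine Finset.sum_le_sum fun i _ => ?_
  have : f x i = ∑ j, f (stdVec j) i * x j := by
    rw [show f x i = ((EuclideanSpace.proj (𝕜 := ℝ) i).toLinearMap ∘ₗ f.toLinearMap) x from rfl,
      map_eq_sum_stdVec]
    exact Finset.sum_congr rfl fun j _ => mul_comm _ _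
  rw [this]
  exact Finset.sum_mul_sq_le_sq_mul_sq _ _ _

end Euclidean

theorem grid_mono {p q : ℕ} {c c' : ℝ} (hpq : p ≤ q) (hc : c ≤ c') : grid p c ⊆ grid q c' :=
  fun _ h => ⟨h.1.mono hpq, h.2.trans hc⟩

variable {S : Type u}

theorem ProductTable.Good.mono {L Hd M : ℕ} {D : ProductTable S L Hd M} {Δ Δ' p p' : ℕ} {c c' : ℝ}
    (hD : D.Good Δ p c) (hΔ : Δ ≤ Δ') (hp : p ≤ p') (hc : c ≤ c') : D.Good Δ' p' c' where
  attn_mem l h P P' x y := grid_mono hp hc (hD.attn_mem l h P P' x y)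
  unembed_mem P ω y := grid_mono hp hc (hD.unembed_mem P ω y)
  mlp_mem P l s y := grid_mono hp hc (hD.mlp_mem P l s y)
  bias_mem l s := grid_mono hp hc (hD.bias_mem l s)
  attn_rel := hD.attn_rel
  unembed_rel := hD.unembed_rel
  mlp_rel := hD.mlp_rel
  attn_local l h P P' i j hij := hD.attn_local l h P P' i j (hΔ.trans_lt hij)
  unembed_local P i j hij := hD.unembed_local P i j (hΔ.trans_lt hij)
  unembed_ext := hD.unembed_ext

theorem zeta_nonneg {n : ℕ} (T : FinTransformer S n) : 0 ≤ zeta T := by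
  have h : ∀ (P : Prop) [Decidable P] (x : ℝ), 0 ≤ if P then |x| ^ 2 else 0 := by
    intro P _ x
    split <;> positivity
  unfold zeta
  refine add_nonneg ?_ ?_
  · exact Finset.sum_nonneg fun l _ => Finset.sum_nonneg fun _ _ => Finset.sum_nonneg fun _ _ =>
      Finset.sum_nonneg fun _ _ => add_nonneg
        (Finset.sum_nonneg fun _ _ => Finset.sum_nonneg fun _ _ => h _ _)
        (Finset.sum_nonneg fun _ _ => Finset.sum_nonneg fun _ _ => h _ _)
  · exact Finset.sum_nonneg fun _ _ => Finset.sum_nonneg fun _ _ => Finset.sum_nonneg fun _ _ =>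
      h _ _

theorem regularizer_nonneg {n : ℕ} (T : FinTransformer S n) : 0 ≤ regularizer T := by
  have h1 : ∀ {α : Type} {E : Type} [SeminormedAddCommGroup E] (g : α → E), 0 ≤ ⨆ a, ‖g a‖ :=
    fun g => Real.iSup_nonneg fun a => norm_nonneg _
  have := zeta_nonneg T
  have h2 : 0 ≤ ⨆ ω, ‖T.model.emb ω‖ := Real.iSup_nonneg fun a => norm_nonneg _
  have h3 := Real.iSup_nonneg fun l => frobenius_nonneg (T.model.A l)
  have h4 := Real.iSup_nonneg fun l => frobenius_nonneg (T.model.B l)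
  unfold regularizer
  have a1 := h1 fun q : Fin T.model.layers × Fin T.model.heads =>
    (ContinuousLinearMap.adjoint (T.model.K q.1 q.2)).comp (T.model.Q q.1 q.2)
  have a2 := h1 fun q : Fin T.model.layers × Fin T.model.heads => T.model.V q.1 q.2
  have a3 := h1 T.model.pos
  have a4 := h1 T.model.b
  positivity

/-- Bounds on the individual terms of the regularizer. -/
structure FinTransformer.Within {n : ℕ} (T : FinTransformer S n) (C : ℝ) : Prop where
  layers : T.model.layers ≤ C
  heads : T.model.heads ≤ C
  prec : T.model.prec ≤ C
  roundPrec : T.model.roundPrec ≤ C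
  KQ : ∀ l h, ‖(ContinuousLinearMap.adjoint (T.model.K l h)).comp (T.model.Q l h)‖ ≤ C
  V : ∀ l h, ‖T.model.V l h‖ ≤ C
  A : ∀ l, frobenius (T.model.A l) ≤ C
  B : ∀ l, frobenius (T.model.B l) ≤ C
  U : ‖T.model.U‖ ≤ C
  pos : ∀ i, ‖T.model.pos i‖ ≤ C
  emb : ∀ ω, ‖T.model.emb ω‖ ≤ C
  b : ∀ l, ‖T.model.b l‖ ≤ C

theorem within_of_regularizer_le [Finite S] {n : ℕ} {T : FinTransformer S n} {C : ℝ}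
    (h : regularizer T ≤ C) : T.Within C := by
  have h1 : ∀ {α : Type} {E : Type} [SeminormedAddCommGroup E] (g : α → E), 0 ≤ ⨆ a, ‖g a‖ :=
    fun g => Real.iSup_nonneg fun a => norm_nonneg _
  have h0 := zeta_nonneg T
  have h2 : 0 ≤ ⨆ ω, ‖T.model.emb ω‖ := Real.iSup_nonneg fun a => norm_nonneg _
  have h3 := Real.iSup_nonneg fun l => frobenius_nonneg (T.model.A l)
  have h4 := Real.iSup_nonneg fun l => frobenius_nonneg (T.model.B l)
  have a1 := h1 fun q : Fin T.model.layers × Fin T.model.heads =>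
    (ContinuousLinearMap.adjoint (T.model.K q.1 q.2)).comp (T.model.Q q.1 q.2)
  have a2 := h1 fun q : Fin T.model.layers × Fin T.model.heads => T.model.V q.1 q.2
  have a3 := h1 T.model.pos
  have a4 := h1 T.model.b
  have a5 := norm_nonneg T.model.U
  have b1 : (0 : ℝ) ≤ T.model.layers := Nat.cast_nonneg _
  have b2 : (0 : ℝ) ≤ T.model.heads := Nat.cast_nonneg _
  have b3 : (0 : ℝ) ≤ T.model.prec := Nat.cast_nonneg _
  have b4 : (0 : ℝ) ≤ T.model.roundPrec := Nat.cast_nonneg _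
  have hsup : ∀ {α : Type u} [Finite α] (g : α → ℝ) (a : α), g a ≤ ⨆ a, g a :=
    fun g a => le_ciSup (Set.finite_range g).bddAbove a
  have hsup' : ∀ {α : Type} [Finite α] (g : α → ℝ) (a : α), g a ≤ ⨆ a, g a :=
    fun g a => le_ciSup (Set.finite_range g).bddAbove a
  unfold regularizer at h
  refine ⟨by linarith, by linarith, by linarith, by linarith, fun l k => ?_, fun l k => ?_,
    fun l => ?_, fun l => ?_, by linarith, fun i => ?_, fun ω => ?_, fun l => ?_⟩
  · refine (hsup' (fun q : Fin T.model.layers × Fin T.model.heads =>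
      ‖(ContinuousLinearMap.adjoint (T.model.K q.1 q.2)).comp (T.model.Q q.1 q.2)‖) (l, k)).trans ?_
    linarith
  · refine (hsup' (fun q : Fin T.model.layers × Fin T.model.heads =>
      ‖T.model.V q.1 q.2‖) (l, k)).trans ?_
    linarith
  · exact (hsup' (fun l => frobenius (T.model.A l)) l).trans (by linarith)
  · exact (hsup' (fun l => frobenius (T.model.B l)) l).trans (by linarith)
  · exact (hsup' (fun i => ‖T.model.pos i‖) i).trans (by linarith)
  · exact (hsup (fun ω => ‖T.model.emb ω‖) ω).trans (by linarith)
  · exact (hsup' (fun l => ‖T.model.b l‖) l).trans (by linarith)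

namespace FinTransformer.Within

variable {n : ℕ} {T : FinTransformer S n} {C : ℝ}

theorem boundedBy (hT : T.Within C) (hC : 1 ≤ C) : T.model.BoundedBy C where
  one_le := hC
  KQ l h a b := by
    rw [← ContinuousLinearMap.adjoint_inner_right]
    refine (abs_real_inner_le_norm _ _).trans ?_
    have := ((ContinuousLinearMap.adjoint (T.model.K l h)).comp
      (T.model.Q l h)).le_of_opNorm_le (hT.KQ l h) b
    calc _ ≤ ‖a‖ * (C * ‖b‖) := mul_le_mul_of_nonneg_left this (norm_nonneg a)
      _ = _ := by ring
  V := hT.V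
  A l := (norm_le_frobenius _).trans (hT.A l)
  U := hT.U
  vec v := by
    rcases v with i | ω | ⟨l, s⟩
    · exact hT.pos i
    · exact hT.emb ω
    · refine ((T.model.B l).le_of_opNorm_le ((norm_le_frobenius _).trans (hT.B l)) _).trans_eq ?_
      simp

end FinTransformer.Within

namespace InTheta

variable {n : ℕ} {T : FinTransformer S n}

theorem bit_vec (hT : InTheta T) (v : Source S n T.model.layers T.width) (i) :
    IsBit T.model.prec (T.model.vec v i) := by
  rcases v with j | ω | ⟨l, s⟩
  · exact hT.bit_pos j i
  · exact hT.bit_emb ω i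
  · exact hT.bit_B l i s

theorem bit_path (hT : InTheta T) (P : T.model.Path) (v : Source S n T.model.layers T.width) (i) :
    IsBit (T.model.prec + T.model.layers * T.model.prec) (T.model.pathProd P (T.model.vec v) i) := by
  refine (isBit_list_prod (p := T.model.prec) _ (fun f hf => ?_) (hT.bit_vec v) i).mono ?_
  · rw [List.mem_reverse, List.mem_ofFn] at hf
    obtain ⟨l, rfl⟩ := hf
    cases P l with
    | none =>
      intro i j
      change IsBit _ (EuclideanSpace.single j (1 : ℝ) i)
      rw [PiLp.single_apply]
      split
      · exact IsBit.one _
      · exact IsBit.zero _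
    | some h => exact hT.bit_V l h
  · simp

/-- Precisions add under multiplication: each side contributes a vector, up to `L` value matrices,
and `K` or `Q`. The same precision serves for the other products. -/
theorem bit_prodAttn (hT : InTheta T) (l h P P') (v w : Source S n T.model.layers T.width) :
    IsBit (2 * (2 * T.model.prec + T.model.layers * T.model.prec))
      (T.model.prodAttn l h P P' v w) := by
  unfold Transformer.prodAttn
  rw [PiLp.inner_apply]
  refine IsBit.sum _ fun i _ => ?_
  refine IsBit.mono (le_of_eq ?_) ((isBit_apply _ (hT.bit_Q l h) (hT.bit_path P' w) i).mul
    (isBit_apply _ (hT.bit_K l h) (hT.bit_path P v) i))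
  ring

theorem bit_prodUnembed (hT : InTheta T) (P ω) (v : Source S n T.model.layers T.width) :
    IsBit (2 * (2 * T.model.prec + T.model.layers * T.model.prec))
      (T.model.prodUnembed P ω v) :=
  (isBit_map (T.model.row ω) (hT.bit_U ω) (hT.bit_path P v)).mono (by ring_nf; omega)

theorem bit_prodMlp (hT : InTheta T) (P l s) (v : Source S n T.model.layers T.width) :
    IsBit (2 * (2 * T.model.prec + T.model.layers * T.model.prec))
      (T.model.prodMlp P l s v) :=
  (isBit_apply _ (hT.bit_A l) (hT.bit_path P v) s).mono (by ring_nf; omega)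

/-- The number of hidden units with nonzero output is bounded. -/
theorem exists_covers (hT : InTheta T) {C : ℝ} (hB : ∀ l, frobenius (T.model.B l) ≤ C) :
    ∃ (M : ℕ) (hid : Fin T.model.layers → Fin M → Fin T.width), T.model.Covers hid ∧
      (M : ℝ) ≤ T.model.layers * (C * 2 ^ T.model.prec) ^ 2 := by
  classical
  let F : Fin T.model.layers → Finset (Fin T.width) := fun l =>
    Finset.univ.filter fun s => T.model.B l (stdVec s) ≠ 0
  have hF : ∀ l, ((F l).card : ℝ) ≤ (C * 2 ^ T.model.prec) ^ 2 := by
    intro l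
    -- A nonzero column has an entry of size at least `2⁻p`, so the Frobenius norm bounds the number
    -- of nonzero columns.
    have h1 : ∀ s ∈ F l, (1 / 2 ^ T.model.prec : ℝ) ^ 2 ≤
        ∑ i, (T.model.B l (stdVec s) i) ^ 2 := by
      intro s hs
      obtain ⟨i, hi⟩ : ∃ i, T.model.B l (stdVec s) i ≠ 0 := by
        by_contra hne
        push Not at hne
        exact (Finset.mem_filter.1 hs).2 (PiLp.ext hne)
      have h2 : (1 / 2 ^ T.model.prec : ℝ) ≤ |T.model.B l (stdVec s) i| := by
        by_contra hlt
        exact hi ((hT.bit_B l i s).eq_zero (not_le.1 hlt))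
      refine le_trans ?_ (Finset.single_le_sum (f := fun i => (T.model.B l (stdVec s) i) ^ 2)
        (fun i _ => sq_nonneg _) (Finset.mem_univ i))
      rw [← sq_abs (T.model.B l (stdVec s) i)]
      exact pow_le_pow_left₀ (by positivity) h2 2
    have h2 : (F l).card • (1 / 2 ^ T.model.prec : ℝ) ^ 2 ≤ C ^ 2 :=
      calc _ ≤ ∑ s ∈ F l, ∑ i, (T.model.B l (stdVec s) i) ^ 2 := Finset.card_nsmul_le_sum _ _ _ h1
        _ ≤ ∑ s, ∑ i, (T.model.B l (stdVec s) i) ^ 2 :=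
          Finset.sum_le_sum_of_subset_of_nonneg (Finset.subset_univ _)
            fun s _ _ => Finset.sum_nonneg fun i _ => sq_nonneg _
        _ = frobenius (T.model.B l) ^ 2 := (frobenius_sq _).symm
        _ ≤ C ^ 2 := pow_le_pow_left₀ (frobenius_nonneg _) (hB l) 2
    rw [nsmul_eq_mul, div_pow, one_pow, mul_one_div, div_le_iff₀ (by positivity)] at h2
    rwa [mul_pow]
  -- The union over the layers gives one naming of hidden units for all layers; a named unit may
  -- have zero output in some of them.
  let G : Finset (Fin T.width) := Finset.univ.biUnion F
  refine ⟨G.card, fun _ => G.orderEmbOfFin rfl, fun l => ⟨(G.orderEmbOfFin rfl).injective,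
    fun s hs => ?_⟩, ?_⟩
  · by_contra hne
    refine hs ?_
    rw [Finset.range_orderEmbOfFin]
    exact Finset.mem_biUnion.2 ⟨l, Finset.mem_univ _, Finset.mem_filter.2 ⟨Finset.mem_univ _, hne⟩⟩
  · have : (G.card : ℝ) ≤ ∑ l, ((F l).card : ℝ) := by
      exact_mod_cast Finset.card_biUnion_le
    refine this.trans ((Finset.sum_le_sum fun l _ => hF l).trans_eq ?_)
    simp

end InTheta

/-- In a large context window, a local transformer with bounded regularizer has a bounded code. -/
theorem exists_code_of_regularizer_le [Finite S] (C Δ : ℕ) (hC : 1 ≤ C) :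
    ∃ K n₀ : ℕ, ∀ n, n₀ ≤ n → ∀ T : FinTransformer S n, InTheta T → T.model.NoPE →
      regularizer T ≤ C → T.model.Local Δ → ∃ Z : Code S, Z.Bounded K ∧ T.model.HasCode Z := by
  let q := 2 * (2 * C + C * C)
  let c := C ^ (2 * C + 3)
  let R := C * (C * 2 ^ C) ^ 2
  -- `q` bounds the precision of the product functions, `c` their size and `R` the number of hidden
  -- units. The window must be large enough for `unembed_ext_eq_zero`.
  refine ⟨C + Δ + q + c + R, (c * 2 ^ q) ^ 2 + 1, fun n hn T hT hpe hreg hloc => ?_⟩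
  have hw := within_of_regularizer_le hreg
  have hC' : (1 : ℝ) ≤ C := by exact_mod_cast hC
  have hb := hw.boundedBy hC'
  have hL : T.model.layers ≤ C := by exact_mod_cast hw.layers
  have hH : T.model.heads ≤ C := by exact_mod_cast hw.heads
  have hp : T.model.prec ≤ C := by exact_mod_cast hw.prec
  have hr : T.model.roundPrec ≤ C := by exact_mod_cast hw.roundPrec
  have hbits : 2 * (2 * T.model.prec + T.model.layers * T.model.prec) ≤ q := by
    simp only [q]
    gcongr
  have hpq : T.model.prec ≤ q := by
    simp only [q]
    omega
  have hpow : (C : ℝ) ^ (2 * T.model.layers + 3) ≤ c := by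
    simp only [c]
    push_cast
    exact pow_le_pow_right₀ hC' (by omega)
  have hCc : (C : ℝ) ≤ c := by
    simp only [c]
    push_cast
    exact le_self_pow₀ hC' (by omega)
  have h0 : T.model.UnembedSeparated := by
    refine hb.unembed_ext_eq_zero hT.translationInvariant le_rfl (q := q) ?_
      fun P ω w => (hT.bit_prodUnembed P ω w).mono hbits
    have : ((c : ℝ) * 2 ^ q) ^ 2 < n := by
      exact_mod_cast hn
    refine lt_of_le_of_lt ?_ this
    gcongr
  obtain ⟨M, hid, hcov, hM⟩ := hT.exists_covers hw.B
  have hM' : M ≤ R := by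
    have : (M : ℝ) ≤ R := by
      refine hM.trans ?_
      simp only [R]
      push_cast
      gcongr
      norm_num
    exact_mod_cast this
  have hgood : (T.model.table hid).Good Δ q c :=
    T.model.table_good hid (Nat.cast_nonneg _) hloc h0
      (fun l h P P' v w => ⟨(hT.bit_prodAttn l h P P' v w).mono hbits,
        (hb.abs_prodAttn l h P P' v w).trans hpow⟩)
      (fun P ω w => ⟨(hT.bit_prodUnembed P ω w).mono hbits, (hb.abs_prodUnembed P ω w).trans hpow⟩)
      (fun P l s w => ⟨(hT.bit_prodMlp P l s w).mono hbits, (hb.abs_prodMlp P l s w).trans hpow⟩)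
      (fun l s => ⟨(hT.bit_b l s).mono hpq,
        ((PiLp.norm_apply_le (T.model.b l) s).trans (hw.b l)).trans hCc⟩)
  refine ⟨_, ⟨⟨?_, ?_, ?_, ?_⟩, hgood.mono ?_ ?_ ?_⟩,
    T.model.hasCode_table hpe hT.translationInvariant hcov⟩
  · simp only []; omega
  · simp only []; omega
  · simp only []; omega
  · change T.model.roundPrec ≤ _
    omega
  · omega
  · omega
  · exact_mod_cast (by omega : c ≤ C + Δ + q + c + R)

end SymbolicLimit

end

/-! ### Restriction to smaller windows and its effect on the regularizer. -/

noncomputable section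

namespace SymbolicLimit

universe u

theorem sum_comp_sq_le_norm_sq {I J : Type*} (g : I ↪ J) (x : L2 J) (F : Finset I) :
    ∑ i ∈ F, x (g i) ^ 2 ≤ ‖x‖ ^ 2 := by
  have := sum_sq_le_norm_sq x (F.map g)
  rwa [Finset.sum_map] at this

/-- Pull back square-summable families along an injection. -/
def pullL2 {I J : Type*} (g : I ↪ J) : L2 J →L[ℝ] L2 I :=
  LinearMap.mkContinuous
    { toFun := fun x => ⟨fun i => x (g i), memℓp_gen' (C := ‖x‖ ^ 2) fun F => by
        simpa using sum_comp_sq_le_norm_sq g x F⟩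
      map_add' := fun _ _ => rfl
      map_smul' := fun _ _ => rfl }
    1 fun x => norm_le_of_sum_sq_le _ (by positivity) fun F => by
      rw [one_mul]
      exact sum_comp_sq_le_norm_sq g x F

theorem norm_pullL2_le {I J : Type*} (g : I ↪ J) : ‖pullL2 g‖ ≤ 1 :=
  LinearMap.mkContinuous_norm_le _ zero_le_one _

theorem Vocab.mapExt_injective {A : Type*} {ι κ : Type} {g : ι → κ} (hg : Function.Injective g) :
    Function.Injective (Vocab.mapExt g : Vocab A ι → Vocab A κ) := by
  rintro (_ | _ | _) (_ | _ | _) h <;> simp_all [Vocab.mapExt, hg.eq_iff]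

/-- Inclusion of context windows. -/
def Slot.incl {N N' : ℕ∞} (h : N' ≤ N) : Slot N' ↪ Slot N where
  toFun k := ⟨k.1, k.2.trans_le h⟩
  inj' _ _ e := Subtype.ext (congrArg (fun k : Slot N => k.1) e)

/-- Inclusion of vocabularies. -/
def Vocab.incl (S : Type u) {N N' : ℕ∞} (h : N' ≤ N) : Vocab S (Slot N') ↪ Vocab S (Slot N) where
  toFun := Vocab.mapExt (Slot.incl h)
  inj' := Vocab.mapExt_injective (Slot.incl h).injective

/-- Inclusion of sources. -/
def Source.incl {S : Type u} {N N' : ℕ∞} {L m : ℕ} (h : N' ≤ N) :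
    Source S N' L m → Source S N L m
  | .pos i => .pos (Slot.incl h i)
  | .tok ω => .tok (Vocab.incl S h ω)
  | .mlp l s => .mlp l s

variable {S : Type u}

theorem Vocab.isExt_incl {N N' : ℕ∞} (h : N' ≤ N) (ω : Vocab S (Slot N')) :
    (Vocab.incl S h ω).IsExt ↔ ω.IsExt := by
  cases ω <;> rfl

theorem Vocab.SameKind.incl {N N' : ℕ∞} (h : N' ≤ N) {ω ω' : Vocab S (Slot N')}
    (hω : ω.SameKind ω') : (Vocab.incl S h ω).SameKind (Vocab.incl S h ω') := by
  cases ω <;> cases ω' <;> first | trivial | (cases hω; rfl)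

theorem Source.isExt_incl {N N' : ℕ∞} {L m : ℕ} (h : N' ≤ N) (v : Source S N' L m) :
    (v.incl h).IsExt ↔ v.IsExt := by
  rcases v with _ | ω | _
  · rfl
  · exact Vocab.isExt_incl h ω
  · rfl

theorem Source.isPos_incl {N N' : ℕ∞} {L m : ℕ} (h : N' ≤ N) (v : Source S N' L m) :
    (v.incl h).IsPos ↔ v.IsPos := by
  cases v <;> rfl

theorem Source.SameKind.incl {N N' : ℕ∞} {L m : ℕ} (h : N' ≤ N) {v w : Source S N' L m}
    (hv : v.SameKind w) : (v.incl h).SameKind (w.incl h) := by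
  rcases v with _ | ω | _ <;> rcases w with _ | ω' | _
  case tok.tok => exact Vocab.SameKind.incl h hv
  case pos.pos => trivial
  all_goals
    cases hv
    try rfl

namespace Transformer

variable {N N' : ℕ∞} {H : Type} [NormedAddCommGroup H] [InnerProductSpace ℝ H] {m : ℕ}

/-- Restriction to a smaller context window. -/
def restrict (T : Transformer S N H m) (h : N' ≤ N) : Transformer S N' H m where
  layers := T.layers
  heads := T.heads
  prec := T.prec
  roundPrec := T.roundPrec
  emb ω := T.emb (Vocab.incl S h ω)
  pos i := T.pos (Slot.incl h i)
  K := T.K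
  Q := T.Q
  V := T.V
  A := T.A
  B := T.B
  b := T.b
  act := T.act
  U := (pullL2 (Vocab.incl S h)).comp T.U

variable (T : Transformer S N H m) (h : N' ≤ N)

theorem vec_restrict (v : Source S N' T.layers m) :
    (T.restrict h).vec v = T.vec (v.incl h) := by
  cases v <;> rfl

theorem prodAttn_restrict (l k P P') (v w : Source S N' T.layers m) :
    (T.restrict h).prodAttn l k P P' v w = T.prodAttn l k P P' (v.incl h) (w.incl h) := by
  unfold prodAttn
  rw [← vec_restrict, ← vec_restrict]
  rfl

theorem prodUnembed_restrict (P ω) (v : Source S N' T.layers m) :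
    (T.restrict h).prodUnembed P ω v = T.prodUnembed P (Vocab.incl S h ω) (v.incl h) := by
  unfold prodUnembed
  rw [← vec_restrict]
  rfl

theorem prodMlp_restrict (P l s) (v : Source S N' T.layers m) :
    (T.restrict h).prodMlp P l s v = T.prodMlp P l s (v.incl h) := by
  unfold prodMlp
  rw [← vec_restrict]
  rfl

variable {T}

theorem NoPE.restrict (hT : T.NoPE) : (T.restrict h).NoPE := fun i => hT (Slot.incl h i)

theorem TranslationInvariant.restrict (hT : T.TranslationInvariant) :
    (T.restrict h).TranslationInvariant where
  attn_pos l k P P' _ _ i' j' e :=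
    (T.prodAttn_restrict h l k P P' _ _).trans
      ((hT.attn_pos l k P P' _ _ (Slot.incl h i') (Slot.incl h j') e).trans
        (T.prodAttn_restrict h l k P P' (.pos i') (.pos j')).symm)
  attn_ext l k P P' _ _ i' j' e :=
    (T.prodAttn_restrict h l k P P' _ _).trans
      ((hT.attn_ext l k P P' _ _ (Slot.incl h i') (Slot.incl h j') e).trans
        (T.prodAttn_restrict h l k P P' (.tok (.ext i')) (.tok (.ext j'))).symm)
  unembed_ext P _ _ i' j' e :=
    (T.prodUnembed_restrict h P _ _).trans
      ((hT.unembed_ext P _ _ (Slot.incl h i') (Slot.incl h j') e).trans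
        (T.prodUnembed_restrict h P (.ext i') (.tok (.ext j'))).symm)
  attn_const l k P P' v w _ _ hv hw h1 h2 :=
    (T.prodAttn_restrict h l k P P' _ _).trans
      ((hT.attn_const l k P P' _ _ _ _ (Source.SameKind.incl h hv) (Source.SameKind.incl h hw)
        (fun q => h1 ⟨(Source.isPos_incl h v).1 q.1, (Source.isPos_incl h w).1 q.2⟩)
        (fun q => h2 ⟨(Source.isExt_incl h v).1 q.1, (Source.isExt_incl h w).1 q.2⟩)).trans
          (T.prodAttn_restrict h l k P P' _ _).symm)
  unembed_const P ω w _ _ hω hw h1 :=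
    (T.prodUnembed_restrict h P _ _).trans
      ((hT.unembed_const P _ _ _ _ (Vocab.SameKind.incl h hω) (Source.SameKind.incl h hw)
        (fun q => h1 ⟨(Vocab.isExt_incl h ω).1 q.1, (Source.isExt_incl h w).1 q.2⟩)).trans
          (T.prodUnembed_restrict h P _ _).symm)
  mlp_const P l s _ _ hw :=
    (T.prodMlp_restrict h P l s _).trans
      ((hT.mlp_const P l s _ _ (Source.SameKind.incl h hw)).trans
        (T.prodMlp_restrict h P l s _).symm)

theorem logits_restrict (hT : T.NoPE) (ε : ℝ) (op oc : ℕ) {w : Word S}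
    (hw : ∀ k, Sum.inr k ∈ w → k ∈ window N' oc) (i : Fin (inputLength w)) {ω : Vocab S ℕ}
    (hω : ω.In (window N' oc)) :
    (T.restrict h).logits ε op oc w i ω = T.logits ε op oc w i ω := by
  have hsub : window N' oc ⊆ window N oc := fun k hk => lt_of_lt_of_le hk h
  have hinit : (T.restrict h).init op oc w = T.init op oc w := by
    funext j
    have hpos : ∀ j, (T.restrict h).posAt j = 0 ∧ T.posAt j = 0 := by
      intro j
      constructor <;> unfold posAt <;> split
      · exact hT _
      · rfl
      · exact hT _
      · rfl
    unfold init
    rw [(hpos _).1, (hpos _).2]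
    congr 1
    have hj := inputToken_in hw j
    generalize inputToken w j = x at hj
    rcases x with _ | a | k
    · rfl
    · rfl
    · rw [embAt_ext _ hj, embAt_ext _ (hsub hj)]
      rfl
  unfold logits
  rw [hinit]
  rcases ω with _ | a | k
  · rfl
  · rfl
  · rw [shifted_ext hω, shifted_ext (hsub hω)]
    rfl

end Transformer

/-- Restriction to a smaller context window. -/
def FinTransformer.restrict {n n' : ℕ} (T : FinTransformer S n) (h : n' ≤ n) :
    FinTransformer S n' :=
  ⟨T.width, T.model.restrict (Nat.cast_le.2 h)⟩

theorem InTheta.restrict {n n' : ℕ} {T : FinTransformer S n} (hT : InTheta T) (h : n' ≤ n) :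
    InTheta (T.restrict h) where
  bit_emb _ := hT.bit_emb _
  bit_pos _ := hT.bit_pos _
  bit_K := hT.bit_K
  bit_Q := hT.bit_Q
  bit_V := hT.bit_V
  bit_A := hT.bit_A
  bit_B := hT.bit_B
  bit_b := hT.bit_b
  bit_U _ := hT.bit_U _
  translationInvariant := hT.translationInvariant.restrict _

theorem mem_window_iff {n oc k : ℕ} : k ∈ window (n : ℕ∞) oc ↔ k + oc < n :=
  Nat.cast_lt (α := ℕ∞) (m := k + oc)

theorem Vocab.in_window {n oc : ℕ} {ω : Vocab S ℕ} (h : ∀ k, ω = .ext k → k + oc < n) :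
    ω.In (window (n : ℕ∞) oc) := by
  cases ω with
  | start => trivial
  | sym a => trivial
  | ext k => exact mem_window_iff.2 (h k rfl)

theorem IsTraining.mono {n n' : ℕ} (h : n' ≤ n) {w : Word S} (hw : IsTraining n' w) :
    IsTraining n w :=
  ⟨hw.1.trans h, fun k hk => (hw.2.1 k hk).trans_le h,
    fun k k' hk hk' => (hw.2.2 k k' hk hk').trans (by omega)⟩

/-- Training inputs and admissible offsets for the smaller window are also admissible for the larger
one, and the restriction computes the same logits there. -/
theorem restrict_mem_candidates {ε : ℝ} {f : Task S} {n n' : ℕ} {T : FinTransformer S n}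
    (hT : T ∈ candidates ε f n) (h : n' ≤ n) : T.restrict h ∈ candidates ε f n' := by
  refine ⟨hT.1.restrict h, hT.2.1.restrict _, fun w hw op oc hop hoc hfit i ω hω => ?_⟩
  refine (Transformer.logits_restrict _ hT.2.1 ε op oc
    (fun k hk => mem_window_iff.2 (hfit k hk)) i (Vocab.in_window hω)).trans ?_
  exact hT.2.2 w (hw.mono h) op oc (hop.trans h) (hoc.trans h)
    (fun k hk => (hfit k hk).trans_le h) i ω fun k hk => (hω k hk).trans_le h

/-- Carries a gain `t` in one summand through a sum; applied once for each of the nested sums in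
`zeta`. -/
theorem sum_add_le {α : Type*} [Fintype α] {f g : α → ℝ} {t : ℝ} (h : ∀ a, f a ≤ g a) (a : α)
    (ha : f a + t ≤ g a) : ∑ a, f a + t ≤ ∑ a, g a := by
  have := Finset.single_le_sum (f := fun a => g a - f a) (fun a _ => sub_nonneg.2 (h a))
    (Finset.mem_univ a)
  rw [Finset.sum_sub_distrib] at this
  linarith

theorem sum_comp_add_le {α β : Type*} [Fintype α] [Fintype β] (g : α ↪ β) {F : β → β → ℝ}
    (hF : ∀ i j, 0 ≤ F i j) (i j : β) (hij : ¬ (i ∈ Set.range g ∧ j ∈ Set.range g)) :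
    ∑ a, ∑ b, F (g a) (g b) + F i j ≤ ∑ i, ∑ j, F i j := by
  classical
  rw [← Finset.sum_product', ← Finset.sum_product']
  have hmem : (i, j) ∉ (Finset.univ ×ˢ Finset.univ : Finset (α × α)).map (g.prodMap g) := by
    simp only [Finset.mem_map, Function.Embedding.coe_prodMap, Prod.map, Prod.mk.injEq]
    rintro ⟨⟨a, b⟩, -, rfl, rfl⟩
    exact hij ⟨⟨a, rfl⟩, ⟨b, rfl⟩⟩
  calc _ = ∑ q ∈ insert (i, j) ((Finset.univ ×ˢ Finset.univ).map (g.prodMap g)), F q.1 q.2 := by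
        rw [Finset.sum_insert hmem, Finset.sum_map, add_comm]
        rfl
    _ ≤ _ := Finset.sum_le_sum_of_subset_of_nonneg (fun _ _ => by simp) fun q _ _ => hF _ _

theorem sum_comp_le {α β : Type*} [Fintype α] [Fintype β] (g : α ↪ β) {F : β → β → ℝ}
    (hF : ∀ i j, 0 ≤ F i j) : ∑ a, ∑ b, F (g a) (g b) ≤ ∑ i, ∑ j, F i j := by
  refine (Finset.sum_le_sum fun a _ => ?_).trans
    ((Finset.sum_map Finset.univ g fun i => ∑ j, F i j).symm.trans_le
      (Finset.sum_le_sum_of_subset_of_nonneg (Finset.subset_univ _)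
        fun i _ _ => Finset.sum_nonneg fun j _ => hF i j))
  refine (Finset.sum_map Finset.univ g fun j => F (g a) j).symm.trans_le ?_
  exact Finset.sum_le_sum_of_subset_of_nonneg (Finset.subset_univ _) fun j _ _ => hF _ j

section Zeta

variable {n n' : ℕ} (T : FinTransformer S n) (h : n' ≤ n)

theorem ite_sq_nonneg (P : Prop) [Decidable P] (x : ℝ) : 0 ≤ if P then |x| ^ 2 else 0 := by
  split <;> positivity

/-- The part of `zeta` that belongs to one head and two sets of value matrices. -/
def zetaAttn (l : Fin T.model.layers) (k : Fin T.model.heads) (P P' : T.model.Path) : ℝ :=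
  (∑ i : Slot (n : ℕ∞), ∑ j : Slot (n : ℕ∞),
      if (i : ℕ) = 0 then |T.model.prodAttn l k P P' (.pos i) (.pos j)| ^ 2 else 0) +
    ∑ i : Slot (n : ℕ∞), ∑ j : Slot (n : ℕ∞),
      if (i : ℕ) = 0 ∨ (j : ℕ) = 0 then
        |T.model.prodAttn l k P P' (.tok (.ext i)) (.tok (.ext j))| ^ 2 else 0

/-- The part of `zeta` that belongs to the unembedding and a set of value matrices. -/
def zetaUnembed (P : T.model.Path) : ℝ :=
  ∑ i : Slot (n : ℕ∞), ∑ j : Slot (n : ℕ∞), if (i : ℕ) = 0 ∨ (j : ℕ) = 0 then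
    |T.model.prodUnembed P (.ext i) (.tok (.ext j))| ^ 2 else 0

theorem zeta_eq : zeta T = (∑ l, ∑ k, ∑ P, ∑ P', zetaAttn T l k P P') + ∑ P, zetaUnembed T P := rfl

theorem zetaAttn_restrict_le (l k P P') :
    zetaAttn (T.restrict h) l k P P' ≤ zetaAttn T l k P P' :=
  add_le_add
    (sum_comp_le (Slot.incl (Nat.cast_le.2 h)) (F := fun i j : Slot (n : ℕ∞) =>
      if (i : ℕ) = 0 then |T.model.prodAttn l k P P' (.pos i) (.pos j)| ^ 2 else 0)
      fun _ _ => ite_sq_nonneg _ _)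
    (sum_comp_le (Slot.incl (Nat.cast_le.2 h)) (F := fun i j : Slot (n : ℕ∞) =>
      if (i : ℕ) = 0 ∨ (j : ℕ) = 0 then
        |T.model.prodAttn l k P P' (.tok (.ext i)) (.tok (.ext j))| ^ 2 else 0)
      fun _ _ => ite_sq_nonneg _ _)

theorem zetaUnembed_restrict_le (P) : zetaUnembed (T.restrict h) P ≤ zetaUnembed T P :=
  sum_comp_le (Slot.incl (Nat.cast_le.2 h)) (F := fun i j : Slot (n : ℕ∞) =>
    if (i : ℕ) = 0 ∨ (j : ℕ) = 0 then
      |T.model.prodUnembed P (.ext i) (.tok (.ext j))| ^ 2 else 0)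
    fun _ _ => ite_sq_nonneg _ _

theorem not_mem_range_incl {i j : Slot (n : ℕ∞)} (hij : n' ≤ i ∨ n' ≤ j) :
    ¬ (i ∈ Set.range (Slot.incl (Nat.cast_le.2 h : (n' : ℕ∞) ≤ n)) ∧
      j ∈ Set.range (Slot.incl (Nat.cast_le.2 h : (n' : ℕ∞) ≤ n))) := by
  rintro ⟨⟨a, rfl⟩, ⟨b, rfl⟩⟩
  have ha : (a : ℕ) < n' := by exact_mod_cast a.2
  have hb : (b : ℕ) < n' := by exact_mod_cast b.2
  exact hij.elim (not_le.2 ha) (not_le.2 hb)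

/-- The square of this interaction is a term of `zeta T` that involves a symbol outside the smaller
window, so it is missing from `zeta` of the restriction. -/
theorem zeta_restrict_add_attn_le (l k P P') {i j : Slot (n : ℕ∞)} (h0 : (i : ℕ) = 0 ∨ (j : ℕ) = 0)
    (hij : n' ≤ i ∨ n' ≤ j) : zeta (T.restrict h) +
      T.model.prodAttn l k P P' (.tok (.ext i)) (.tok (.ext j)) ^ 2 ≤ zeta T := by
  have key : zetaAttn (T.restrict h) l k P P' +
      T.model.prodAttn l k P P' (.tok (.ext i)) (.tok (.ext j)) ^ 2 ≤ zetaAttn T l k P P' := by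
    have h1 := sum_comp_le (Slot.incl (Nat.cast_le.2 h : (n' : ℕ∞) ≤ n))
      (F := fun i j : Slot (n : ℕ∞) =>
        if (i : ℕ) = 0 then |T.model.prodAttn l k P P' (.pos i) (.pos j)| ^ 2 else 0)
      fun _ _ => ite_sq_nonneg _ _
    have h2 := sum_comp_add_le (Slot.incl (Nat.cast_le.2 h : (n' : ℕ∞) ≤ n))
      (F := fun i j : Slot (n : ℕ∞) => if (i : ℕ) = 0 ∨ (j : ℕ) = 0 then
        |T.model.prodAttn l k P P' (.tok (.ext i)) (.tok (.ext j))| ^ 2 else 0)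
      (fun _ _ => ite_sq_nonneg _ _) i j (not_mem_range_incl h hij)
    rw [if_pos h0, sq_abs] at h2
    have h3 := add_le_add h1 h2
    rw [← add_assoc] at h3
    exact h3
  have hle := zetaAttn_restrict_le T h
  rw [zeta_eq, zeta_eq, add_right_comm]
  refine add_le_add ?_ (Finset.sum_le_sum fun P _ => zetaUnembed_restrict_le T h P)
  refine sum_add_le (fun l => Finset.sum_le_sum fun k _ => Finset.sum_le_sum fun P _ =>
    Finset.sum_le_sum fun P' _ => hle l k P P') l ?_
  refine sum_add_le (fun k => Finset.sum_le_sum fun P _ =>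
    Finset.sum_le_sum fun P' _ => hle l k P P') k ?_
  refine sum_add_le (fun P => Finset.sum_le_sum fun P' _ => hle l k P P') P ?_
  exact sum_add_le (fun P' => hle l k P P') P' key

theorem zeta_restrict_add_unembed_le (P) {i j : Slot (n : ℕ∞)}
    (h0 : (i : ℕ) = 0 ∨ (j : ℕ) = 0) (hij : n' ≤ i ∨ n' ≤ j) : zeta (T.restrict h) +
      T.model.prodUnembed P (.ext i) (.tok (.ext j)) ^ 2 ≤ zeta T := by
  have key : zetaUnembed (T.restrict h) P +
      T.model.prodUnembed P (.ext i) (.tok (.ext j)) ^ 2 ≤ zetaUnembed T P := by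
    have h2 := sum_comp_add_le (Slot.incl (Nat.cast_le.2 h : (n' : ℕ∞) ≤ n))
      (F := fun i j : Slot (n : ℕ∞) => if (i : ℕ) = 0 ∨ (j : ℕ) = 0 then
        |T.model.prodUnembed P (.ext i) (.tok (.ext j))| ^ 2 else 0)
      (fun _ _ => ite_sq_nonneg _ _) i j (not_mem_range_incl h hij)
    rw [if_pos h0, sq_abs] at h2
    exact h2
  rw [zeta_eq, zeta_eq, add_assoc]
  refine add_le_add (Finset.sum_le_sum fun l _ => Finset.sum_le_sum fun k _ =>
    Finset.sum_le_sum fun P _ => Finset.sum_le_sum fun P' _ => zetaAttn_restrict_le T h l k P P') ?_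
  exact sum_add_le (zetaUnembed_restrict_le T h) P key

theorem iSup_incl_le {α β : Type*} [Finite β] (g : α → β) {F : β → ℝ} (hF : ∀ b, 0 ≤ F b) :
    ⨆ a, F (g a) ≤ ⨆ b, F b :=
  Real.iSup_le (fun a => le_ciSup (Set.finite_range F).bddAbove (g a)) (Real.iSup_nonneg hF)

/-- Restriction shrinks the unembedding norm and the suprema over embeddings and positions, and
leaves all else but `zeta` unchanged. So the regularizer drops at least as much as `zeta`. -/
theorem regularizer_restrict_le [Finite S] :
    regularizer (T.restrict h) ≤ regularizer T - (zeta T - zeta (T.restrict h)) := by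
  have h1 : ‖(T.restrict h).model.U‖ ≤ ‖T.model.U‖ :=
    (ContinuousLinearMap.opNorm_comp_le _ _).trans
      (mul_le_of_le_one_left (norm_nonneg _) (norm_pullL2_le _))
  have h2 : ⨆ i, ‖(T.restrict h).model.pos i‖ ≤ ⨆ i, ‖T.model.pos i‖ :=
    iSup_incl_le (Slot.incl (Nat.cast_le.2 h)) fun _ => norm_nonneg _
  have h3 : ⨆ ω, ‖(T.restrict h).model.emb ω‖ ≤ ⨆ ω, ‖T.model.emb ω‖ :=
    iSup_incl_le (Vocab.incl S (Nat.cast_le.2 h)) fun _ => norm_nonneg _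
  obtain ⟨c₁, c₂, c₃, e, e'⟩ : ∃ c₁ c₂ c₃ : ℝ,
      regularizer T = c₁ + (c₂ + ‖T.model.U‖) +
        ((⨆ i, ‖T.model.pos i‖) + (⨆ ω, ‖T.model.emb ω‖) + c₃) + zeta T ∧
      regularizer (T.restrict h) = c₁ + (c₂ + ‖(T.restrict h).model.U‖) +
        ((⨆ i, ‖(T.restrict h).model.pos i‖) + (⨆ ω, ‖(T.restrict h).model.emb ω‖) + c₃) +
          zeta (T.restrict h) := ⟨_, _, _, rfl, rfl⟩
  rw [e, e']
  linarith

end Zeta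

end SymbolicLimit

end

/-! ### Runs: locality, recurrent codes and the limit. -/

noncomputable section

namespace SymbolicLimit

universe u

variable {S : Type u} [Finite S]

/-- If restriction to a smaller context window hardly decreases the regularizer, then the
transformer is local. -/
theorem local_of_regularizer_lt {n n' q : ℕ} {T : FinTransformer S n} (hT : InTheta T)
    (hpe : T.model.NoPE) (h : n' ≤ n)
    (hq : 2 * (2 * T.model.prec + T.model.layers * T.model.prec) ≤ q)
    (hlt : regularizer T < regularizer (T.restrict h) + (1 / 2 ^ q) ^ 2) : T.model.Local n' := by
  have hz : zeta T < zeta (T.restrict h) + (1 / 2 ^ q) ^ 2 := by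
    have := regularizer_restrict_le T h
    linarith
  -- A nonzero number with `q` fractional bits would cost at least `(2⁻q) ^ 2`, more than the
  -- restriction saves.
  have hzero : ∀ x : ℝ, IsBit q x → zeta (T.restrict h) + x ^ 2 ≤ zeta T → x = 0 := by
    intro x hx hle
    refine hx.eq_zero (abs_lt_of_sq_lt_sq (by linarith) (by positivity))
  -- A far pair is translated until the smaller index is `0`, the first extended symbol; the other
  -- index then lies outside the smaller window, and `zeta` penalizes the pair.
  have hsub : ∀ {i j : Slot (n : ℕ∞)}, n' < Nat.dist i j → ∃ i' j' : Slot (n : ℕ∞),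
      ((i : ℕ) + j' = i' + j) ∧ ((i' : ℕ) = 0 ∨ (j' : ℕ) = 0) ∧ (n' ≤ i' ∨ n' ≤ j') := by
    intro i j hij
    unfold Nat.dist at hij
    refine ⟨⟨(i : ℕ) - j, lt_of_le_of_lt (Nat.cast_le.2 (Nat.sub_le _ _)) i.2⟩,
      ⟨(j : ℕ) - i, lt_of_le_of_lt (Nat.cast_le.2 (Nat.sub_le _ _)) j.2⟩, ?_, ?_, ?_⟩ <;>
    · simp only []
      omega
  refine ⟨fun l k P P' i j _ => ?_, fun l k P P' i j hij => ?_, fun P i j hij => ?_⟩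
  · change ⟪T.model.K l k (T.model.pathProd P (T.model.pos i)), _⟫_ℝ = 0
    rw [hpe i, map_zero, map_zero, inner_zero_left]
  · obtain ⟨i', j', e, h0, hfar⟩ := hsub hij
    rw [hT.translationInvariant.attn_ext l k P P' i j i' j' e]
    exact hzero _ ((hT.bit_prodAttn _ _ _ _ _ _).mono hq)
      (zeta_restrict_add_attn_le T h l k P P' h0 hfar)
  · obtain ⟨i', j', e, h0, hfar⟩ := hsub hij
    rw [hT.translationInvariant.unembed_ext P i j i' j' e]
    exact hzero _ ((hT.bit_prodUnembed _ _ _).mono hq)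
      (zeta_restrict_add_unembed_le T h P h0 hfar)

theorem bddBelow_regularizer {S : Type u} {n : ℕ} (s : Set (FinTransformer S n)) :
    BddBelow (regularizer '' s) :=
  ⟨0, by
    rintro _ ⟨T, -, rfl⟩
    exact regularizer_nonneg T⟩

variable {ε : ℝ} {f : Task S}

theorem exists_isRun {S : Type u} {ε : ℝ} {f : Task S} (h : ∀ n, (candidates ε f n).Nonempty) :
    ∃ T : (n : ℕ) → FinTransformer S n, IsRun ε f T := by
  have key : ∀ n : ℕ, ∃ T : FinTransformer S n, 1 ≤ n → T ∈ candidates ε f n ∧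
      regularizer T ≤ 1 / (n : ℝ) + sInf (regularizer '' candidates ε f n) := by
    intro n
    by_cases hn : 1 ≤ n
    · obtain ⟨_, ⟨T, hT, rfl⟩, hlt⟩ := Real.lt_sInf_add_pos ((h n).image regularizer)
        (by positivity : 0 < 1 / (n : ℝ))
      exact ⟨T, fun _ => ⟨hT, by linarith⟩⟩
    · exact ⟨(h n).some, fun h' => absurd h' hn⟩
  choose T hT using key
  exact ⟨T, hT⟩

namespace IsRun

variable {T : (n : ℕ) → FinTransformer S n}

/-- From some point on, the members of a run with bounded regularizer are local, with the same
bandwidth. -/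
theorem exists_local (hT : IsRun ε f T) {C : ℕ} (hC : ∀ n, 1 ≤ n → regularizer (T n) ≤ C) :
    ∃ Δ n₀ : ℕ, ∀ n, n₀ ≤ n → 1 ≤ n ∧ (T n).model.Local Δ := by
  let q := 2 * (2 * C + C * C)
  let ρ : ℕ → ℝ := fun n => sInf (regularizer '' candidates ε f n)
  have hδ : (0 : ℝ) < (1 / 2 ^ q) ^ 2 / 2 := by positivity
  have hρ : ∀ n, 1 ≤ n → ρ n ≤ regularizer (T n) := fun n hn =>
    csInf_le (bddBelow_regularizer _) ⟨_, (hT n hn).1, rfl⟩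
  have hbdd : BddAbove (Set.range fun n => ρ (n + 1)) := ⟨C, by
    rintro _ ⟨n, rfl⟩
    exact (hρ _ (by omega)).trans (hC _ (by omega))⟩
  -- At window `k + 1` the infimum is within half the tolerance of the supremum of all infima. The
  -- slack `1 / n` takes up the other half.
  obtain ⟨_, ⟨k, rfl⟩, hk⟩ := exists_lt_of_lt_csSup (Set.range_nonempty fun n => ρ (n + 1))
    (sub_lt_self _ hδ)
  obtain ⟨n₂, hn₂⟩ := exists_nat_gt (((1 / 2 ^ q) ^ 2 / 2 : ℝ)⁻¹)
  refine ⟨k + 1, max (k + 1) n₂, fun n hn => ⟨by omega, ?_⟩⟩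
  have hn1 : 1 ≤ n := by omega
  have hle : k + 1 ≤ n := by omega
  obtain ⟨hmem, hreg⟩ := hT n hn1
  have hw := within_of_regularizer_le (hC n hn1)
  have hL : (T n).model.layers ≤ C := by exact_mod_cast hw.layers
  have hp : (T n).model.prec ≤ C := by exact_mod_cast hw.prec
  refine local_of_regularizer_lt (q := q) hmem.1 hmem.2.1 hle (by simp only [q]; gcongr) ?_
  have h1 : 1 / (n : ℝ) < (1 / 2 ^ q) ^ 2 / 2 := by
    rw [one_div]
    refine inv_lt_of_inv_lt₀ hδ (hn₂.trans_le ?_)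
    exact_mod_cast (by omega : n₂ ≤ n)
  have h2 : ρ n ≤ sSup (Set.range fun n => ρ (n + 1)) :=
    le_csSup hbdd ⟨n - 1, by simp only []; rw [Nat.sub_add_cancel hn1]⟩
  -- The restricted transformer competes in window `k + 1`, so its regularizer is almost as large as
  -- that of `T n`.
  have h3 : ρ (k + 1) ≤ regularizer ((T n).restrict hle) :=
    csInf_le (bddBelow_regularizer _) ⟨_, restrict_mem_candidates hmem hle, rfl⟩
  have h4 : regularizer (T n) ≤ 1 / (n : ℝ) + ρ n := hreg
  simp only [] at hk
  linarith

/-- From some point on, the members of a run with bounded regularizer have one of finitely many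
codes, each of which occurs infinitely often. -/
theorem exists_code (hT : IsRun ε f T) {C : ℝ} (hC : ∀ n, 1 ≤ n → regularizer (T n) ≤ C) :
    ∃ K n₀ : ℕ, ∀ n, n₀ ≤ n → ∃ Z : Code S, Z.Bounded K ∧ (T n).model.HasCode Z ∧
      ∃ᶠ n' in Filter.atTop, (T n').model.HasCode Z := by
  obtain ⟨c, hc⟩ := exists_nat_ge C
  have hc' : ∀ n, 1 ≤ n → regularizer (T n) ≤ (c + 1 : ℕ) := fun n hn => by
    push_cast
    linarith [hC n hn]
  obtain ⟨Δ, n₁, hloc⟩ := hT.exists_local hc'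
  obtain ⟨K, n₂, hcode⟩ := exists_code_of_regularizer_le (S := S) (c + 1) Δ (by omega)
  -- Of finitely many codes, those that occur only finitely often have all disappeared from some
  -- point on.
  have hev : ∀ᶠ n in Filter.atTop, ∀ Z ∈ {Z : Code S | Z.Bounded K}, (T n).model.HasCode Z →
      ∃ᶠ n' in Filter.atTop, (T n').model.HasCode Z := by
    refine (Filter.eventually_all_finite (Code.bounded_finite K)).2 fun Z _ => ?_
    by_cases h : ∃ᶠ n' in Filter.atTop, (T n').model.HasCode Z
    · exact Filter.Eventually.of_forall fun _ _ => h
    · rw [Filter.not_frequently] at h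
      exact h.mono fun n hn h' => absurd h' hn
  obtain ⟨n₃, hn₃⟩ := Filter.eventually_atTop.1 hev
  refine ⟨K, max n₁ (max n₂ n₃), fun n hn => ?_⟩
  obtain ⟨hn1, hl⟩ := hloc n (by omega)
  obtain ⟨Z, hZ, hTZ⟩ := hcode n (by omega) (T n) (hT n hn1).1.1 (hT n hn1).1.2.1 (hc' n hn1) hl
  exact ⟨Z, hZ, hTZ, hn₃ n (by omega) Z hZ hTZ⟩

omit [Finite S] in
/-- A code that occurs infinitely often in a run computes the task. -/
theorem logits_eq_of_frequently (hT : IsRun ε f T) {Z : Code S}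
    (hZ : ∃ᶠ n in Filter.atTop, (T n).model.HasCode Z) {N : ℕ∞} {H : Type}
    [NormedAddCommGroup H] [InnerProductSpace ℝ H] {m : ℕ} {T' : Transformer S N H m}
    (hT' : T'.HasCode Z) (op oc : ℕ) {w : Word S} (hw : ∀ k, Sum.inr k ∈ w → k ∈ window N oc)
    (i : Fin (inputLength w)) {ω : Vocab S ℕ} (hω : ω.In (window N oc)) :
    T'.logits ε op oc w i ω = f w i ω := by
  let B : ℕ := (w.map (Sum.elim (fun _ => 0) id)).sum
  have hB : ∀ k, Sum.inr k ∈ w → k ≤ B := fun k hk =>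
    List.le_sum_of_mem (List.mem_map.2 ⟨_, hk, rfl⟩)
  obtain ⟨D, hD⟩ : ∃ D, ∀ k, ω = .ext k → k ≤ D := by
    rcases ω with _ | a | k
    · exact ⟨0, fun k h => nomatch h⟩
    · exact ⟨0, fun k h => nomatch h⟩
    · exact ⟨k, fun k' h => by cases h; exact le_rfl⟩
  -- The window is so large that `w` is a training input at offset `0` and `ω` is one of the output
  -- symbols: `B` bounds the extended indices in `w`, and `D` that of `ω`.
  obtain ⟨n, hn, hTn⟩ := Filter.frequently_atTop.1 hZ (2 * inputLength w + 2 * B + D + 1)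
  have hfit : SymbolsFit n 0 w := fun k hk => by
    have := hB k hk
    omega
  have hωn : ∀ k, ω = .ext k → k + 0 < n := fun k hk => by
    have := hD k hk
    omega
  have htrain : IsTraining n w := ⟨by omega, hfit, fun k k' hk _ => by
    have := hB k hk
    omega⟩
  rw [hT'.logits_eq hTn ε op oc 0 0 w hw (fun k hk => mem_window_iff.2 (hfit k hk)) i hω
    (Vocab.in_window hωn)]
  exact (hT n (by omega)).1.2.2 w htrain 0 0 (by omega) (by omega) hfit i ω hωn

/-- A code describes the transformer at every character offset, so a recurrent code settles all
offsets and all inputs at once. -/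
theorem generalizesInLimit (hT : IsRun ε f T) {C : ℝ}
    (hC : ∀ n, 1 ≤ n → regularizer (T n) ≤ C) : GeneralizesInLimit ε f T := by
  refine ⟨⟨C, hC⟩, ?_⟩
  obtain ⟨K, n₀, h⟩ := hT.exists_code hC
  refine ⟨n₀, fun n hn w _ _ op oc _ _ hfit i ω hω => ?_⟩
  obtain ⟨Z, -, hZ, hfreq⟩ := h n hn.le
  exact hT.logits_eq_of_frequently hfreq hZ op oc (fun k hk => mem_window_iff.2 (hfit k hk)) i
    (Vocab.in_window hω)

theorem expressibleNoPE (hT : IsRun ε f T) {C : ℝ}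
    (hC : ∀ n, 1 ≤ n → regularizer (T n) ≤ C) : ExpressibleNoPE ε f := by
  obtain ⟨K, n₀, h⟩ := hT.exists_code hC
  obtain ⟨⟨L, Hd, M, D⟩, hb, -, hfreq⟩ := h n₀ le_rfl
  obtain ⟨H, i1, i2, i3, m, T', hlim, hcode⟩ := hb.2.exists_limitTransformer
  have htop : ∀ k, k ∈ window ⊤ 0 := fun k => ENat.natCast_lt_top (k + 0)
  refine ⟨H, i1, i2, i3, m, T', hlim, hcode.1, fun w i ω => ?_⟩
  refine hT.logits_eq_of_frequently hfreq hcode 0 0 (fun k _ => htop k) i ?_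
  cases ω <;> first | trivial | exact htop _

end IsRun

/-- The tasks of symbolic limit transformers are learned with bounded regularizer. -/
theorem ExpressibleNoPE.exists_candidate (hf : ExpressibleNoPE ε f) :
    ∃ R : ℝ, ∀ n, ∃ T ∈ candidates ε f n, regularizer T ≤ R := by
  obtain ⟨H, _, _, _, m, T, hT, hpe, hTf⟩ := hf
  obtain ⟨Δ, c, hD⟩ := hT.exists_good
  have hcode := T.hasCode_table hpe hT.translationInvariant T.covers_id
  refine ⟨ProductTable.Good.regularizerBound (T.table fun _ s => s) Δ T.prec c, fun n => ?_⟩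
  obtain ⟨T', hT', hcode', hreg⟩ := hD.exists_finTransformer n
  refine ⟨T', ⟨hT', hcode'.1, fun w _ op oc _ _ hfit i ω hω => ?_⟩, hreg⟩
  have htop : ∀ k, k ∈ window ⊤ 0 := fun k => ENat.natCast_lt_top (k + 0)
  rw [← hTf w i ω]
  refine hcode'.logits_eq hcode ε op oc 0 0 w (fun k hk => mem_window_iff.2 (hfit k hk))
    (fun k _ => htop k) i (Vocab.in_window hω) ?_
  cases ω <;> first | trivial | exact htop _

end SymbolicLimit

end

theorem corollaryC {S : Type*} [Finite S] (ε : ℝ) (hε : 0 < ε) (f : SymbolicLimit.Task S) :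
    SymbolicLimit.ExpressibleNoPE ε f ↔
      (∃ T : (n : ℕ) → SymbolicLimit.FinTransformer S n, SymbolicLimit.IsRun ε f T) ∧
      ∀ T : (n : ℕ) → SymbolicLimit.FinTransformer S n, SymbolicLimit.IsRun ε f T →
        SymbolicLimit.GeneralizesInLimit ε f T := by
  constructor
  · intro hf
    obtain ⟨R, hR⟩ := hf.exists_candidate
    refine ⟨SymbolicLimit.exists_isRun fun n => ?_, fun T hT => ?_⟩
    · obtain ⟨T, hT, -⟩ := hR n
      exact ⟨T, hT⟩
    -- `R` bounds the infimum through the realization of the limit table, and the slack `1 / n` is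
    -- at most `1`.
    · refine hT.generalizesInLimit (C := 1 + R) fun n hn => ?_
      obtain ⟨T', hT', hle⟩ := hR n
      have h1 : sInf (SymbolicLimit.regularizer '' SymbolicLimit.candidates ε f n) ≤ R :=
        (csInf_le (SymbolicLimit.bddBelow_regularizer _) ⟨T', hT', rfl⟩).trans hle
      have h2 : 1 / (n : ℝ) ≤ 1 := by
        rw [div_le_one (by exact_mod_cast hn)]
        exact_mod_cast hn
      exact (hT n hn).2.trans (add_le_add h2 h1)
  -- A single run with bounded regularizer suffices here; the correctness of its code comes from the
  -- training inputs.
  · rintro ⟨⟨T, hT⟩, h⟩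
    obtain ⟨⟨C, hC⟩, -⟩ := h T hT
    exact hT.expressibleNoPE hC
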